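/- Let $P_\infty(x)=\sum_{n\ge 0}\frac{\xi_n}{\sqrt{n!}}x^n$, where $\xi_0,\xi_1,\dots$ are i.i.d. standard real Gaussian random variables, and let $Z$ be the random multiset of the real zeros of $P_\infty$, each repeated according to its multiplicity. A locally integrable $\rho:\mathbb R^m\to\mathbb R$ is called an $m$-point correlation function of $Z$ if for every compactly supported $C^\infty$ function $f:\mathbb R^m\to\mathbb R$ the sum below is integrable and $$\mathbb E\sum_{(z_1,\dots,z_m)} f(z_1,\dots,z_m)=\int_{\mathbb R^m} f(y)\,\rho(y)\,dy,$$ where the sum is over all ordered $m$-tuples of different elements of the multiset $Z$. For every $m\ge 1$ an $m$-point correlation function of $Z$ exists and has a continuous version; let $\rho=\rho^{(m)}$ denote this version. For every $k$ there are finite positive constants $\Delta_k$ and $C_k$, depending only on $k$, such that the following holds. Let $X=(x_1,\dots,x_k)\in\mathbb R^k$, let $\{1,\dots,k\}=I\sqcup J$ be a partition into two nonempty sets, put $X_I=(x_i)_{i\in I}$, $X_J=(x_j)_{j\in J}$ and $d=\min_{i\in I,\,j\in J}|x_i-x_j|$, and suppose that $d\ge 2\Delta_k$. (a) If $x_1,\dots,x_k$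 are distinct, then $\rho(X_I)>0$, $\rho(X_J)>0$ and $$\left|\frac{\rho(X)}{\rho(X_I)\rho(X_J)}-1\right|\le C_k\,e^{-\frac12(d-\Delta_k)^2}.$$ (b) In all cases (the points need not be distinct), $$\left|\rho(X)-\rho(X_I)\rho(X_J)\right|\le C_k\,e^{-\frac12(d-\Delta_k)^2}.$$ -/

import Mathlib

open MeasureTheory ProbabilityTheory
open scoped Nat

/-- `ξ 0, ξ 1, …` are independent standard normal random variables on `(Ω, P)`. -/
structure IsStdGaussianSeq {Ω : Type*} [MeasurableSpace Ω] (P : Measure Ω)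
    (ξ : ℕ → Ω → ℝ) : Prop where
  indep : iIndepFun ξ P
  law : ∀ n, HasLaw (ξ n) (gaussianReal 0 1) P

/-- The Weyl series `∑ₙ aₙ xⁿ / √(n!)` with coefficients `a`. -/
noncomputable def weylSeries (a : ℕ → ℝ) (x : ℝ) : ℝ :=
  ∑' n : ℕ, a n / √(n ! : ℝ) * x ^ n

/-- A labelling of the multiset of real zeros of a real analytic function `F`: a zero `x` of
multiplicity `r` carries the labels `(x, 0), …, (x, r - 1)`.
(The order of vanishing is `0` at a point where `F` does not vanish.) -/
def ZeroLabel (F : ℝ → ℝ) : Type :=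
  {p : ℝ × ℕ // (p.2 : ℕ∞) < analyticOrderAt F p.1}

/-- The location of a labelled zero. -/
def ZeroLabel.point {F : ℝ → ℝ} (l : ZeroLabel F) : ℝ := l.1.1

/-- `∑ f (z₁, …, zₘ)` over all ordered `m`-tuples of different elements of the multiset of real
zeros of `F`, that is, over all injective choices of `m` labels. -/
noncomputable def zeroTupleSum (F : ℝ → ℝ) (m : ℕ) (f : (Fin m → ℝ) → ℝ) : ℝ :=
  ∑' e : Fin m ↪ ZeroLabel F, f (fun i => (e i).point)

/-- `ρ` is an `m`-point correlation function of the point process of real zeros (counted with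
multiplicity) of the random function `F`: for every smooth compactly supported `f`,
`𝔼 ∑ f (z₁, …, zₘ) = ∫ f ρ`, both sides being well defined. -/
structure IsCorrelationFunction {Ω : Type*} [MeasurableSpace Ω] (P : Measure Ω)
    (F : Ω → ℝ → ℝ) (m : ℕ) (ρ : (Fin m → ℝ) → ℝ) : Prop where
  locallyIntegrable : LocallyIntegrable ρ volume
  integrable_sum : ∀ f : (Fin m → ℝ) → ℝ, ContDiff ℝ ((⊤ : ℕ∞) : WithTop ℕ∞) f → HasCompactSupport f →
    Integrable (fun ω => zeroTupleSum (F ω) m f) P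
  integral_sum : ∀ f : (Fin m → ℝ) → ℝ, ContDiff ℝ ((⊤ : ℕ∞) : WithTop ℕ∞) f → HasCompactSupport f →
    ∫ ω, zeroTupleSum (F ω) m f ∂P = ∫ x, f x * ρ x

/-- The subconfiguration `X_I = (x_i)_{i ∈ I}`, listed by increasing index. -/
def subConfig {k : ℕ} (x : Fin k → ℝ) (I : Finset (Fin k)) : Fin I.card → ℝ :=
  fun i => x (I.orderEmbOfFin rfl i)

/-- The distance `min {|x_i - x_j| : i ∈ I, j ∈ J}` of the clusters `X_I` and `X_J`
(for nonempty `I` and `J`). -/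
noncomputable def clusterDist {k : ℕ} (x : Fin k → ℝ) (I J : Finset (Fin k)) : ℝ :=
  ⨅ p : I × J, |x p.1 - x p.2|

open scoped ENNReal Topology Matrix

section AreaFormula

variable {E : Type*} [NormedAddCommGroup E] [NormedSpace ℝ E] [FiniteDimensional ℝ E]
  [MeasurableSpace E] [BorelSpace E] (μ : Measure E) [μ.IsAddHaarMeasure]

/-- The sum of `f` over the points of `s` in the fibre of `Φ` over `a`. -/
noncomputable def fiberSum {X Y : Type*} (Φ : X → Y) (s : Set X) (f : X → ℝ≥0∞) (a : Y) : ℝ≥0∞ :=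
  ∑' x : X, {x | x ∈ s ∧ Φ x = a}.indicator f x

theorem fiberSum_apply_of_injOn {X Y : Type*} {Φ : X → Y} {s : Set X} (h : Set.InjOn Φ s)
    (f : X → ℝ≥0∞) {x : X} (hx : x ∈ s) : fiberSum Φ s f (Φ x) = f x := by
  unfold fiberSum
  rw [tsum_eq_single x]
  · simp [hx]
  · intro y hy
    refine Set.indicator_of_notMem ?_ _
    rintro ⟨h1, h2⟩
    exact hy (h h1 hx h2)

theorem fiberSum_eq_zero {X Y : Type*} {Φ : X → Y} {s : Set X}
    (f : X → ℝ≥0∞) {a : Y} (ha : a ∉ Φ '' s) : fiberSum Φ s f a = 0 := by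
  unfold fiberSum
  rw [ENNReal.tsum_eq_zero]
  intro y
  refine Set.indicator_of_notMem ?_ _
  rintro ⟨h1, h2⟩
  exact ha ⟨y, h1, h2⟩

theorem fiberSum_iUnion {X Y : Type*} {Φ : X → Y} {s : ℕ → Set X}
    (hs : Pairwise (Function.onFun Disjoint s)) (f : X → ℝ≥0∞) (a : Y) :
    fiberSum Φ (⋃ n, s n) f a = ∑' n, fiberSum Φ (s n) f a := by
  unfold fiberSum
  rw [ENNReal.tsum_comm]
  congr 1
  ext x
  by_cases hx : ∃ n, x ∈ s n
  · obtain ⟨n, hn⟩ := hx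
    rw [tsum_eq_single n]
    · by_cases h : Φ x = a
      · rw [Set.indicator_of_mem, Set.indicator_of_mem]
        · exact ⟨hn, h⟩
        · exact ⟨Set.mem_iUnion.2 ⟨n, hn⟩, h⟩
      · rw [Set.indicator_of_notMem, Set.indicator_of_notMem]
        · exact fun H => h H.2
        · exact fun H => h H.2
    · intro k hk
      refine Set.indicator_of_notMem ?_ _
      rintro ⟨h1, -⟩
      exact Set.disjoint_left.1 (hs hk) h1 hn
  · push Not at hx
    rw [Set.indicator_of_notMem]
    · symm
      rw [ENNReal.tsum_eq_zero]
      intro n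
      refine Set.indicator_of_notMem ?_ _
      exact fun H => hx n H.1
    · rintro ⟨h1, -⟩
      obtain ⟨n, hn⟩ := Set.mem_iUnion.1 h1
      exact hx n hn

theorem lintegral_fiberSum_of_injOn {Φ : E → E} {Φ' : E → E →L[ℝ] E} {s : Set E}
    (hs : MeasurableSet s) (hΦ : ∀ x ∈ s, HasFDerivWithinAt Φ (Φ' x) s x) (hinj : Set.InjOn Φ s)
    {f : E → ℝ≥0∞} (hf : Measurable f) :
    Measurable (fiberSum Φ s f) ∧
      ∫⁻ a, fiberSum Φ s f a ∂μ = ∫⁻ x in s, ENNReal.ofReal |(Φ' x).det| * f x ∂μ := by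
  constructor
  · have h1 := measurableEmbedding_of_fderivWithin hs hΦ hinj
    have h2 : fiberSum Φ s f = Function.extend (s.domRestrict Φ) (fun x => f x) (fun _ => 0) := by
      ext a
      by_cases ha : a ∈ Φ '' s
      · obtain ⟨x, hx, rfl⟩ := ha
        rw [fiberSum_apply_of_injOn hinj f hx]
        have := h1.injective.extend_apply (fun x : s => f x) (fun _ => 0) ⟨x, hx⟩
        simpa using this.symm
      · rw [fiberSum_eq_zero f ha, Function.extend_apply']
        rintro ⟨x, hx⟩
        exact ha ⟨x, x.2, hx⟩
    rw [h2]
    exact h1.measurable_extend (hf.comp measurable_subtype_coe) measurable_const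
  · have hm : MeasurableSet (Φ '' s) := measurable_image_of_fderivWithin hs hΦ hinj
    have h1 : ∫⁻ a, fiberSum Φ s f a ∂μ = ∫⁻ a in Φ '' s, fiberSum Φ s f a ∂μ := by
      rw [← lintegral_indicator hm]
      congr 1
      ext a
      by_cases ha : a ∈ Φ '' s
      · rw [Set.indicator_of_mem ha]
      · rw [Set.indicator_of_notMem ha, fiberSum_eq_zero f ha]
    rw [h1, lintegral_image_eq_lintegral_abs_det_fderiv_mul μ hs hΦ hinj]
    refine setLIntegral_congr_fun hs ?_
    intro x hx
    simp only [fiberSum_apply_of_injOn hinj f hx]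

theorem exists_injOn_partition {Φ : E → E} {V : Set E} (hV : IsOpen V)
    (hΦ : ContDiffOn ℝ 1 Φ V) (hdet : ∀ x ∈ V, (fderiv ℝ Φ x).det ≠ 0) :
    ∃ D : ℕ → Set E, (∀ n, MeasurableSet (D n)) ∧ Pairwise (Function.onFun Disjoint D) ∧
      (∀ n, Set.InjOn Φ (D n)) ∧ (⋃ n, D n) = V := by
  have key : ∀ x ∈ V, ∃ W : Set E, IsOpen W ∧ x ∈ W ∧ Set.InjOn Φ W := by
    intro x hx
    have hc : ContDiffAt ℝ 1 Φ x := hΦ.contDiffAt (hV.mem_nhds hx)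
    let A : E ≃L[ℝ] E := ContinuousLinearMap.toContinuousLinearEquivOfDetNeZero _ (hdet x hx)
    have hd : HasFDerivAt Φ (A : E →L[ℝ] E) x := by
      have := (hc.differentiableAt one_ne_zero).hasFDerivAt
      simpa [A] using this
    refine ⟨(hc.toOpenPartialHomeomorph Φ hd one_ne_zero).source, 
      (hc.toOpenPartialHomeomorph Φ hd one_ne_zero).open_source,
      hc.mem_toOpenPartialHomeomorph_source hd one_ne_zero, ?_⟩
    exact (hc.toOpenPartialHomeomorph Φ hd one_ne_zero).injOn
  choose! W hWo hWx hWi using key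
  obtain ⟨t, htV, htc, ht⟩ := TopologicalSpace.countable_cover_nhdsWithin
    (f := W) (s := V) (fun x hx => mem_nhdsWithin_of_mem_nhds ((hWo x hx).mem_nhds (hWx x hx)))
  rcases t.eq_empty_or_nonempty with rfl | hne
  · refine ⟨fun _ => ∅, fun _ => MeasurableSet.empty, fun i j _ => disjoint_bot_left, 
      fun _ => Set.injOn_empty _, ?_⟩
    simpa using (Set.subset_empty_iff.1 (by simpa using ht)).symm
  · obtain ⟨u, hu⟩ := htc.exists_eq_range hne
    have hut : ∀ n, u n ∈ t := fun n => hu ▸ Set.mem_range_self n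
    refine ⟨disjointed (fun n => W (u n) ∩ V), ?_, disjoint_disjointed _, ?_, ?_⟩
    · exact fun n => MeasurableSet.disjointed
        (fun n => ((hWo _ (htV (hut n))).inter hV).measurableSet) n
    · exact fun n => (hWi _ (htV (hut n))).mono
        ((disjointed_subset _ n).trans Set.inter_subset_left)
    · rw [iUnion_disjointed, ← Set.iUnion_inter]
      refine Set.inter_eq_right.2 (ht.trans ?_)
      rw [hu]
      simp

theorem lintegral_fiberSum {Φ : E → E} {U : Set E} (hU : IsOpen U) (hΦ : ContDiffOn ℝ 1 Φ U)
    {f : E → ℝ≥0∞} (hf : Measurable f) :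
    AEMeasurable (fiberSum Φ U f) μ ∧
      ∫⁻ a, fiberSum Φ U f a ∂μ
        = ∫⁻ x in U, ENNReal.ofReal |(fderiv ℝ Φ x).det| * f x ∂μ := by
  have hcont : ContinuousOn (fun x => (fderiv ℝ Φ x).det) U :=
    ContinuousLinearMap.continuous_det.comp_continuousOn
      (hΦ.continuousOn_fderiv_of_isOpen hU le_rfl)
  set V : Set E := U ∩ {x | (fderiv ℝ Φ x).det ≠ 0} with hVdef
  have hV : IsOpen V := hcont.isOpen_inter_preimage hU isOpen_ne
  obtain ⟨D, hDm, hDd, hDi, hDU⟩ := exists_injOn_partition hV (hΦ.mono Set.inter_subset_left)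
    (fun x hx => hx.2)
  have hDV : ∀ n, D n ⊆ V := fun n => hDU ▸ Set.subset_iUnion D n
  have hder : ∀ x ∈ U, HasFDerivAt Φ (fderiv ℝ Φ x) x := fun x hx =>
    ((hΦ.contDiffAt (hU.mem_nhds hx)).differentiableAt one_ne_zero).hasFDerivAt
  have hcrit : μ (Φ '' (U \ V)) = 0 := by
    refine addHaar_image_eq_zero_of_det_fderivWithin_eq_zero μ
      (f' := fderiv ℝ Φ) (fun x hx => (hder x hx.1).hasFDerivWithinAt) ?_
    intro x hx
    by_contra h
    exact hx.2 ⟨hx.1, h⟩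
  have hae : fiberSum Φ U f =ᵐ[μ] fun a => ∑' n, fiberSum Φ (D n) f a := by
    have : ∀ᵐ a ∂μ, a ∉ Φ '' (U \ V) := by
      exact measure_eq_zero_iff_ae_notMem.1 hcrit
    filter_upwards [this] with a ha
    rw [← fiberSum_iUnion hDd, hDU]
    unfold fiberSum
    congr 1
    ext x
    congr 1
    ext y
    simp only [Set.mem_ofPred_eq]
    constructor
    · rintro ⟨h1, h2⟩
      refine ⟨?_, h2⟩
      by_contra h3
      exact ha ⟨y, ⟨h1, h3⟩, h2⟩
    · exact fun h => ⟨h.1.1, h.2⟩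
  have hn := fun n => lintegral_fiberSum_of_injOn μ (hDm n)
    (fun x hx => (hder x (hDV n hx).1).hasFDerivWithinAt) (hDi n) hf
  refine ⟨⟨_, Measurable.tsum fun n => (hn n).1, hae⟩, ?_⟩
  rw [lintegral_congr_ae hae, lintegral_tsum fun n => (hn n).1.aemeasurable]
  simp_rw [fun n => (hn n).2]
  rw [← lintegral_iUnion hDm hDd, hDU, ← lintegral_indicator hV.measurableSet,
    ← lintegral_indicator hU.measurableSet]
  congr 1
  ext x
  by_cases hx : x ∈ V
  · rw [Set.indicator_of_mem hx, Set.indicator_of_mem hx.1]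
  · rw [Set.indicator_of_notMem hx]
    by_cases hx' : x ∈ U
    · rw [Set.indicator_of_mem hx']
      have : (fderiv ℝ Φ x).det = 0 := by
        by_contra h
        exact hx ⟨hx', h⟩
      simp [this]
    · rw [Set.indicator_of_notMem hx']

end AreaFormula

section WeylFunctions

/-- The functions `exp (-x²/2) xⁿ / √(n!)`: an orthonormal basis of the reproducing kernel Hilbert
space of the kernel `exp (-(x - y)²/2)`. -/
noncomputable def weylFun (n : ℕ) (x : ℝ) : ℝ :=
  Real.exp (-x ^ 2 / 2) * (x ^ n / √(n ! : ℝ))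

/-- The derivative of `weylFun n`. -/
noncomputable def weylFunDeriv (n : ℕ) (x : ℝ) : ℝ :=
  Real.exp (-x ^ 2 / 2) * ((n * x ^ (n - 1) - x ^ (n + 1)) / √(n ! : ℝ))

/-- The normalised Weyl series `exp (-x²/2) ∑ aₙ xⁿ / √(n!)`. -/
noncomputable def normSeries (a : ℕ → ℝ) (x : ℝ) : ℝ := ∑' n, a n * weylFun n x

/-- The derivative of the normalised Weyl series. -/
noncomputable def normSeriesDeriv (a : ℕ → ℝ) (x : ℝ) : ℝ := ∑' n, a n * weylFunDeriv n x

/-- The sequence `a` grows at most like `S * 2 ^ n`. -/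
def HasGrowth (a : ℕ → ℝ) (S : ℝ) : Prop := ∀ n, |a n| ≤ S * 2 ^ n

theorem HasGrowth.nonneg {a : ℕ → ℝ} {S : ℝ} (h : HasGrowth a S) : 0 ≤ S := by
  have := h 0
  simp at this
  exact (abs_nonneg _).trans this

theorem sqrt_factorial_pos (n : ℕ) : 0 < √(n ! : ℝ) :=
  Real.sqrt_pos.2 (by exact_mod_cast n.factorial_pos)

theorem pow_div_sqrt_factorial_le_exp (r : ℝ) (n : ℕ) :
    r ^ n / √(n ! : ℝ) ≤ Real.exp (r ^ 2 / 2) := by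
  have h1 : (r ^ 2) ^ n / (n ! : ℝ) ≤ Real.exp (r ^ 2) :=
    Real.pow_div_factorial_le_exp _ (by positivity) n
  have h2 : (r ^ n / √(n ! : ℝ)) ^ 2 ≤ Real.exp (r ^ 2 / 2) ^ 2 := by
    rw [div_pow, Real.sq_sqrt (by positivity), ← Real.exp_nat_mul]
    convert! h1 using 2
    · ring
    · push_cast; ring
  exact le_of_sq_le_sq h2 (Real.exp_pos _).le

theorem pow_div_sqrt_factorial_le (r : ℝ) (n : ℕ) :
    r ^ n / √(n ! : ℝ) ≤ Real.exp (2 * r ^ 2) * (1 / 2) ^ n := by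
  have h := pow_div_sqrt_factorial_le_exp (2 * r) n
  rw [mul_pow] at h
  have h2 : r ^ n / √(n ! : ℝ) = (2 ^ n * r ^ n / √(n ! : ℝ)) * (1 / 2) ^ n := by
    rw [div_pow]; field_simp; simp
  rw [h2]
  have h3 : (2 * r) ^ 2 / 2 = 2 * r ^ 2 := by ring
  rw [h3] at h
  gcongr

/-- A bound for `|weylFun n|` and `|weylFunDeriv n|` on `[-R, R]`, times `2 ^ n`. -/
theorem weylFun_bounds {R : ℝ} (hR : 1 ≤ R) {x : ℝ} (hx : |x| ≤ R) (n : ℕ) :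
    2 ^ n * |weylFun n x| ≤ (1 + R) * Real.exp (32 * R ^ 2) * (1 / 2) ^ n ∧
    2 ^ n * |weylFunDeriv n x| ≤ (1 + R) * Real.exp (32 * R ^ 2) * (1 / 2) ^ n := by
  have hs := sqrt_factorial_pos n
  have key : (4 * R) ^ n / √(n ! : ℝ) ≤ Real.exp (32 * R ^ 2) * (1 / 2) ^ n := by
    have := pow_div_sqrt_factorial_le (4 * R) n
    convert! this using 3
    ring
  have hexp : Real.exp (-x ^ 2 / 2) ≤ 1 := by
    rw [Real.exp_le_one_iff]; nlinarith [sq_nonneg x]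
  have hpow : |x| ^ n ≤ R ^ n := by gcongr
  have h2n : (1 : ℝ) ≤ 2 ^ n := one_le_pow₀ (by norm_num)
  have hRn : (1 : ℝ) ≤ R ^ n := one_le_pow₀ hR
  have h4 : (4 * R) ^ n = 2 ^ n * (2 ^ n * R ^ n) := by
    rw [← mul_assoc, ← mul_pow, ← mul_pow]; norm_num
  have main : ∀ y : ℝ, |y| ≤ (1 + R) * (2 ^ n * R ^ n) →
      2 ^ n * |Real.exp (-x ^ 2 / 2) * (y / √(n ! : ℝ))|
        ≤ (1 + R) * Real.exp (32 * R ^ 2) * (1 / 2) ^ n := by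
    intro y hy
    rw [abs_mul, abs_div, abs_of_pos hs, abs_of_pos (Real.exp_pos _)]
    calc 2 ^ n * (Real.exp (-x ^ 2 / 2) * (|y| / √(n ! : ℝ)))
        ≤ 2 ^ n * (1 * (((1 + R) * (2 ^ n * R ^ n)) / √(n ! : ℝ))) := by gcongr
      _ = (1 + R) * ((4 * R) ^ n / √(n ! : ℝ)) := by rw [h4]; ring
      _ ≤ (1 + R) * (Real.exp (32 * R ^ 2) * (1 / 2) ^ n) := by gcongr
      _ = _ := by ring
  constructor
  · refine main _ ?_
    rw [abs_pow]
    calc |x| ^ n ≤ R ^ n := hpow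
      _ = 1 * (1 * R ^ n) := by ring
      _ ≤ (1 + R) * (2 ^ n * R ^ n) := by gcongr; linarith
  · refine main _ ?_
    have hn : (n : ℝ) + 1 ≤ 2 ^ n := by exact_mod_cast Nat.lt_two_pow_self
    have hp1 : |x| ^ (n - 1) ≤ R ^ n :=
      calc |x| ^ (n - 1) ≤ R ^ (n - 1) := by gcongr
        _ ≤ R ^ n := pow_le_pow_right₀ hR (Nat.sub_le _ _)
    have hp2 : |x| ^ (n + 1) ≤ R * R ^ n := by
      calc |x| ^ (n + 1) ≤ R ^ (n + 1) := by gcongr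
        _ = R * R ^ n := by ring
    calc |n * x ^ (n - 1) - x ^ (n + 1)| ≤ |n * x ^ (n - 1)| + |x ^ (n + 1)| := abs_sub _ _
      _ = n * |x| ^ (n - 1) + |x| ^ (n + 1) := by simp [abs_mul, abs_pow]
      _ ≤ n * R ^ n + R * R ^ n := by gcongr
      _ ≤ (1 + R) * (2 ^ n * R ^ n) := by
        have h0 : (0 : ℝ) ≤ n := Nat.cast_nonneg n
        have : (n : ℝ) + R ≤ (1 + R) * 2 ^ n := by nlinarith
        calc n * R ^ n + R * R ^ n = (n + R) * R ^ n := by ring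
          _ ≤ ((1 + R) * 2 ^ n) * R ^ n := by gcongr
          _ = _ := by ring

theorem summable_geom_const (C : ℝ) : Summable fun n : ℕ => C * (1 / 2 : ℝ) ^ n :=
  summable_geometric_two.mul_left C

theorem HasGrowth.term_bounds {a : ℕ → ℝ} {S : ℝ} (ha : HasGrowth a S) {R : ℝ} (hR : 1 ≤ R)
    {x : ℝ} (hx : |x| ≤ R) (n : ℕ) :
    ‖a n * weylFun n x‖ ≤ S * ((1 + R) * Real.exp (32 * R ^ 2)) * (1 / 2) ^ n ∧
    ‖a n * weylFunDeriv n x‖ ≤ S * ((1 + R) * Real.exp (32 * R ^ 2)) * (1 / 2) ^ n := by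
  have h := weylFun_bounds hR hx n
  have hS := ha.nonneg
  have main : ∀ y : ℝ, 2 ^ n * |y| ≤ (1 + R) * Real.exp (32 * R ^ 2) * (1 / 2) ^ n →
      ‖a n * y‖ ≤ S * ((1 + R) * Real.exp (32 * R ^ 2)) * (1 / 2) ^ n := by
    intro y hy
    rw [Real.norm_eq_abs, abs_mul]
    calc |a n| * |y| ≤ (S * 2 ^ n) * |y| := by gcongr; exact ha n
      _ = S * (2 ^ n * |y|) := by ring
      _ ≤ S * ((1 + R) * Real.exp (32 * R ^ 2) * (1 / 2) ^ n) := by gcongr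
      _ = _ := by ring
  exact ⟨main _ h.1, main _ h.2⟩

theorem exists_bound_abs (x : ℝ) : ∃ R : ℝ, 1 ≤ R ∧ |x| ≤ R :=
  ⟨max 1 |x|, le_max_left _ _, le_max_right _ _⟩

theorem HasGrowth.summable {a : ℕ → ℝ} {S : ℝ} (ha : HasGrowth a S) (x : ℝ) :
    Summable fun n => a n * weylFun n x := by
  obtain ⟨R, hR, hx⟩ := exists_bound_abs x
  exact Summable.of_norm_bounded (summable_geom_const _) (fun n => (ha.term_bounds hR hx n).1)

theorem HasGrowth.summable_deriv {a : ℕ → ℝ} {S : ℝ} (ha : HasGrowth a S) (x : ℝ) :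
    Summable fun n => a n * weylFunDeriv n x := by
  obtain ⟨R, hR, hx⟩ := exists_bound_abs x
  exact Summable.of_norm_bounded (summable_geom_const _) (fun n => (ha.term_bounds hR hx n).2)

theorem hasDerivAt_weylFun (n : ℕ) (x : ℝ) : HasDerivAt (weylFun n) (weylFunDeriv n x) x := by
  have h1 : HasDerivAt (fun x : ℝ => Real.exp (-x ^ 2 / 2)) (Real.exp (-x ^ 2 / 2) * (-x)) x := by
    have : HasDerivAt (fun x : ℝ => -x ^ 2 / 2) (-x) x := by
      convert! ((hasDerivAt_pow 2 x).neg.div_const 2) using 1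
      push_cast; ring
    exact this.exp
  have h2 := h1.mul ((hasDerivAt_pow n x).div_const (√(n ! : ℝ)))
  refine h2.congr_deriv ?_
  unfold weylFunDeriv
  ring

theorem HasGrowth.hasDerivAt {a : ℕ → ℝ} {S : ℝ} (ha : HasGrowth a S) (x : ℝ) :
    HasDerivAt (normSeries a) (normSeriesDeriv a x) x := by
  obtain ⟨R, hR, hx⟩ := exists_bound_abs x
  have hx' : x ∈ Metric.ball (0 : ℝ) (R + 1) := by
    simp only [mem_ball_zero_iff, Real.norm_eq_abs]; linarith
  refine hasDerivAt_tsum_of_isPreconnected (t := Metric.ball (0 : ℝ) (R + 1))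
    (summable_geom_const _) Metric.isOpen_ball (convex_ball _ _).isPreconnected
    (fun n y _ => (hasDerivAt_weylFun n y).const_mul (a n))
    (fun n y hy => (ha.term_bounds (R := R + 1) (by linarith) ?_ n).2) hx' (ha.summable x) hx'
  simp only [mem_ball_zero_iff, Real.norm_eq_abs] at hy
  exact hy.le

theorem continuous_weylFun (n : ℕ) : Continuous (weylFun n) :=
  continuous_iff_continuousAt.2 fun x => (hasDerivAt_weylFun n x).continuousAt

theorem continuous_weylFunDeriv (n : ℕ) : Continuous (weylFunDeriv n) := by
  unfold weylFunDeriv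
  fun_prop

theorem HasGrowth.continuous {a : ℕ → ℝ} {S : ℝ} (ha : HasGrowth a S) :
    Continuous (normSeries a) :=
  continuous_iff_continuousAt.2 fun x => (ha.hasDerivAt x).continuousAt

theorem HasGrowth.continuous_deriv {a : ℕ → ℝ} {S : ℝ} (ha : HasGrowth a S) :
    Continuous (normSeriesDeriv a) := by
  refine continuous_iff_continuousAt.2 fun x => ?_
  obtain ⟨R, hR, hx⟩ := exists_bound_abs x
  have : ContinuousOn (normSeriesDeriv a) (Metric.ball (0 : ℝ) (R + 1)) := by
    refine continuousOn_tsum (fun n => ((continuous_weylFunDeriv n).const_mul _).continuousOn)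
      (summable_geom_const _) (fun n y hy => (ha.term_bounds (R := R + 1) (by linarith) ?_ n).2)
    simp only [mem_ball_zero_iff, Real.norm_eq_abs] at hy
    exact hy.le
  refine this.continuousAt (Metric.isOpen_ball.mem_nhds ?_)
  simp only [mem_ball_zero_iff, Real.norm_eq_abs]; linarith

theorem normSeries_eq (a : ℕ → ℝ) (x : ℝ) :
    normSeries a x = Real.exp (-x ^ 2 / 2) * weylSeries a x := by
  unfold normSeries weylSeries weylFun
  rw [← tsum_mul_left]
  congr 1
  ext n
  ring

theorem normSeries_eq_zero_iff (a : ℕ → ℝ) (x : ℝ) : normSeries a x = 0 ↔ weylSeries a x = 0 := by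
  rw [normSeries_eq]; simp [(Real.exp_pos _).ne']

theorem weylSeries_eq (a : ℕ → ℝ) : weylSeries a = fun x => Real.exp (x ^ 2 / 2) * normSeries a x := by
  ext x
  rw [normSeries_eq, ← mul_assoc, ← Real.exp_add]
  have : x ^ 2 / 2 + -x ^ 2 / 2 = 0 := by ring
  rw [this]; simp

theorem HasGrowth.hasDerivAt_weylSeries {a : ℕ → ℝ} {S : ℝ} (ha : HasGrowth a S) {x : ℝ}
    (hx : normSeries a x = 0) :
    HasDerivAt (weylSeries a) (Real.exp (x ^ 2 / 2) * normSeriesDeriv a x) x := by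
  rw [weylSeries_eq]
  have h1 : DifferentiableAt ℝ (fun x : ℝ => Real.exp (x ^ 2 / 2)) x := by fun_prop
  refine (h1.hasDerivAt.mul (ha.hasDerivAt x)).congr_deriv ?_
  rw [hx]; ring

theorem HasGrowth.analyticAt_weylSeries {a : ℕ → ℝ} {S : ℝ} (ha : HasGrowth a S) (x : ℝ) :
    AnalyticAt ℝ (weylSeries a) x := by
  set p := FormalMultilinearSeries.ofScalars ℝ (fun n : ℕ => a n / √(n ! : ℝ)) with hp
  have hS := ha.nonneg
  have hrad : p.radius = ⊤ := by
    refine FormalMultilinearSeries.radius_eq_top_of_summable_norm _ fun r => ?_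
    refine Summable.of_norm_bounded (summable_geom_const (S * Real.exp (2 * (2 * r) ^ 2))) ?_
    intro n
    rw [norm_mul, norm_norm, hp, FormalMultilinearSeries.ofScalars_norm, norm_div, norm_pow,
      Real.norm_eq_abs, Real.norm_eq_abs, Real.norm_eq_abs, abs_of_pos (sqrt_factorial_pos n),
      abs_of_nonneg r.coe_nonneg]
    have := pow_div_sqrt_factorial_le (2 * r) n
    have hs := sqrt_factorial_pos n
    calc |a n| / √(n ! : ℝ) * (r : ℝ) ^ n ≤ (S * 2 ^ n) / √(n ! : ℝ) * (r : ℝ) ^ n := by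
          gcongr; exact ha n
      _ = S * ((2 * r) ^ n / √(n ! : ℝ)) := by rw [mul_pow]; ring
      _ ≤ S * (Real.exp (2 * (2 * r) ^ 2) * (1 / 2) ^ n) := by gcongr
      _ = S * Real.exp (2 * (2 * (r : ℝ)) ^ 2) * (1 / 2) ^ n := by ring
  have h1 : HasFPowerSeriesOnBall p.sum p 0 p.radius :=
    p.hasFPowerSeriesOnBall (by rw [hrad]; exact ENNReal.zero_lt_top)
  have h2 : p.sum = weylSeries a := by
    ext y
    have := FormalMultilinearSeries.ofScalars_sum_eq (E := ℝ) (fun n : ℕ => a n / √(n ! : ℝ)) y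
    rw [FormalMultilinearSeries.ofScalarsSum] at this
    rw [hp, this]
    simp [weylSeries]
  rw [← h2]
  refine h1.analyticAt_of_mem ?_
  rw [hrad]; simp

end WeylFunctions

section Division

/-- The coefficients of the power series `(f x - f y) / (x - y)` in `x`, where `f = ∑ cₙ xⁿ`. -/
noncomputable def divCoeff (y : ℝ) (c : ℕ → ℝ) (n : ℕ) : ℝ := ∑' j, c (n + 1 + j) * y ^ j

theorem divCoeff_term_bound {r y B : ℝ} (hr : 0 < r) (hy : |y| ≤ r / 2) {c : ℕ → ℝ} {n : ℕ}
    (hc : ∀ k, n + 1 ≤ k → |c k| ≤ B / r ^ k) (j : ℕ) :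
    ‖c (n + 1 + j) * y ^ j‖ ≤ B / r ^ (n + 1) * (1 / 2) ^ j := by
  rw [Real.norm_eq_abs, abs_mul, abs_pow]
  have h1 := hc (n + 1 + j) (by omega)
  calc |c (n + 1 + j)| * |y| ^ j ≤ (B / r ^ (n + 1 + j)) * (r / 2) ^ j := by
        gcongr
        exact (abs_nonneg _).trans h1
    _ = _ := by rw [pow_add r (n + 1) j, div_pow, div_pow]; field_simp; simp

theorem abs_divCoeff_le {r y B : ℝ} (hr : 0 < r) (hy : |y| ≤ r / 2) {c : ℕ → ℝ} {n : ℕ}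
    (hc : ∀ k, n + 1 ≤ k → |c k| ≤ B / r ^ k) : |divCoeff y c n| ≤ (2 / r * B) / r ^ n := by
  have := tsum_of_norm_bounded (hasSum_geometric_two.mul_left _) (divCoeff_term_bound hr hy hc)
  rw [Real.norm_eq_abs] at this
  refine this.trans (le_of_eq ?_)
  rw [pow_succ]; field_simp

theorem divCoeff_eq {r y B : ℝ} (hr : 0 < r) (hy : |y| ≤ r / 2) {c : ℕ → ℝ}
    (hc : ∀ k, |c k| ≤ B / r ^ k) (n : ℕ) :
    divCoeff y c n = c (n + 1) + y * divCoeff y c (n + 1) := by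
  have hs : Summable fun j => c (n + 1 + j) * y ^ j :=
    Summable.of_norm_bounded (summable_geom_const _) (divCoeff_term_bound hr hy fun k _ => hc k)
  unfold divCoeff
  rw [hs.tsum_eq_zero_add, ← tsum_mul_left]
  congr 1
  · simp
  · congr 1; ext j
    rw [show n + 1 + 1 + j = n + 1 + (j + 1) by ring, pow_succ]; ring

theorem summable_powerSeries {r x B : ℝ} (hr : 0 < r) (hx : |x| ≤ r / 2) {c : ℕ → ℝ}
    (hc : ∀ k, |c k| ≤ B / r ^ k) : Summable fun n => c n * x ^ n := by
  refine Summable.of_norm_bounded (summable_geom_const B) fun n => ?_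
  rw [Real.norm_eq_abs, abs_mul, abs_pow]
  calc |c n| * |x| ^ n ≤ (B / r ^ n) * (r / 2) ^ n := by
        gcongr
        · exact (abs_nonneg _).trans (hc n)
        · exact hc n
    _ = _ := by rw [div_pow, div_pow]; field_simp; simp

theorem abs_powerSeries_le {r x B : ℝ} (hr : 0 < r) (hx : |x| ≤ r / 2) {c : ℕ → ℝ}
    (hc : ∀ k, |c k| ≤ B / r ^ k) : |∑' n, c n * x ^ n| ≤ 2 * B := by
  have : ∀ n, ‖c n * x ^ n‖ ≤ B * (1 / 2) ^ n := fun n => by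
    rw [Real.norm_eq_abs, abs_mul, abs_pow]
    calc |c n| * |x| ^ n ≤ (B / r ^ n) * (r / 2) ^ n := by
          gcongr
          · exact (abs_nonneg _).trans (hc n)
          · exact hc n
      _ = _ := by rw [div_pow, div_pow]; field_simp; simp
  have h := tsum_of_norm_bounded (hasSum_geometric_two.mul_left B) this
  rw [Real.norm_eq_abs] at h
  linarith

theorem powerSeries_sub {r x y B : ℝ} (hr : 0 < r) (hx : |x| ≤ r / 2) (hy : |y| ≤ r / 2)
    {c : ℕ → ℝ} (hc : ∀ k, |c k| ≤ B / r ^ k) :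
    ∑' n, c n * x ^ n - ∑' n, c n * y ^ n = (x - y) * ∑' n, divCoeff y c n * x ^ n := by
  have hd : ∀ k, |divCoeff y c k| ≤ (2 / r * B) / r ^ k :=
    fun k => abs_divCoeff_le hr hy fun k _ => hc k
  have hsc := summable_powerSeries hr hx hc
  have hsy := summable_powerSeries hr hy hc
  have hsd := summable_powerSeries hr hx hd
  have e1 : ∑' n, c n * x ^ n = c 0 + ∑' n, c (n + 1) * x ^ (n + 1) := by
    rw [hsc.tsum_eq_zero_add]; simp
  have e2 : ∑' n, c n * y ^ n = c 0 + y * divCoeff y c 0 := by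
    rw [hsy.tsum_eq_zero_add, divCoeff, ← tsum_mul_left]
    congr 1
    · simp
    · congr 1; ext j
      rw [show 0 + 1 + j = j + 1 by ring, pow_succ]; ring
  have e3 : ∑' n, c (n + 1) * x ^ (n + 1) = x * ∑' n, divCoeff y c n * x ^ n
      - y * (∑' n, divCoeff y c (n + 1) * x ^ (n + 1)) := by
    rw [← tsum_mul_left, ← tsum_mul_left, ← Summable.tsum_sub]
    · congr 1; ext n
      have := divCoeff_eq hr hy hc n
      have h2 : c (n + 1) = divCoeff y c n - y * divCoeff y c (n + 1) := by linarith
      rw [h2]; ring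
    · exact hsd.mul_left x
    · exact ((summable_nat_add_iff 1).2 hsd).mul_left y
  have e4 : ∑' n, divCoeff y c n * x ^ n
      = divCoeff y c 0 + ∑' n, divCoeff y c (n + 1) * x ^ (n + 1) := by
    rw [hsd.tsum_eq_zero_add]; simp
  rw [e1, e2, e3]
  have : ∑' n, divCoeff y c (n + 1) * x ^ (n + 1)
    = ∑' n, divCoeff y c n * x ^ n - divCoeff y c 0 := by rw [e4]; ring
  rw [this]; ring

/-- A power series that vanishes at the points of `s` is bounded by a multiple of
`∏ |x - y|`, where only the coefficients of order at least `s.card` matter. -/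
theorem abs_powerSeries_le_prod {r : ℝ} (hr : 0 < r) (s : Finset ℝ) :
    ∀ (c : ℕ → ℝ) (B B' : ℝ), (∀ k, |c k| ≤ B' / r ^ k) → (∀ k, s.card ≤ k → |c k| ≤ B / r ^ k) →
      (∀ y ∈ s, |y| ≤ r / 2) → (∀ y ∈ s, ∑' n, c n * y ^ n = 0) → ∀ x : ℝ, |x| ≤ r / 2 →
      |∑' n, c n * x ^ n| ≤ 2 * (2 / r) ^ s.card * B * ∏ y ∈ s, |x - y| := by
  classical
  induction s using Finset.induction_on with
  | empty =>
    intro c B B' _ hB _ _ x hx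
    simpa using abs_powerSeries_le hr hx (fun k => hB k (by simp))
  | insert y s hys ih =>
    intro c B B' hB' hB hs h0 x hx
    have hy : |y| ≤ r / 2 := hs y (Finset.mem_insert_self _ _)
    have hcard : (insert y s).card = s.card + 1 := Finset.card_insert_of_notMem hys
    have hsub := fun x hx => powerSeries_sub (x := x) hr hx hy hB'
    rw [h0 y (Finset.mem_insert_self _ _)] at hsub
    have := ih (divCoeff y c) (2 / r * B) (2 / r * B') 
      (fun k => abs_divCoeff_le hr hy fun k _ => hB' k)
      (fun k hk => abs_divCoeff_le hr hy fun l hl => hB l (by omega))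
      (fun z hz => hs z (Finset.mem_insert_of_mem hz))
      (fun z hz => by
        have h1 := hsub z (hs z (Finset.mem_insert_of_mem hz))
        rw [h0 z (Finset.mem_insert_of_mem hz)] at h1
        have h2 : z - y ≠ 0 := sub_ne_zero.2 (fun h => hys (h ▸ hz))
        simpa [h2] using h1.symm) x hx
    have h3 := hsub x hx
    rw [sub_zero] at h3
    rw [h3, abs_mul, Finset.prod_insert hys, hcard, pow_succ]
    calc |x - y| * |∑' n, divCoeff y c n * x ^ n|
        ≤ |x - y| * (2 * (2 / r) ^ s.card * (2 / r * B) * ∏ y ∈ s, |x - y|) := by gcongr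
      _ = _ := by ring

end Division

section Kernel

/-- The covariance kernel of the normalised Weyl series. -/
noncomputable def gaussKernel (x y : ℝ) : ℝ := Real.exp (-(x - y) ^ 2 / 2)

theorem exists_hasGrowth_weylFun (x : ℝ) : ∃ S, HasGrowth (fun n => weylFun n x) S ∧
    HasGrowth (fun n => weylFunDeriv n x) S := by
  obtain ⟨R, hR, hx⟩ := exists_bound_abs x
  have main : ∀ (n : ℕ) (y : ℝ), 2 ^ n * |y| ≤ (1 + R) * Real.exp (32 * R ^ 2) * (1 / 2) ^ n →
      |y| ≤ (1 + R) * Real.exp (32 * R ^ 2) * 2 ^ n := by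
    intro n y hy
    have h1 : (1 : ℝ) ≤ 2 ^ n := one_le_pow₀ (by norm_num)
    have h2 : (1 / 2 : ℝ) ^ n ≤ 2 ^ n := (pow_le_one₀ (by norm_num) (by norm_num)).trans h1
    calc |y| = 1 * |y| := by ring
      _ ≤ 2 ^ n * |y| := by gcongr
      _ ≤ _ := hy
      _ ≤ _ := by gcongr
  exact ⟨(1 + R) * Real.exp (32 * R ^ 2), fun n => main n _ (weylFun_bounds hR hx n).1,
    fun n => main n _ (weylFun_bounds hR hx n).2⟩

theorem hasSum_weylFun_mul_weylFun (x y : ℝ) :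
    HasSum (fun n => weylFun n x * weylFun n y) (gaussKernel x y) := by
  have h1 : HasSum (fun n : ℕ => (x * y) ^ n / (n ! : ℝ)) (Real.exp (x * y)) := by
    rw [Real.exp_eq_exp_ℝ]; exact NormedSpace.expSeries_div_hasSum_exp (x * y)
  have h2 := h1.mul_left (Real.exp (-x ^ 2 / 2) * Real.exp (-y ^ 2 / 2))
  convert! h2 using 1
  · ext n
    unfold weylFun
    have : √(n ! : ℝ) * √(n ! : ℝ) = n ! := Real.mul_self_sqrt (by positivity)
    have h : (x * y) ^ n / (n ! : ℝ) = x ^ n * y ^ n / (√(n ! : ℝ) * √(n ! : ℝ)) := by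
      rw [mul_pow, this]
    rw [h]
    ring
  · unfold gaussKernel
    rw [← Real.exp_add, ← Real.exp_add]
    congr 1; ring

theorem hasDerivAt_gaussKernel_right (x y : ℝ) :
    HasDerivAt (fun y => gaussKernel x y) ((x - y) * gaussKernel x y) y := by
  have h1 : HasDerivAt (fun y : ℝ => -(x - y) ^ 2 / 2) (x - y) y := by
    have h0 : HasDerivAt (fun y : ℝ => x - y) (-1) y := by
      simpa using (hasDerivAt_id y).const_sub x
    refine ((h0.pow 2).neg.div_const 2).congr_deriv ?_
    push_cast; ring
  refine h1.exp.congr_deriv ?_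
  unfold gaussKernel; ring

theorem hasSum_weylFun_mul_weylFunDeriv (x y : ℝ) :
    HasSum (fun n => weylFun n x * weylFunDeriv n y) ((x - y) * gaussKernel x y) := by
  obtain ⟨S, hS, -⟩ := exists_hasGrowth_weylFun x
  have h1 := hS.hasDerivAt y
  have h2 : normSeries (fun n => weylFun n x) = fun y => gaussKernel x y := by
    ext y; exact (hasSum_weylFun_mul_weylFun x y).tsum_eq
  rw [h2] at h1
  rw [← h1.unique (hasDerivAt_gaussKernel_right x y)]
  exact (hS.summable_deriv y).hasSum

theorem hasSum_weylFunDeriv_mul_weylFun (x y : ℝ) :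
    HasSum (fun n => weylFunDeriv n x * weylFun n y) (-(x - y) * gaussKernel x y) := by
  have := hasSum_weylFun_mul_weylFunDeriv y x
  convert! this using 1
  · ext n; ring
  · unfold gaussKernel
    rw [show -(x - y) ^ 2 / 2 = -(y - x) ^ 2 / 2 by ring]; ring

theorem hasSum_weylFunDeriv_mul_weylFunDeriv (x y : ℝ) :
    HasSum (fun n => weylFunDeriv n x * weylFunDeriv n y)
      ((1 - (x - y) ^ 2) * gaussKernel x y) := by
  obtain ⟨S, -, hS⟩ := exists_hasGrowth_weylFun x
  have h1 := hS.hasDerivAt y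
  have h2 : normSeries (fun n => weylFunDeriv n x) = fun y => -(x - y) * gaussKernel x y := by
    ext y; exact (hasSum_weylFunDeriv_mul_weylFun x y).tsum_eq
  rw [h2] at h1
  have h3 : HasDerivAt (fun y => -(x - y) * gaussKernel x y)
      ((1 - (x - y) ^ 2) * gaussKernel x y) y := by
    have h0 : HasDerivAt (fun y : ℝ => -(x - y)) 1 y := by
      refine (((hasDerivAt_id y).const_sub x).neg).congr_deriv ?_
      ring
    refine (h0.mul (hasDerivAt_gaussKernel_right x y)).congr_deriv ?_
    ring
  rw [← h1.unique h3]
  exact (hS.summable_deriv y).hasSum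

end Kernel

section Zeros

/-- The constant in `abs_normSeriesDeriv_le_prod`. -/
noncomputable def repulsionConst (R : ℝ) (m : ℕ) : ℝ :=
  2 * (1 / (R + 1)) ^ m * Real.exp (32 * (R + 1) ^ 2)

theorem repulsionConst_pos {R : ℝ} (hR : 1 ≤ R) (m : ℕ) : 0 < repulsionConst R m := by
  unfold repulsionConst; positivity

theorem abs_normSeriesDeriv_le_prod_finset {a : ℕ → ℝ} {S S' R : ℝ} (ha : HasGrowth a S')
    (hR : 1 ≤ R) {s : Finset ℝ} (hs : ∀ y ∈ s, |y| ≤ R) (h0 : ∀ y ∈ s, normSeries a y = 0)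
    (haS : ∀ n, s.card ≤ n → |a n| ≤ S * 2 ^ n) {y : ℝ} (hy : y ∈ s) :
    |normSeriesDeriv a y| ≤ repulsionConst R s.card * S * ∏ z ∈ s.erase y, |y - z| := by
  set r : ℝ := 2 * (R + 1) with hr
  have hr0 : 0 < r := by positivity
  set c : ℕ → ℝ := fun n => a n / √(n ! : ℝ) with hc
  set E : ℝ := Real.exp (2 * (2 * r) ^ 2) with hE
  have hcS : ∀ (S : ℝ) (n : ℕ), |a n| ≤ S * 2 ^ n → |c n| ≤ S * E / r ^ n := by
    intro S n hn
    have hp := pow_div_sqrt_factorial_le (2 * r) n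
    have hs := sqrt_factorial_pos n
    have hS0 : 0 ≤ S := by
      by_contra h
      have : S * 2 ^ n < 0 := mul_neg_of_neg_of_pos (by linarith) (by positivity)
      linarith [abs_nonneg (a n)]
    rw [hc, abs_div, abs_of_pos hs, le_div_iff₀ (by positivity)]
    calc |a n| / √(n ! : ℝ) * r ^ n ≤ (S * 2 ^ n) / √(n ! : ℝ) * r ^ n := by gcongr
      _ = S * ((2 * r) ^ n / √(n ! : ℝ)) := by rw [mul_pow 2 r]; ring
      _ ≤ S * (E * (1 / 2) ^ n) := by gcongr
      _ ≤ S * (E * 1) := by gcongr; exact pow_le_one₀ (by norm_num) (by norm_num)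
      _ = S * E := by ring
  have hF : ∀ x, ∑' n, c n * x ^ n = weylSeries a x := fun x => rfl
  have hbound : ∀ x, |x| ≤ r / 2 →
      |weylSeries a x| ≤ 2 * (2 / r) ^ s.card * (S * E) * ∏ z ∈ s, |x - z| := by
    intro x hx
    exact abs_powerSeries_le_prod hr0 s c (S * E) (S' * E) (fun n => hcS S' n (ha n))
      (fun n hn => hcS S n (haS n hn)) (fun y hy => (hs y hy).trans (by rw [hr]; linarith))
      (fun y hy => by rw [hF]; exact (normSeries_eq_zero_iff a y).1 (h0 y hy)) x hx
  have hder := (ha.hasDerivAt_weylSeries (h0 y hy))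
  have hlim := hder.tendsto_slope.abs
  have hlim2 : Filter.Tendsto
      (fun x => 2 * (2 / r) ^ s.card * (S * E) * ∏ z ∈ s.erase y, |x - z|) (𝓝[≠] y)
      (𝓝 (2 * (2 / r) ^ s.card * (S * E) * ∏ z ∈ s.erase y, |y - z|)) := by
    have : Continuous fun x : ℝ => 2 * (2 / r) ^ s.card * (S * E) * ∏ z ∈ s.erase y, |x - z| := by
      fun_prop
    exact (this.tendsto y).mono_left nhdsWithin_le_nhds
  have hle : |Real.exp (y ^ 2 / 2) * normSeriesDeriv a y|
      ≤ 2 * (2 / r) ^ s.card * (S * E) * ∏ z ∈ s.erase y, |y - z| := by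
    refine le_of_tendsto_of_tendsto hlim hlim2 ?_
    have hn : ∀ᶠ x in 𝓝[≠] y, |x| < r / 2 := by
      refine nhdsWithin_le_nhds ?_
      refine (continuous_abs.tendsto y).eventually_lt_const ?_
      have := hs y hy
      rw [hr]; linarith
    filter_upwards [hn, self_mem_nhdsWithin] with x hx hxy
    have hxy' : 0 < |x - y| := abs_pos.2 (sub_ne_zero.2 hxy)
    have h1 := hbound x hx.le
    rw [slope_def_field, (normSeries_eq_zero_iff a y).1 (h0 y hy), sub_zero, abs_div,
      div_le_iff₀ hxy']
    rw [← Finset.mul_prod_erase s _ hy] at h1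
    linarith
  have h2r : 2 / r = 1 / (R + 1) := by rw [hr]; field_simp
  have hE' : E = Real.exp (32 * (R + 1) ^ 2) := by rw [hE, hr]; congr 1; ring
  rw [abs_mul, abs_of_pos (Real.exp_pos _), h2r, hE'] at hle
  have h1 : 1 ≤ Real.exp (y ^ 2 / 2) := Real.one_le_exp (by positivity)
  calc |normSeriesDeriv a y| ≤ Real.exp (y ^ 2 / 2) * |normSeriesDeriv a y| :=
        le_mul_of_one_le_left (abs_nonneg _) h1
    _ ≤ _ := hle
    _ = _ := by unfold repulsionConst; ring

theorem abs_normSeriesDeriv_le_prod {m : ℕ} {a : ℕ → ℝ} {S S' R : ℝ} (ha : HasGrowth a S')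
    (hR : 1 ≤ R) {x : Fin m → ℝ} (hx : Function.Injective x) (hxR : ∀ i, |x i| ≤ R)
    (h0 : ∀ i, normSeries a (x i) = 0) (haS : ∀ n, m ≤ n → |a n| ≤ S * 2 ^ n) (i : Fin m) :
    |normSeriesDeriv a (x i)|
      ≤ repulsionConst R m * S * ∏ j ∈ Finset.univ.erase i, |x i - x j| := by
  have hcard : (Finset.univ.map ⟨x, hx⟩).card = m := by simp
  have := abs_normSeriesDeriv_le_prod_finset (s := Finset.univ.map ⟨x, hx⟩) (S := S)
    (y := x i) ha hR (by simpa using hxR) (by simpa using h0) (by rwa [hcard]) (by simp)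
  rw [hcard] at this
  have h2 : (Finset.univ.map ⟨x, hx⟩).erase (x i)
      = (Finset.univ.erase i).map ⟨x, hx⟩ := by
    rw [Finset.map_erase]; rfl
  rw [h2, Finset.prod_map] at this
  exact this

/-- All zeros of the normalised Weyl series with coefficients `a` are simple. -/
def SimpleZeros (a : ℕ → ℝ) : Prop := ∀ x, normSeries a x = 0 → normSeriesDeriv a x ≠ 0

/-- The `m`-tuples of distinct zeros. -/
def zeroTuples (a : ℕ → ℝ) (m : ℕ) : Set (Fin m → ℝ) :=
  {x | Function.Injective x ∧ ∀ i, normSeries a (x i) = 0}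

theorem HasGrowth.analyticOrderAt_eq_one {a : ℕ → ℝ} {S : ℝ} (ha : HasGrowth a S)
    (hs : SimpleZeros a) {x : ℝ} (hx : normSeries a x = 0) :
    analyticOrderAt (weylSeries a) x = 1 := by
  refine (ha.analyticAt_weylSeries x).analyticOrderAt_eq_one_of_zero_deriv_ne_zero
    ((normSeries_eq_zero_iff a x).1 hx) ?_
  rw [(ha.hasDerivAt_weylSeries hx).deriv]
  exact mul_ne_zero (Real.exp_pos _).ne' (hs x hx)

/-- For simple zeros, a label is the same thing as a zero. -/
noncomputable def zeroLabelEquiv {a : ℕ → ℝ} {S : ℝ} (ha : HasGrowth a S) (hs : SimpleZeros a) :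
    ZeroLabel (weylSeries a) ≃ {x : ℝ // normSeries a x = 0} where
  toFun l := ⟨l.point, by
    have h1 := l.2
    by_contra h
    have h2 : analyticOrderAt (weylSeries a) l.1.1 = 0 := by
      rw [(ha.analyticAt_weylSeries _).analyticOrderAt_eq_zero]
      exact fun h' => h ((normSeries_eq_zero_iff a _).2 h')
    rw [h2] at h1
    exact not_lt_bot h1⟩
  invFun x := ⟨(x.1, 0), by
    simp [ha.analyticOrderAt_eq_one hs x.2]⟩
  left_inv l := by
    have h1 := l.2
    have h0 : normSeries a l.1.1 = 0 := by
      by_contra h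
      have h2 : analyticOrderAt (weylSeries a) l.1.1 = 0 := by
        rw [(ha.analyticAt_weylSeries _).analyticOrderAt_eq_zero]
        exact fun h' => h ((normSeries_eq_zero_iff a _).2 h')
      rw [h2] at h1
      exact not_lt_bot h1
    rw [ha.analyticOrderAt_eq_one hs h0] at h1
    have h2 : l.1.2 = 0 := by
      have : l.1.2 < 1 := by exact_mod_cast h1
      omega
    refine Subtype.ext ?_
    exact Prod.ext rfl h2.symm
  right_inv x := rfl

theorem zeroTupleSum_eq {a : ℕ → ℝ} {S : ℝ} (ha : HasGrowth a S) (hs : SimpleZeros a) (m : ℕ)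
    (f : (Fin m → ℝ) → ℝ) :
    zeroTupleSum (weylSeries a) m f = ∑' x : zeroTuples a m, f x := by
  let E : (Fin m ↪ ZeroLabel (weylSeries a)) ≃ zeroTuples a m :=
    { toFun := fun e => ⟨fun i => (zeroLabelEquiv ha hs (e i)).1,
        ⟨fun i j h => e.injective ((zeroLabelEquiv ha hs).injective (Subtype.ext h)),
          fun i => (zeroLabelEquiv ha hs (e i)).2⟩⟩
      invFun := fun x => ⟨fun i => (zeroLabelEquiv ha hs).symm ⟨x.1 i, x.2.2 i⟩, fun i j h => by
        have := (zeroLabelEquiv ha hs).symm.injective h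
        exact x.2.1 (congrArg Subtype.val this)⟩
      left_inv := fun e => by
        ext i; simp
      right_inv := fun x => by
        ext i
        change ((zeroLabelEquiv ha hs) ((zeroLabelEquiv ha hs).symm ⟨x.1 i, x.2.2 i⟩)).1 = x.1 i
        rw [Equiv.apply_symm_apply] }
  exact E.tsum_eq (fun x : zeroTuples a m => f x)

theorem HasGrowth.finite_zeros {a : ℕ → ℝ} {S : ℝ} (ha : HasGrowth a S) (hs : SimpleZeros a)
    (R : ℝ) : {x : ℝ | |x| ≤ R ∧ normSeries a x = 0}.Finite := by
  by_contra h
  have h : {x : ℝ | |x| ≤ R ∧ normSeries a x = 0}.Infinite := h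
  have hK : IsCompact (Set.Icc (-R) R) := isCompact_Icc
  obtain ⟨z, -, hz⟩ := h.exists_accPt_of_subset_isCompact hK (fun x hx => _root_.abs_le.1 hx.1)
  have hfr := accPt_iff_frequently_nhdsNE.1 hz
  have hz0 : normSeries a z = 0 := by
    have : IsClosed {x | normSeries a x = 0} := isClosed_eq ha.continuous continuous_const
    have hcl : z ∈ closure {x | normSeries a x = 0} := by
      rw [mem_closure_iff_frequently]
      exact (hfr.filter_mono nhdsWithin_le_nhds).mono fun x hx => hx.2
    rwa [this.closure_eq] at hcl
  have hne := (ha.hasDerivAt z).eventually_ne (c := 0) (hs z hz0)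
  exact hfr (hne.mono fun x hx hx' => hx hx'.2)

end Zeros

section CoefficientLaw

/-- The law of a sequence of independent standard Gaussians. -/
noncomputable def coeffLaw : Measure (ℕ → ℝ) := Measure.infinitePi fun _ => gaussianReal 0 1

instance : IsProbabilityMeasure coeffLaw := by unfold coeffLaw; infer_instance

/-- The standard Gaussian measure on `ℝᵐ`. -/
noncomputable def stdGaussianPi (m : ℕ) : Measure (Fin m → ℝ) :=
  Measure.pi fun _ => gaussianReal 0 1

instance (m : ℕ) : IsProbabilityMeasure (stdGaussianPi m) := by
  unfold stdGaussianPi; infer_instance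

/-- Replace the first `m` terms of the sequence `b` by `a`. -/
def glue (m : ℕ) (a : Fin m → ℝ) (b : ℕ → ℝ) (n : ℕ) : ℝ := if h : n < m then a ⟨n, h⟩ else b n

theorem measurable_glue (m : ℕ) :
    Measurable fun p : (Fin m → ℝ) × (ℕ → ℝ) => glue m p.1 p.2 := by
  refine measurable_pi_iff.2 fun n => ?_
  unfold glue
  by_cases h : n < m
  · simp only [h, dite_true]; fun_prop
  · simp only [h, dite_false]; fun_prop

theorem map_glue (m : ℕ) :
    ((stdGaussianPi m).prod coeffLaw).map (fun p => glue m p.1 p.2) = coeffLaw := by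
  refine Measure.eq_infinitePi _ fun s t ht => ?_
  rw [Measure.map_apply (measurable_glue m)
    (MeasurableSet.pi s.countable_toSet fun i _ => ht i)]
  have hpre : (fun p : (Fin m → ℝ) × (ℕ → ℝ) => glue m p.1 p.2) ⁻¹' ((s : Set ℕ).pi t)
      = (Set.univ.pi fun i : Fin m => if (i : ℕ) ∈ s then t i else Set.univ) ×ˢ
        ((s.filter fun n => ¬ n < m : Finset ℕ) : Set ℕ).pi t := by
    ext ⟨a, b⟩
    simp only [Set.mem_preimage, Set.mem_pi, Set.mem_prod, Finset.mem_coe, Finset.mem_filter,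
      Set.mem_univ, true_implies]
    constructor
    · intro h
      refine ⟨fun i => ?_, fun n hn => ?_⟩
      · split_ifs with hi
        · have := h i hi
          simpa [glue] using this
        · trivial
      · have := h n hn.1
        simpa [glue, hn.2] using this
    · rintro ⟨h1, h2⟩ n hn
      by_cases h : n < m
      · have := h1 ⟨n, h⟩
        simp only [hn, if_true] at this
        simpa [glue, h] using this
      · simpa [glue, h] using h2 n ⟨hn, h⟩
  rw [hpre, Measure.prod_prod, coeffLaw, Measure.infinitePi_pi _ (fun i _ => ht i), stdGaussianPi,
    Measure.pi_pi]
  have h1 : ∏ i : Fin m, gaussianReal 0 1 (if (i : ℕ) ∈ s then t i else Set.univ)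
      = ∏ n ∈ s.filter (fun n => n < m), gaussianReal 0 1 (t n) := by
    rw [Fin.prod_univ_eq_prod_range
      (fun n => gaussianReal 0 1 (if n ∈ s then t n else Set.univ)) m]
    have : ∀ n, gaussianReal 0 1 (if n ∈ s then t n else Set.univ)
        = if n ∈ s then gaussianReal 0 1 (t n) else 1 := by
      intro n; split_ifs <;> simp
    simp_rw [this]
    rw [← Finset.prod_filter]
    congr 1
    ext n; simp [and_comm]
  rw [h1, Finset.prod_filter_mul_prod_filter_not]

/-- Resampling of the first `m` coefficients. -/
theorem lintegral_coeffLaw (m : ℕ) {h : (ℕ → ℝ) → ℝ≥0∞} (hh : Measurable h) :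
    ∫⁻ a, h a ∂coeffLaw = ∫⁻ b, ∫⁻ a, h (glue m a b) ∂stdGaussianPi m ∂coeffLaw := by
  conv_lhs => rw [← map_glue m]
  rw [lintegral_map hh (measurable_glue m), lintegral_prod_symm']
  exact hh.comp (measurable_glue m)

/-- Up to a constant, a bound for the `p`-th power of the growth rate of `a`. -/
noncomputable def growthSum (p : ℕ) (a : ℕ → ℝ) : ℝ≥0∞ :=
  ∑' n, ENNReal.ofReal (‖a n‖ ^ p * (1 / 2) ^ n)

theorem measurable_growthSum (p : ℕ) : Measurable (growthSum p) := by
  refine Measurable.tsum fun n => ?_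
  fun_prop

theorem lintegral_growthSum_lt_top {p : ℕ} (hp : p ≠ 0) :
    ∫⁻ a, growthSum p a ∂coeffLaw < ∞ := by
  unfold growthSum
  rw [lintegral_tsum fun n => Measurable.aemeasurable (by fun_prop)]
  have h1 : Integrable (fun x : ℝ => ‖x‖ ^ p) (gaussianReal 0 1) :=
    (memLp_id_gaussianReal (p : NNReal)).integrable_norm_pow (by simpa using hp)
  have h2 : ∀ n : ℕ, ∫⁻ a, ENNReal.ofReal (‖a n‖ ^ p * (1 / 2) ^ n) ∂coeffLaw
      = ENNReal.ofReal (∫ x : ℝ, ‖x‖ ^ p ∂gaussianReal 0 1) * ENNReal.ofReal ((1 / 2) ^ n) := by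
    intro n
    have h3 := (measurePreserving_eval_infinitePi (fun _ : ℕ => gaussianReal 0 1) n).lintegral_comp
      (f := fun x : ℝ => ENNReal.ofReal (‖x‖ ^ p * (1 / 2) ^ n)) (by fun_prop)
    unfold coeffLaw
    refine h3.trans ?_
    rw [ofReal_integral_eq_lintegral_ofReal h1 (Filter.Eventually.of_forall fun x => by positivity),
      ← lintegral_mul_const' _ _ ENNReal.ofReal_ne_top]
    congr 1
    ext x
    rw [ENNReal.ofReal_mul (by positivity)]
  simp_rw [h2]
  rw [ENNReal.tsum_mul_left]
  refine ENNReal.mul_lt_top ENNReal.ofReal_lt_top ?_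
  rw [← ENNReal.ofReal_tsum_of_nonneg (fun n => by positivity) summable_geometric_two]
  exact ENNReal.ofReal_lt_top

theorem exists_hasGrowth_of_growthSum {p : ℕ} (hp : p ≠ 0) {a : ℕ → ℝ} (ha : growthSum p a < ∞) :
    ∃ S, HasGrowth a S ∧ S ^ p = (growthSum p a).toReal := by
  set T := (growthSum p a).toReal with hT
  have hT0 : 0 ≤ T := ENNReal.toReal_nonneg
  refine ⟨T ^ (1 / (p : ℝ)), fun n => ?_, ?_⟩
  · have h1 : ENNReal.ofReal (‖a n‖ ^ p * (1 / 2) ^ n) ≤ growthSum p a :=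
      ENNReal.le_tsum n
    have h2 : ‖a n‖ ^ p * (1 / 2) ^ n ≤ T := by
      rw [hT]; exact (ENNReal.ofReal_le_iff_le_toReal ha.ne).1 h1
    have h3 : |a n| ^ p ≤ (T ^ (1 / (p : ℝ)) * 2 ^ n) ^ p := by
      rw [mul_pow, ← Real.rpow_natCast (T ^ (1 / (p : ℝ))), ← Real.rpow_mul hT0,
        one_div_mul_cancel (by exact_mod_cast hp), Real.rpow_one]
      have h4 : (1 : ℝ) ≤ (2 ^ n) ^ (p - 1) := one_le_pow₀ (one_le_pow₀ (by norm_num))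
      have h5 : ((2 : ℝ) ^ n) ^ p = 2 ^ n * (2 ^ n) ^ (p - 1) := by
        rw [← pow_succ', Nat.sub_add_cancel (Nat.one_le_iff_ne_zero.2 hp)]
      rw [h5]
      have h6 : |a n| ^ p = (‖a n‖ ^ p * (1 / 2) ^ n) * 2 ^ n := by
        rw [Real.norm_eq_abs, div_pow]; field_simp; simp
      rw [h6]
      calc (‖a n‖ ^ p * (1 / 2) ^ n) * 2 ^ n ≤ T * 2 ^ n := by gcongr
        _ = T * (2 ^ n * 1) := by ring
        _ ≤ T * (2 ^ n * (2 ^ n) ^ (p - 1)) := by gcongr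
    exact le_of_pow_le_pow_left₀ hp (by positivity) h3
  · rw [← Real.rpow_natCast, ← Real.rpow_mul hT0, one_div_mul_cancel (by exact_mod_cast hp),
      Real.rpow_one]

theorem ae_growthSum_lt_top {p : ℕ} (hp : p ≠ 0) : ∀ᵐ a ∂coeffLaw, growthSum p a < ∞ :=
  ae_lt_top (measurable_growthSum p) (lintegral_growthSum_lt_top hp).ne

theorem ae_hasGrowth : ∀ᵐ a ∂coeffLaw, ∃ S, HasGrowth a S := by
  filter_upwards [ae_growthSum_lt_top one_ne_zero] with a ha
  obtain ⟨S, hS, -⟩ := exists_hasGrowth_of_growthSum one_ne_zero ha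
  exact ⟨S, hS⟩

theorem measurable_normSeries :
    Measurable fun p : (ℕ → ℝ) × ℝ => normSeries p.1 p.2 := by
  refine Measurable.tsum fun n => ?_
  have := (continuous_weylFun n).measurable
  fun_prop

theorem measurable_normSeriesDeriv :
    Measurable fun p : (ℕ → ℝ) × ℝ => normSeriesDeriv p.1 p.2 := by
  refine Measurable.tsum fun n => ?_
  have := (continuous_weylFunDeriv n).measurable
  fun_prop

/-- Sequences whose pairing with a sequence of moderate growth converges. -/
def RapidDecay (w : ℕ → ℝ) : Prop := ∃ C, ∀ n, 2 ^ n * |w n| ≤ C * (1 / 2) ^ n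

theorem rapidDecay_weylFun (x : ℝ) : RapidDecay fun n => weylFun n x := by
  obtain ⟨R, hR, hx⟩ := exists_bound_abs x
  exact ⟨_, fun n => (weylFun_bounds hR hx n).1⟩

theorem rapidDecay_weylFunDeriv (x : ℝ) : RapidDecay fun n => weylFunDeriv n x := by
  obtain ⟨R, hR, hx⟩ := exists_bound_abs x
  exact ⟨_, fun n => (weylFun_bounds hR hx n).2⟩

theorem RapidDecay.add {v w : ℕ → ℝ} (hv : RapidDecay v) (hw : RapidDecay w) :
    RapidDecay fun n => v n + w n := by
  obtain ⟨C, hC⟩ := hv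
  obtain ⟨D, hD⟩ := hw
  refine ⟨C + D, fun n => ?_⟩
  calc 2 ^ n * |v n + w n| ≤ 2 ^ n * (|v n| + |w n|) := by gcongr; exact abs_add_le _ _
    _ = 2 ^ n * |v n| + 2 ^ n * |w n| := by ring
    _ ≤ C * (1 / 2) ^ n + D * (1 / 2) ^ n := add_le_add (hC n) (hD n)
    _ = _ := by ring

theorem RapidDecay.const_mul {w : ℕ → ℝ} (hw : RapidDecay w) (c : ℝ) :
    RapidDecay fun n => c * w n := by
  obtain ⟨D, hD⟩ := hw
  refine ⟨|c| * D, fun n => ?_⟩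
  calc 2 ^ n * |c * w n| = |c| * (2 ^ n * |w n|) := by rw [abs_mul]; ring
    _ ≤ |c| * (D * (1 / 2) ^ n) := mul_le_mul_of_nonneg_left (hD n) (abs_nonneg c)
    _ = _ := by ring

theorem RapidDecay.sum {ι : Type*} (s : Finset ι) {w : ι → ℕ → ℝ} (hw : ∀ i, RapidDecay (w i)) :
    RapidDecay fun n => ∑ i ∈ s, w i n := by
  classical
  induction s using Finset.induction_on with
  | empty => exact ⟨0, fun n => by simp⟩
  | insert i s his ih =>
    simp_rw [Finset.sum_insert his]
    exact (hw i).add ih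

theorem RapidDecay.hasGrowth {w : ℕ → ℝ} (hw : RapidDecay w) : ∃ S, HasGrowth w S := by
  obtain ⟨C, hC⟩ := hw
  have hC0 : 0 ≤ C := by
    have := hC 0
    simp at this
    exact (abs_nonneg _).trans this
  refine ⟨C, fun n => ?_⟩
  have h1 : (1 : ℝ) ≤ 2 ^ n := one_le_pow₀ (by norm_num)
  have h2 : (1 / 2 : ℝ) ^ n ≤ 2 ^ n := (pow_le_one₀ (by norm_num) (by norm_num)).trans h1
  calc |w n| = 1 * |w n| := by ring
    _ ≤ 2 ^ n * |w n| := by gcongr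
    _ ≤ _ := hC n
    _ ≤ _ := by gcongr

theorem RapidDecay.summable_mul {w : ℕ → ℝ} (hw : RapidDecay w) {a : ℕ → ℝ} {S : ℝ}
    (ha : HasGrowth a S) : Summable fun n => a n * w n := by
  obtain ⟨C, hC⟩ := hw
  refine Summable.of_norm_bounded (summable_geom_const (S * C)) fun n => ?_
  have := ha.nonneg
  rw [Real.norm_eq_abs, abs_mul]
  calc |a n| * |w n| ≤ (S * 2 ^ n) * |w n| := by gcongr; exact ha n
    _ = S * (2 ^ n * |w n|) := by ring
    _ ≤ S * (C * (1 / 2) ^ n) := mul_le_mul_of_nonneg_left (hC n) this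
    _ = _ := by ring

theorem integral_cexp_partialSum (w : ℕ → ℝ) (N : ℕ) :
    ∫ a, Complex.exp (((∑ n ∈ Finset.range N, a n * w n : ℝ) : ℂ) * Complex.I) ∂coeffLaw
      = Complex.exp (-((∑ n ∈ Finset.range N, w n ^ 2 : ℝ) : ℂ) / 2) := by
  have h1 := integral_restrict_infinitePi (fun _ : ℕ => gaussianReal 0 1) (s := Finset.range N)
    (f := fun y => ∏ i : Finset.range N, Complex.exp (((y i * w i : ℝ) : ℂ) * Complex.I))
    (Measurable.aestronglyMeasurable (by fun_prop))
  have h2 : ∀ a : ℕ → ℝ, Complex.exp (((∑ n ∈ Finset.range N, a n * w n : ℝ) : ℂ) * Complex.I)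
      = ∏ i : Finset.range N,
        Complex.exp ((((Finset.range N).restrict a i * w i : ℝ) : ℂ) * Complex.I) := by
    intro a
    rw [← Complex.exp_sum, ← Finset.sum_mul, ← Complex.ofReal_sum]
    congr 3
    exact (Finset.sum_coe_sort (Finset.range N) (fun n => a n * w n)).symm
  simp_rw [h2, coeffLaw]
  rw [h1, integral_fintype_prod_eq_prod (μ := fun _ => gaussianReal 0 1)
    (fun (i : Finset.range N) (x : ℝ) => Complex.exp (((x * w i : ℝ) : ℂ) * Complex.I))]
  have h3 : ∀ t : ℝ, ∫ x : ℝ, Complex.exp (((x * t : ℝ) : ℂ) * Complex.I) ∂gaussianReal 0 1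
      = Complex.exp (-((t ^ 2 : ℝ) : ℂ) / 2) := by
    intro t
    have := charFun_gaussianReal (μ := 0) (v := 1) t
    rw [charFun_apply_real] at this
    rw [show -((t ^ 2 : ℝ) : ℂ) / 2 = (t : ℂ) * ((0 : ℝ) : ℂ) * Complex.I
      - ((1 : NNReal) : ℝ) * (t : ℂ) ^ 2 / 2 by push_cast; ring, ← this]
    congr 1
    ext x
    push_cast
    ring_nf
  simp_rw [h3]
  rw [← Complex.exp_sum, Finset.sum_coe_sort (Finset.range N)
    (fun n => -((w n ^ 2 : ℝ) : ℂ) / 2)]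
  congr 1
  push_cast
  rw [← Finset.sum_neg_distrib, Finset.sum_div]

/-- The characteristic function of `∑ₙ aₙ wₙ`. -/
theorem integral_cexp_tsum {w : ℕ → ℝ} (hw : RapidDecay w) :
    ∫ a, Complex.exp (((∑' n, a n * w n : ℝ) : ℂ) * Complex.I) ∂coeffLaw
      = Complex.exp (-((∑' n, w n ^ 2 : ℝ) : ℂ) / 2) := by
  obtain ⟨S, hS⟩ := hw.hasGrowth
  have hsq : Summable fun n => w n ^ 2 := by
    simpa [sq] using hw.summable_mul hS
  have hR : Filter.Tendsto (fun N => Complex.exp (-((∑ n ∈ Finset.range N, w n ^ 2 : ℝ) : ℂ) / 2))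
      Filter.atTop (𝓝 (Complex.exp (-((∑' n, w n ^ 2 : ℝ) : ℂ) / 2))) := by
    have hc : Continuous fun s : ℝ => Complex.exp (-(s : ℂ) / 2) := by fun_prop
    exact (hc.tendsto _).comp hsq.hasSum.tendsto_sum_nat
  simp_rw [← integral_cexp_partialSum] at hR
  refine tendsto_nhds_unique ?_ hR
  refine tendsto_integral_of_dominated_convergence (fun _ => 1) (fun N => ?_)
    (integrable_const _) (fun N => ?_) ?_
  · refine Measurable.aestronglyMeasurable ?_
    fun_prop
  · exact Filter.Eventually.of_forall fun a => (Complex.norm_exp_ofReal_mul_I _).le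
  · filter_upwards [ae_hasGrowth] with a ⟨S, ha⟩
    have hc : Continuous fun s : ℝ => Complex.exp ((s : ℂ) * Complex.I) := by fun_prop
    exact (hc.tendsto _).comp (hw.summable_mul ha).hasSum.tendsto_sum_nat

end CoefficientLaw

section GaussianComparison

variable {ι : Type*} [Fintype ι]

/-- `μ` is the centred Gaussian measure with covariance matrix `A`. -/
structure HasGaussianCov (μ : Measure (ι → ℝ)) (A : Matrix ι ι ℝ) : Prop where
  isProbabilityMeasure : IsProbabilityMeasure μ
  charFun_eq : ∀ t : ι → ℝ, ∫ y, Complex.exp (((t ⬝ᵥ y : ℝ) : ℂ) * Complex.I) ∂μ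
    = Complex.exp (-((t ⬝ᵥ A *ᵥ t : ℝ) : ℂ) / 2)

theorem charFun_map_toLp (μ : Measure (ι → ℝ)) (t : PiLp 2 fun _ : ι => ℝ) :
    charFun (μ.map (WithLp.toLp 2)) t
      = ∫ y, Complex.exp (((t.ofLp ⬝ᵥ y : ℝ) : ℂ) * Complex.I) ∂μ := by
  rw [charFun, integral_map (by fun_prop) (by fun_prop)]
  simp [PiLp.inner_apply, dotProduct, mul_comm]

theorem HasGaussianCov.unique {μ ν : Measure (ι → ℝ)} {A : Matrix ι ι ℝ}
    (hμ : HasGaussianCov μ A) (hν : HasGaussianCov ν A) : μ = ν := by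
  have := hμ.isProbabilityMeasure
  have := hν.isProbabilityMeasure
  have h : μ.map (WithLp.toLp 2) = ν.map (WithLp.toLp 2) := by
    refine Measure.ext_of_charFun (E := EuclideanSpace ℝ ι) ?_
    ext t
    rw [charFun_map_toLp, charFun_map_toLp, hμ.charFun_eq, hν.charFun_eq]
  have h2 := congrArg (fun m => m.map (MeasurableEquiv.toLp 2 (ι → ℝ)).symm) h
  rw [← MeasurableEquiv.coe_toLp, MeasurableEquiv.map_symm_map, MeasurableEquiv.map_symm_map] at h2
  exact h2

theorem HasGaussianCov.map_mulVec {κ : Type*} [Fintype κ] {μ : Measure (ι → ℝ)}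
    {A : Matrix ι ι ℝ} (hμ : HasGaussianCov μ A) (T : Matrix κ ι ℝ) :
    HasGaussianCov (μ.map (T *ᵥ ·)) (T * A * Tᵀ) := by
  have := hμ.isProbabilityMeasure
  have hT : Measurable (T *ᵥ · : (ι → ℝ) → (κ → ℝ)) :=
    (Continuous.matrix_mulVec continuous_const continuous_id).measurable
  refine ⟨Measure.isProbabilityMeasure_map hT.aemeasurable, fun t => ?_⟩
  rw [integral_map hT.aemeasurable (Measurable.aestronglyMeasurable (by 
    unfold dotProduct; fun_prop))]
  have h := hμ.charFun_eq (Tᵀ *ᵥ t)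
  have e1 : ∀ y, (Tᵀ *ᵥ t) ⬝ᵥ y = t ⬝ᵥ T *ᵥ y := fun y => by
    rw [Matrix.mulVec_transpose, ← Matrix.dotProduct_mulVec]
  simp_rw [e1] at h
  rw [h, Matrix.mulVec_mulVec, Matrix.mulVec_mulVec, Matrix.mul_assoc]

theorem hasGaussianCov_pi [DecidableEq ι] (lam : ι → NNReal) :
    HasGaussianCov (Measure.pi fun i => gaussianReal 0 (lam i))
      (Matrix.diagonal fun i => (lam i : ℝ)) := by
  refine ⟨inferInstance, fun t => ?_⟩
  have h := charFun_pi (μ := fun i => gaussianReal 0 (lam i)) (WithLp.toLp 2 t)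
  rw [charFun_map_toLp] at h
  rw [h]
  simp_rw [charFun_gaussianReal]
  rw [← Complex.exp_sum]
  congr 1
  simp only [dotProduct, Matrix.mulVec_diagonal]
  push_cast
  rw [← Finset.sum_neg_distrib, Finset.sum_div]
  refine Finset.sum_congr rfl fun i _ => ?_
  simp
  ring

/-- The law of finitely many linear functionals of the coefficients. -/
theorem hasGaussianCov_map_tsum {w : ι → ℕ → ℝ} (hw : ∀ i, RapidDecay (w i))
    {A : Matrix ι ι ℝ} (hA : ∀ i j, HasSum (fun n => w i n * w j n) (A i j)) :
    HasGaussianCov (coeffLaw.map fun a i => ∑' n, a n * w i n) A := by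
  have hmeas : Measurable fun (a : ℕ → ℝ) (i : ι) => ∑' n, a n * w i n :=
    measurable_pi_iff.2 fun i => Measurable.tsum fun n => by fun_prop
  refine ⟨Measure.isProbabilityMeasure_map hmeas.aemeasurable, fun t => ?_⟩
  rw [integral_map hmeas.aemeasurable (Measurable.aestronglyMeasurable (by 
    unfold dotProduct; fun_prop))]
  have hv : RapidDecay fun n => ∑ i, t i * w i n := RapidDecay.sum _ fun i => (hw i).const_mul _
  have h1 := integral_cexp_tsum hv
  have h2 : ∀ᵐ a ∂coeffLaw, ∑' n, a n * ∑ i, t i * w i n = t ⬝ᵥ fun i => ∑' n, a n * w i n := by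
    filter_upwards [ae_hasGrowth] with a ⟨S, ha⟩
    simp_rw [Finset.mul_sum]
    rw [Summable.tsum_finsetSum]
    · refine Finset.sum_congr rfl fun i _ => ?_
      rw [← tsum_mul_left]
      congr 1; ext n; ring
    · exact fun i _ => ((hw i).const_mul (t i)).summable_mul ha
  have h3 : ∑' n, (∑ i, t i * w i n) ^ 2 = t ⬝ᵥ A *ᵥ t := by
    refine HasSum.tsum_eq ?_
    have e : ∀ n, (∑ i, t i * w i n) ^ 2 = ∑ i, ∑ j, t i * t j * (w i n * w j n) := by
      intro n
      rw [sq, Finset.sum_mul_sum]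
      refine Finset.sum_congr rfl fun i _ => Finset.sum_congr rfl fun j _ => by ring
    simp_rw [e]
    have e2 : t ⬝ᵥ A *ᵥ t = ∑ i, ∑ j, t i * t j * A i j := by
      simp only [dotProduct, Matrix.mulVec, Finset.mul_sum]
      refine Finset.sum_congr rfl fun i _ => Finset.sum_congr rfl fun j _ => by ring
    rw [e2]
    exact hasSum_sum fun i _ => hasSum_sum fun j _ => (hA i j).mul_left _
  rw [← h3, ← h1]
  refine integral_congr_ae ?_
  filter_upwards [h2] with a ha
  rw [ha]

/-- Independent Gaussian vectors form a Gaussian vector. -/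
theorem HasGaussianCov.prod {κ : Type*} [Fintype κ] {μ : Measure (ι → ℝ)} {ν : Measure (κ → ℝ)}
    {A : Matrix ι ι ℝ} {B : Matrix κ κ ℝ} (hμ : HasGaussianCov μ A) (hν : HasGaussianCov ν B) :
    HasGaussianCov ((μ.prod ν).map fun p => Sum.elim p.1 p.2) (Matrix.fromBlocks A 0 0 B) := by
  have := hμ.isProbabilityMeasure
  have := hν.isProbabilityMeasure
  have hm : Measurable fun p : (ι → ℝ) × (κ → ℝ) => (Sum.elim p.1 p.2 : ι ⊕ κ → ℝ) :=
    measurable_pi_iff.2 fun i => by rcases i with i | i <;> simp <;> fun_prop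
  refine ⟨Measure.isProbabilityMeasure_map hm.aemeasurable, fun t => ?_⟩
  rw [integral_map hm.aemeasurable (Measurable.aestronglyMeasurable (by
    unfold dotProduct; fun_prop))]
  have ht : t = Sum.elim (t ∘ Sum.inl) (t ∘ Sum.inr) := (Sum.elim_comp_inl_inr t).symm
  have e : ∀ p : (ι → ℝ) × (κ → ℝ),
      Complex.exp (((t ⬝ᵥ Sum.elim p.1 p.2 : ℝ) : ℂ) * Complex.I)
      = Complex.exp ((((t ∘ Sum.inl) ⬝ᵥ p.1 : ℝ) : ℂ) * Complex.I)
        * Complex.exp ((((t ∘ Sum.inr) ⬝ᵥ p.2 : ℝ) : ℂ) * Complex.I) := by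
    intro p
    rw [← Complex.exp_add]
    congr 1
    simp [dotProduct, Fintype.sum_sum_type]
    ring
  simp_rw [e]
  rw [integral_prod_mul (μ := μ) (ν := ν)
    (fun y => Complex.exp ((((t ∘ Sum.inl) ⬝ᵥ y : ℝ) : ℂ) * Complex.I))
    (fun y => Complex.exp ((((t ∘ Sum.inr) ⬝ᵥ y : ℝ) : ℂ) * Complex.I)),
    hμ.charFun_eq, hν.charFun_eq, ← Complex.exp_add]
  congr 1
  have e3 : t ⬝ᵥ Matrix.fromBlocks A 0 0 B *ᵥ t = (t ∘ Sum.inl) ⬝ᵥ A *ᵥ (t ∘ Sum.inl)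
      + (t ∘ Sum.inr) ⬝ᵥ B *ᵥ (t ∘ Sum.inr) := by
    rw [Matrix.fromBlocks_mulVec]
    simp [dotProduct, Fintype.sum_sum_type]
  rw [e3]
  push_cast
  ring

theorem mul_mul_transpose_apply_self {κ : Type*} (T : Matrix κ ι ℝ) (A : Matrix ι ι ℝ) (i : κ) :
    (T * A * Tᵀ) i i = T i ⬝ᵥ A *ᵥ T i := by
  rw [Matrix.mul_assoc, Matrix.mul_apply]
  simp only [dotProduct, Matrix.mulVec, Matrix.mul_apply, Matrix.transpose_apply]

theorem exists_orthogonal_diagonalization [DecidableEq ι] {A : Matrix ι ι ℝ} (hA : Aᵀ = A) :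
    ∃ (U : Matrix ι ι ℝ) (d : ι → ℝ), U * Uᵀ = 1 ∧ U * A * Uᵀ = Matrix.diagonal d := by
  have hH : A.IsHermitian := by
    rw [Matrix.IsHermitian, Matrix.conjTranspose_eq_transpose_of_trivial, hA]
  refine ⟨star (hH.eigenvectorUnitary : Matrix ι ι ℝ), hH.eigenvalues, ?_, ?_⟩
  · have h := Unitary.coe_star_mul_self hH.eigenvectorUnitary
    have e : (star (hH.eigenvectorUnitary : Matrix ι ι ℝ))ᵀ = hH.eigenvectorUnitary := by
      rw [Matrix.star_eq_conjTranspose, Matrix.conjTranspose_eq_transpose_of_trivial,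
        Matrix.transpose_transpose]
    rw [e]; exact h
  · have h := hH.conjStarAlgAut_star_eigenvectorUnitary
    rw [Unitary.conjStarAlgAut_star_apply] at h
    have e : (star (hH.eigenvectorUnitary : Matrix ι ι ℝ))ᵀ = hH.eigenvectorUnitary := by
      rw [Matrix.star_eq_conjTranspose, Matrix.conjTranspose_eq_transpose_of_trivial,
        Matrix.transpose_transpose]
    rw [e]
    simpa [Function.comp_def] using h

theorem exists_simultaneous_diagonalization [DecidableEq ι] {A₀ A : Matrix ι ι ℝ} (h₀ : A₀ᵀ = A₀)
    (hpos : ∀ t : ι → ℝ, t ≠ 0 → 0 < t ⬝ᵥ A₀ *ᵥ t) (hA : Aᵀ = A) :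
    ∃ (T : Matrix ι ι ℝ) (lam : ι → ℝ), IsUnit T.det ∧ T * A₀ * Tᵀ = 1 ∧
      T * A * Tᵀ = Matrix.diagonal lam := by
  obtain ⟨U, d, hU, hd⟩ := exists_orthogonal_diagonalization h₀
  have hdpos : ∀ i, 0 < d i := by
    intro i
    have h1 := mul_mul_transpose_apply_self U A₀ i
    rw [hd, Matrix.diagonal_apply_eq] at h1
    rw [h1]
    refine hpos _ fun h => ?_
    have h2 : (U * Uᵀ) i i = 0 := by
      simp [Matrix.mul_apply, h]
    rw [hU] at h2
    simp at h2
  set B : Matrix ι ι ℝ := Matrix.diagonal (fun i => (√(d i))⁻¹) * U with hB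
  have hB1 : B * A₀ * Bᵀ = 1 := by
    rw [hB, Matrix.transpose_mul, Matrix.diagonal_transpose]
    have : Matrix.diagonal (fun i => (√(d i))⁻¹) * U * A₀ * (Uᵀ * Matrix.diagonal fun i => (√(d i))⁻¹)
      = Matrix.diagonal (fun i => (√(d i))⁻¹) * (U * A₀ * Uᵀ) * Matrix.diagonal fun i => (√(d i))⁻¹ := by
      simp only [Matrix.mul_assoc]
    rw [this, hd, Matrix.diagonal_mul_diagonal, Matrix.diagonal_mul_diagonal, ← Matrix.diagonal_one]
    congr 1
    ext i
    have h2 : √(d i) * √(d i) = d i := Real.mul_self_sqrt (hdpos i).le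
    change (√(d i))⁻¹ * d i * (√(d i))⁻¹ = 1
    rw [mul_right_comm, ← mul_inv, h2, inv_mul_cancel₀ (hdpos i).ne']
  obtain ⟨V, lam, hV, hlam⟩ := exists_orthogonal_diagonalization (A := B * A * Bᵀ) (by
    simp [Matrix.transpose_mul, hA, Matrix.mul_assoc])
  have hT1 : V * B * A₀ * (V * B)ᵀ = 1 := by
    have : V * B * A₀ * (V * B)ᵀ = V * (B * A₀ * Bᵀ) * Vᵀ := by
      simp only [Matrix.transpose_mul, Matrix.mul_assoc]
    rw [this, hB1, Matrix.mul_one, hV]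
  refine ⟨V * B, lam, ?_, hT1, ?_⟩
  · have := congrArg Matrix.det hT1
    rw [Matrix.det_mul, Matrix.det_mul, Matrix.det_one] at this
    refine isUnit_iff_ne_zero.2 fun h => ?_
    rw [h] at this
    simp at this
  · rw [← hlam]
    simp only [Matrix.transpose_mul, Matrix.mul_assoc]

theorem pi_withDensity {μ ν : ι → Measure ℝ} [∀ i, IsProbabilityMeasure (μ i)]
    [∀ i, SigmaFinite (ν i)] {f : ι → ℝ → ℝ≥0∞} (hf : ∀ i, Measurable (f i))
    (h : ∀ i, ν i = (μ i).withDensity (f i)) :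
    Measure.pi ν = (Measure.pi μ).withDensity fun x => ∏ i, f i (x i) := by
  refine Measure.pi_eq fun s hs => ?_
  rw [withDensity_apply _ (MeasurableSet.univ_pi hs),
    ← lintegral_indicator (MeasurableSet.univ_pi hs)]
  have e : ∀ x : ι → ℝ, (Set.univ.pi s).indicator (fun x => ∏ i, f i (x i)) x
      = ∏ i, (s i).indicator (f i) (x i) := by
    intro x
    by_cases hx : x ∈ Set.univ.pi s
    · rw [Set.indicator_of_mem hx]
      exact Finset.prod_congr rfl fun i _ => (Set.indicator_of_mem (hx i trivial) _).symm
    · rw [Set.indicator_of_notMem hx]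
      simp only [Set.mem_pi, Set.mem_univ, true_implies, not_forall] at hx
      obtain ⟨i, hi⟩ := hx
      exact (Finset.prod_eq_zero (Finset.mem_univ i) (Set.indicator_of_notMem hi _)).symm
  simp_rw [e]
  have hind := iIndepFun_pi (μ := μ) (X := fun i => (s i).indicator (f i))
    (fun i => ((hf i).indicator (hs i)).aemeasurable)
  rw [lintegral_prod_eq_prod_lintegral_of_indepFun _ _ hind
    (fun i => ((hf i).indicator (hs i)).comp (measurable_pi_apply i))]
  refine Finset.prod_congr rfl fun i _ => ?_
  have := (measurePreserving_eval μ i).lintegral_comp ((hf i).indicator (hs i))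
  refine this.trans ?_
  rw [lintegral_indicator (hs i), h i, withDensity_apply _ (hs i)]

theorem gaussianPDF_le_mul {u v : NNReal} (hu : u ≠ 0) (huv : u ≤ v) {c : ℝ}
    (hc : v ≤ c ^ 2 * u) (hc0 : 0 ≤ c) (x : ℝ) :
    gaussianPDF 0 u x ≤ ENNReal.ofReal c * gaussianPDF 0 v x := by
  have hu0 : (0 : ℝ) < u := by positivity
  have hv0 : (0 : ℝ) < v := lt_of_lt_of_le hu0 (by exact_mod_cast huv)
  have huv' : (u : ℝ) ≤ v := by exact_mod_cast huv
  unfold gaussianPDF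
  rw [← ENNReal.ofReal_mul hc0]
  refine ENNReal.ofReal_le_ofReal ?_
  unfold gaussianPDFReal
  rw [← mul_assoc]
  have h1 : (√(2 * Real.pi * u))⁻¹ ≤ c * (√(2 * Real.pi * v))⁻¹ := by
    rw [← div_eq_mul_inv, inv_eq_one_div, div_le_div_iff₀ (by positivity) (by positivity), one_mul]
    have : c * √(2 * Real.pi * u) = √(c ^ 2 * (2 * Real.pi * u)) := by
      rw [Real.sqrt_mul (sq_nonneg c) (2 * Real.pi * u), Real.sqrt_sq hc0]
    rw [this]
    refine Real.sqrt_le_sqrt ?_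
    nlinarith [Real.pi_pos]
  refine mul_le_mul h1 ?_ (Real.exp_pos _).le (by positivity)
  refine Real.exp_le_exp.2 ?_
  rw [neg_div, neg_div, neg_le_neg_iff]
  gcongr

theorem pi_gaussian_le {u v : ι → NNReal} (hu : ∀ i, u i ≠ 0) (huv : ∀ i, u i ≤ v i) {c : ℝ}
    (hc : ∀ i, (v i : ℝ) ≤ c ^ 2 * u i) (hc0 : 0 ≤ c) {h : (ι → ℝ) → ℝ≥0∞} :
    ∫⁻ z, h z ∂(Measure.pi fun i => gaussianReal 0 (u i))
      ≤ ENNReal.ofReal (c ^ Fintype.card ι) * ∫⁻ z, h z ∂(Measure.pi fun i => gaussianReal 0 (v i)) := by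
  have hv : ∀ i, v i ≠ 0 := fun i hi => hu i (le_antisymm (hi ▸ huv i) bot_le)
  have hrat : ∀ i, gaussianReal 0 (u i) = (gaussianReal 0 (v i)).withDensity
      fun x => gaussianPDF 0 (u i) x / gaussianPDF 0 (v i) x := by
    intro i
    rw [gaussianReal_of_var_ne_zero _ (hu i), gaussianReal_of_var_ne_zero _ (hv i)]
    refine Eq.trans ?_ (withDensity_mul _ (measurable_gaussianPDF _ _)
      ((measurable_gaussianPDF _ _).div (measurable_gaussianPDF _ _)))
    congr 1
    ext x
    simp only [Pi.mul_apply]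
    rw [ENNReal.mul_div_cancel (gaussianPDF_pos _ (hv i) x).ne' gaussianPDF_ne_top]
  rw [pi_withDensity (fun i => (measurable_gaussianPDF _ _).div (measurable_gaussianPDF _ _)) hrat]
  have hle : (Measure.pi fun i => gaussianReal 0 (v i)).withDensity
      (fun x => ∏ i, gaussianPDF 0 (u i) (x i) / gaussianPDF 0 (v i) (x i))
      ≤ ENNReal.ofReal (c ^ Fintype.card ι) • Measure.pi fun i => gaussianReal 0 (v i) := by
    rw [← withDensity_const]
    refine withDensity_mono (Filter.Eventually.of_forall fun x => ?_)
    calc ∏ i, gaussianPDF 0 (u i) (x i) / gaussianPDF 0 (v i) (x i)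
        ≤ ∏ _i : ι, ENNReal.ofReal c := by
          refine Finset.prod_le_prod' fun i _ => ?_
          exact ENNReal.div_le_of_le_mul (gaussianPDF_le_mul (hu i) (huv i) (hc i) hc0 _)
      _ = _ := by
        rw [Finset.prod_const, ENNReal.ofReal_pow hc0, Finset.card_univ]
  exact (lintegral_mono' hle le_rfl).trans (by rw [lintegral_smul_measure]; rfl)

/-- Scaling of the standard Gaussian measure. -/
theorem lintegral_pi_gaussian_scale (v : NNReal) (h : (ι → ℝ) → ℝ≥0∞) (hh : Measurable h) :
    ∫⁻ z, h z ∂(Measure.pi fun _ : ι => gaussianReal 0 v)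
      = ∫⁻ z, h (√v • z) ∂(Measure.pi fun _ : ι => gaussianReal 0 1) := by
  have h1 : (Measure.pi fun _ : ι => gaussianReal 0 1).map (fun z i => √v * z i)
      = Measure.pi fun _ : ι => gaussianReal 0 v := by
    have := Measure.pi_map_pi (μ := fun _ : ι => gaussianReal 0 1) (f := fun _ x => √v * x)
      (fun i => by fun_prop)
    rw [this]
    congr 1
    ext1 i
    rw [gaussianReal_map_const_mul]
    congr 1
    · simp
    · ext; simp
  rw [← h1, lintegral_map hh (by fun_prop)]
  rfl

/-- Comparison of two centred Gaussian measures whose covariance forms are close. -/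
theorem HasGaussianCov.lintegral_le_and_le [DecidableEq ι] {μ₀ μ : Measure (ι → ℝ)}
    {A₀ A : Matrix ι ι ℝ}
    (hμ₀ : HasGaussianCov μ₀ A₀) (hμ : HasGaussianCov μ A) (h₀ : A₀ᵀ = A₀) (hA : Aᵀ = A)
    (hpos : ∀ t : ι → ℝ, t ≠ 0 → 0 < t ⬝ᵥ A₀ *ᵥ t) {p q : NNReal} (hp : p ≠ 0)
    (hpA : ∀ t : ι → ℝ, p * (t ⬝ᵥ A₀ *ᵥ t) ≤ t ⬝ᵥ A *ᵥ t)
    (hqA : ∀ t : ι → ℝ, t ⬝ᵥ A *ᵥ t ≤ q * (t ⬝ᵥ A₀ *ᵥ t)) {c : ℝ} (hc0 : 0 ≤ c)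
    (hc : q ≤ c ^ 2 * p) {h : (ι → ℝ) → ℝ≥0∞} (hh : Measurable h) :
    ∫⁻ y, h y ∂μ ≤ ENNReal.ofReal (c ^ Fintype.card ι) * ∫⁻ y, h (√q • y) ∂μ₀ ∧
    ∫⁻ y, h (√p • y) ∂μ₀ ≤ ENNReal.ofReal (c ^ Fintype.card ι) * ∫⁻ y, h y ∂μ := by
  obtain ⟨T, lam, hT, hT₀, hTA⟩ := exists_simultaneous_diagonalization h₀ hpos hA
  have hrow : ∀ i, T i ⬝ᵥ A₀ *ᵥ T i = 1 := fun i => by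
    rw [← mul_mul_transpose_apply_self, hT₀]; simp
  have hrow2 : ∀ i, T i ⬝ᵥ A *ᵥ T i = lam i := fun i => by
    rw [← mul_mul_transpose_apply_self, hTA]; simp
  have hlp : ∀ i, (p : ℝ) ≤ lam i := fun i => by
    have := hpA (T i)
    rwa [hrow, hrow2, mul_one] at this
  have hlq : ∀ i, lam i ≤ q := fun i => by
    have := hqA (T i)
    rwa [hrow, hrow2, mul_one] at this
  set l : ι → NNReal := fun i => ⟨lam i, p.2.trans (hlp i)⟩ with hl
  have hTm : Measurable (T *ᵥ · : (ι → ℝ) → (ι → ℝ)) :=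
    (Continuous.matrix_mulVec continuous_const continuous_id).measurable
  have hTi : Measurable (T⁻¹ *ᵥ · : (ι → ℝ) → (ι → ℝ)) :=
    (Continuous.matrix_mulVec continuous_const continuous_id).measurable
  have hg : Measurable fun z => h (T⁻¹ *ᵥ z) := hh.comp hTi
  have m1 : μ.map (T *ᵥ ·) = Measure.pi fun i => gaussianReal 0 (l i) := by
    have h1 := hμ.map_mulVec T
    rw [hTA] at h1
    exact h1.unique (hasGaussianCov_pi l)
  have m0 : μ₀.map (T *ᵥ ·) = Measure.pi fun _ => gaussianReal 0 1 := by
    have h1 := hμ₀.map_mulVec T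
    rw [hT₀] at h1
    have h2 := hasGaussianCov_pi (ι := ι) fun _ => 1
    simp only [NNReal.coe_one, Matrix.diagonal_one] at h2
    exact h1.unique h2
  have hcan : ∀ y, T⁻¹ *ᵥ (T *ᵥ y) = y := fun y => by
    rw [Matrix.mulVec_mulVec, Matrix.nonsing_inv_mul _ hT, Matrix.one_mulVec]
  have f1 : ∫⁻ y, h y ∂μ
      = ∫⁻ z, h (T⁻¹ *ᵥ z) ∂(Measure.pi fun i => gaussianReal 0 (l i)) := by
    rw [← m1, lintegral_map hg hTm]
    simp_rw [hcan]
  have f0 : ∀ r : NNReal, ∫⁻ y, h (√r • y) ∂μ₀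
      = ∫⁻ z, h (T⁻¹ *ᵥ z) ∂(Measure.pi fun _ : ι => gaussianReal 0 r) := by
    intro r
    rw [lintegral_pi_gaussian_scale r _ hg, ← m0, lintegral_map]
    · simp_rw [Matrix.mulVec_smul, hcan]
    · exact hg.comp (measurable_const_smul _)
    · exact hTm
  rw [f1, f0, f0]
  have hl0 : ∀ i, l i ≠ 0 := fun i hi => by
    have h1 := hlp i
    have h2 : lam i = 0 := congrArg NNReal.toReal hi
    rw [h2] at h1
    exact hp (le_antisymm (by exact_mod_cast h1) bot_le)
  constructor
  · refine pi_gaussian_le (v := fun _ => q) hl0 (fun i => hlq i) (fun i => ?_) hc0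
    exact hc.trans (mul_le_mul_of_nonneg_left (hlp i) (by positivity))
  · refine pi_gaussian_le (u := fun _ => p) (fun _ => hp) (fun i => hlp i) (fun i => ?_) hc0
    exact (hlq i).trans hc

end GaussianComparison

section Jets

variable {σ τ : Type*}

/-- The coefficients of the functionals `f ↦ f (x i)` (left summand) and `f ↦ f' (x i)`
(right summand) of the normalised Weyl series. -/
noncomputable def jetFun (x : σ → ℝ) : σ ⊕ σ → ℕ → ℝ :=
  Sum.elim (fun i n => weylFun n (x i)) (fun i n => weylFunDeriv n (x i))

/-- The covariances of values and derivatives of the normalised Weyl series at the points `x i`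
with those at the points `y j`. -/
noncomputable def crossCov (x : σ → ℝ) (y : τ → ℝ) : Matrix (σ ⊕ σ) (τ ⊕ τ) ℝ :=
  Matrix.fromBlocks (Matrix.of fun i j => gaussKernel (x i) (y j))
    (Matrix.of fun i j => (x i - y j) * gaussKernel (x i) (y j))
    (Matrix.of fun i j => -(x i - y j) * gaussKernel (x i) (y j))
    (Matrix.of fun i j => (1 - (x i - y j) ^ 2) * gaussKernel (x i) (y j))

theorem rapidDecay_jetFun (x : σ → ℝ) (p : σ ⊕ σ) : RapidDecay (jetFun x p) := by
  rcases p with i | i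
  · exact rapidDecay_weylFun (x i)
  · exact rapidDecay_weylFunDeriv (x i)

theorem hasSum_jetFun (x : σ → ℝ) (y : τ → ℝ) (p : σ ⊕ σ) (q : τ ⊕ τ) :
    HasSum (fun n => jetFun x p n * jetFun y q n) (crossCov x y p q) := by
  rcases p with i | i <;> rcases q with j | j
  · exact hasSum_weylFun_mul_weylFun (x i) (y j)
  · exact hasSum_weylFun_mul_weylFunDeriv (x i) (y j)
  · exact hasSum_weylFunDeriv_mul_weylFun (x i) (y j)
  · exact hasSum_weylFunDeriv_mul_weylFunDeriv (x i) (y j)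

theorem crossCov_sub (x : σ → ℝ) (y : τ → ℝ) (c : ℝ) :
    crossCov (fun i => x i - c) (fun j => y j - c) = crossCov x y := by
  simp [crossCov, gaussKernel]

theorem crossCov_transpose (x : σ → ℝ) (y : τ → ℝ) : (crossCov x y)ᵀ = crossCov y x := by
  ext q p
  refine (hasSum_jetFun x y p q).unique ?_
  have := hasSum_jetFun y x q p
  simpa [mul_comm] using this

variable [Fintype σ] [Fintype τ]

theorem hasSum_crossCov_bilin (x : σ → ℝ) (y : τ → ℝ) (u : σ ⊕ σ → ℝ) (v : τ ⊕ τ → ℝ) :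
    HasSum (fun n => (∑ p, u p * jetFun x p n) * ∑ q, v q * jetFun y q n)
      (u ⬝ᵥ crossCov x y *ᵥ v) := by
  have e : ∀ n, (∑ p, u p * jetFun x p n) * ∑ q, v q * jetFun y q n
      = ∑ p, ∑ q, u p * v q * (jetFun x p n * jetFun y q n) := by
    intro n
    rw [Finset.sum_mul_sum]
    refine Finset.sum_congr rfl fun i _ => Finset.sum_congr rfl fun j _ => by ring
  simp_rw [e]
  have e2 : u ⬝ᵥ crossCov x y *ᵥ v = ∑ p, ∑ q, u p * v q * crossCov x y p q := by
    simp only [dotProduct, Matrix.mulVec, Finset.mul_sum]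
    refine Finset.sum_congr rfl fun i _ => Finset.sum_congr rfl fun j _ => by ring
  rw [e2]
  exact hasSum_sum fun i _ => hasSum_sum fun j _ => (hasSum_jetFun x y i j).mul_left _

theorem hasSum_jetCov_quad (x : σ → ℝ) (u : σ ⊕ σ → ℝ) :
    HasSum (fun n => (∑ p, u p * jetFun x p n) ^ 2) (u ⬝ᵥ crossCov x x *ᵥ u) := by
  simpa [sq] using hasSum_crossCov_bilin x x u u

theorem jetCov_quad_nonneg (x : σ → ℝ) (u : σ ⊕ σ → ℝ) : 0 ≤ u ⬝ᵥ crossCov x x *ᵥ u :=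
  (hasSum_jetCov_quad x u).nonneg fun _ => sq_nonneg _

/-- The functional `g ↦ ∑ᵢ (uᵢ g (xᵢ) + u'ᵢ g' (xᵢ))` on complex analytic functions. -/
noncomputable def jetApply (x : σ → ℝ) (u : σ ⊕ σ → ℝ) (g : ℂ → ℂ) : ℂ :=
  ∑ i, (u (Sum.inl i) * g (x i) + u (Sum.inr i) * deriv g (x i))

theorem jetApply_congr {x : σ → ℝ} (u : σ ⊕ σ → ℝ) {g h : ℂ → ℂ}
    (h0 : ∀ i, g (x i) = h (x i)) (h1 : ∀ i, deriv g (x i) = deriv h (x i)) :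
    jetApply x u g = jetApply x u h := by
  unfold jetApply
  simp_rw [h0, h1]

theorem jetApply_add (x : σ → ℝ) (u : σ ⊕ σ → ℝ) {g h : ℂ → ℂ} (hg : Differentiable ℂ g)
    (hh : Differentiable ℂ h) :
    jetApply x u (fun z => g z + h z) = jetApply x u g + jetApply x u h := by
  unfold jetApply
  rw [← Finset.sum_add_distrib]
  refine Finset.sum_congr rfl fun i _ => ?_
  rw [deriv_fun_add (hg _) (hh _)]
  ring

theorem jetApply_const_mul (x : σ → ℝ) (u : σ ⊕ σ → ℝ) (c : ℂ) {g : ℂ → ℂ}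
    (hg : Differentiable ℂ g) :
    jetApply x u (fun z => c * g z) = c * jetApply x u g := by
  unfold jetApply
  rw [Finset.mul_sum]
  refine Finset.sum_congr rfl fun i _ => ?_
  rw [deriv_const_mul _ (hg _)]
  ring

theorem abs_tsum_mul_le {d l : ℕ → ℝ} {D Q : ℝ} (hd : HasSum (fun n => d n ^ 2) D)
    (hl : HasSum (fun n => l n ^ 2) Q) (hdl : Summable fun n => d n * l n) :
    |∑' n, d n * l n| ≤ √D * √Q := by
  have hD : 0 ≤ D := hd.nonneg fun _ => sq_nonneg _
  rw [← Real.sqrt_mul hD]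
  refine Real.abs_le_sqrt ?_
  refine le_of_tendsto' (hdl.hasSum.tendsto_sum_nat.pow 2) fun N => ?_
  refine (Finset.sum_mul_sq_le_sq_mul_sq (Finset.range N) d l).trans ?_
  gcongr
  · exact sum_le_hasSum _ (fun i _ => sq_nonneg _) hd
  · exact sum_le_hasSum _ (fun i _ => sq_nonneg _) hl

/-- A functional of values and derivatives is bounded on the functions
`exp (-(z-c)²/2) Φ z` with `Φ` of small Gaussian growth, in terms of its variance. -/
theorem abs_re_jetApply_le (x : σ → ℝ) (u : σ ⊕ σ → ℝ) (c : ℝ) {G : ℂ → ℂ}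
    (hG : Differentiable ℂ G) {M : ℝ}
    (hM : ∀ z, ‖G z * Complex.exp ((z - c) ^ 2 / 2)‖ ≤ M * Real.exp (‖z - c‖ ^ 2 / 8)) :
    |(jetApply x u G).re| ≤ 2 * M * √(u ⬝ᵥ crossCov x x *ᵥ u) := by
  set Φ : ℂ → ℂ := fun z => G z * Complex.exp ((z - c) ^ 2 / 2) with hΦ
  have hΦd : Differentiable ℂ Φ := by
    intro z
    exact (hG z).mul (by fun_prop)
  have hM0 : 0 ≤ M := by
    have := (norm_nonneg _).trans (hM c)
    simpa using this
  set d : ℕ → ℂ := fun n => iteratedDeriv n Φ c / (√(n ! : ℝ) : ℂ) with hd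
  have hdn : ∀ n, ‖d n‖ ^ 2 ≤ M ^ 2 * (7 / 10) ^ n := by
    intro n
    have hs := sqrt_factorial_pos n
    have hdnorm : ‖d n‖ = ‖iteratedDeriv n Φ c‖ / √(n ! : ℝ) := by
      rw [hd]; simp only [norm_div, Complex.norm_real, Real.norm_eq_abs, abs_of_pos hs]
    rcases Nat.eq_zero_or_pos n with rfl | hn
    · have := hM c
      simp at this
      rw [hdnorm]
      simp only [iteratedDeriv_zero, Nat.factorial_zero, Nat.cast_one, Real.sqrt_one, div_one,
        pow_zero, mul_one, hΦ]
      gcongr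
      simpa using this
    · have hn0 : (0 : ℝ) < n := by exact_mod_cast hn
      set r : ℝ := 2 * √n with hr
      have hr0 : 0 < r := by positivity
      have hr2 : r ^ 2 = 4 * n := by rw [hr, mul_pow, Real.sq_sqrt hn0.le]; norm_num
      have h1 := Complex.norm_iteratedDeriv_le_of_forall_mem_sphere_norm_le (f := Φ) (c := c)
        (C := M * Real.exp (r ^ 2 / 8)) n hr0 hΦd.diffContOnCl (fun z hz => by
          have := hM z
          rwa [mem_sphere_iff_norm.1 hz] at this)
      have h2 : ‖d n‖ ^ 2 ≤ (n ! * (M * Real.exp (r ^ 2 / 8)) / r ^ n / √(n ! : ℝ)) ^ 2 := by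
        rw [hdnorm]; gcongr
      refine h2.trans ?_
      have hf : √(n ! : ℝ) ^ 2 = n ! := Real.sq_sqrt (by positivity)
      have h3 : (n ! * (M * Real.exp (r ^ 2 / 8)) / r ^ n / √(n ! : ℝ)) ^ 2
          = M ^ 2 * (n ! * Real.exp n / (4 * n) ^ n) := by
        rw [div_pow, div_pow, mul_pow, mul_pow, hf, ← pow_mul, mul_comm n 2, pow_mul, hr2,
          ← Real.exp_nat_mul]
        have : (n ! : ℝ) ≠ 0 := by positivity
        have e : ((2 : ℕ) : ℝ) * (4 * n / 8) = n := by push_cast; ring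
        rw [e]
        field_simp
      rw [h3]
      gcongr
      rw [div_le_iff₀ (by positivity), ← mul_pow]
      calc (n ! : ℝ) * Real.exp n ≤ n ^ n * Real.exp 1 ^ n := by
            have h4 : (n ! : ℝ) ≤ n ^ n := by exact_mod_cast Nat.factorial_le_pow n
            rw [← Real.exp_nat_mul, mul_one]
            gcongr
        _ = (n * Real.exp 1) ^ n := by rw [mul_pow]
        _ ≤ (7 / 10 * (4 * n)) ^ n := by
            have := Real.exp_one_lt_d9
            exact pow_le_pow_left₀ (by positivity) (by nlinarith) n
  set a : ℕ → ℝ := fun n => (d n).re with ha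
  have han : ∀ n, a n ^ 2 ≤ M ^ 2 * (7 / 10) ^ n := fun n => by
    refine le_trans ?_ (hdn n)
    rw [← sq_abs]
    gcongr
    exact Complex.abs_re_le_norm _
  have hgeo : HasSum (fun n : ℕ => M ^ 2 * (7 / 10 : ℝ) ^ n) (M ^ 2 * (1 - 7 / 10)⁻¹) :=
    (hasSum_geometric_of_lt_one (by norm_num) (by norm_num)).mul_left _
  have hasum : Summable fun n => a n ^ 2 :=
    Summable.of_nonneg_of_le (fun n => sq_nonneg _) han hgeo.summable
  have hD : ∑' n, a n ^ 2 ≤ (2 * M) ^ 2 := by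
    refine (hasum.tsum_le_tsum han hgeo.summable).trans ?_
    rw [hgeo.tsum_eq]
    nlinarith [sq_nonneg M]
  have hgrow : HasGrowth a M := by
    intro n
    have h1 : (7 / 10 : ℝ) ^ n ≤ 1 := pow_le_one₀ (by norm_num) (by norm_num)
    have h2 : (1 : ℝ) ≤ 2 ^ n := one_le_pow₀ (by norm_num)
    have h3 : |a n| ^ 2 ≤ M ^ 2 := by
      rw [sq_abs]
      calc a n ^ 2 ≤ _ := han n
        _ ≤ M ^ 2 * 1 := by gcongr
        _ = M ^ 2 := by ring
    have h4 : |a n| ≤ M := le_of_sq_le_sq h3 hM0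
    nlinarith
  have hre : ∀ y : ℝ, (G y).re = normSeries a (y - c) := by
    intro y
    have h1 := Complex.hasSum_taylorSeries_of_entire hΦd c y
    have h2 := (h1.mul_left (Complex.exp (-((y : ℂ) - c) ^ 2 / 2)))
    have h3 : Complex.exp (-((y : ℂ) - c) ^ 2 / 2) * Φ y = G y := by
      rw [hΦ]
      simp only
      rw [mul_left_comm, ← Complex.exp_add]
      have : -((y : ℂ) - c) ^ 2 / 2 + ((y : ℂ) - c) ^ 2 / 2 = 0 := by ring
      rw [this]; simp
    rw [h3] at h2
    have h4 := Complex.hasSum_re h2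
    refine h4.unique ?_ 
    have h5 := (hgrow.summable (y - c)).hasSum
    convert! h5 using 1
    ext n
    have hs := (sqrt_factorial_pos n).ne'
    have e1 : Complex.exp (-((y : ℂ) - c) ^ 2 / 2) = ((Real.exp (-(y - c) ^ 2 / 2) : ℝ) : ℂ) := by
      push_cast; rfl
    have e2 : ((n ! : ℂ))⁻¹ = (((√(n ! : ℝ))⁻¹ * (√(n ! : ℝ))⁻¹ : ℝ) : ℂ) := by
      rw [← mul_inv, Real.mul_self_sqrt (by positivity)]; push_cast; rfl
    have e3 : iteratedDeriv n Φ c = (√(n ! : ℝ) : ℂ) * d n := by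
      rw [hd]
      have : (√(n ! : ℝ) : ℂ) ≠ 0 := by exact_mod_cast hs
      field_simp
    rw [e1, e2, e3]
    have e4 : ((Real.exp (-(y - c) ^ 2 / 2) : ℝ) : ℂ) *
        ((((√(n ! : ℝ))⁻¹ * (√(n ! : ℝ))⁻¹ : ℝ) : ℂ) • ((y : ℂ) - c) ^ n • ((√(n ! : ℝ) : ℂ) * d n))
        = ((Real.exp (-(y - c) ^ 2 / 2) * ((√(n ! : ℝ))⁻¹ * (√(n ! : ℝ))⁻¹) * (y - c) ^ n
          * √(n ! : ℝ) : ℝ) : ℂ) * d n := by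
      simp only [smul_eq_mul]; push_cast; ring
    rw [e4, Complex.re_ofReal_mul]
    unfold weylFun
    simp only [ha]
    field_simp
  have hder : ∀ y : ℝ, (deriv G y).re = normSeriesDeriv a (y - c) := by
    intro y
    have h1 := (hG y).hasDerivAt.real_of_complex
    have h2 : HasDerivAt (fun y : ℝ => normSeries a (y - c)) (normSeriesDeriv a (y - c)) y :=
      (hgrow.hasDerivAt (y - c)).comp_sub_const y c
    simp_rw [hre] at h1
    exact h1.unique h2
  set l : ℕ → ℝ := fun n => ∑ p, u p * jetFun (fun i => x i - c) p n with hl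
  have hlr : RapidDecay l :=
    RapidDecay.sum _ fun p => (rapidDecay_jetFun (fun i => x i - c) p).const_mul (u p)
  have hsum : (jetApply x u G).re = ∑' n, a n * l n := by
    have hs : ∀ p : σ ⊕ σ, HasSum (fun n => a n * (u p * jetFun (fun i => x i - c) p n))
        (Sum.elim (fun i => u (Sum.inl i) * normSeries a (x i - c))
          (fun i => u (Sum.inr i) * normSeriesDeriv a (x i - c)) p) := by
      intro p
      rcases p with i | i
      · have := (hgrow.summable (x i - c)).hasSum.mul_left (u (Sum.inl i))
        convert! this using 1
        ext n; simp [jetFun]; ring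
      · have := (hgrow.summable_deriv (x i - c)).hasSum.mul_left (u (Sum.inr i))
        convert! this using 1
        ext n; simp [jetFun]; ring
    have h2 := hasSum_sum fun (p : σ ⊕ σ) (_ : p ∈ Finset.univ) => hs p
    have h3 : ∀ n, ∑ p, a n * (u p * jetFun (fun i => x i - c) p n) = a n * l n := fun n => by
      rw [hl, Finset.mul_sum]
    simp_rw [h3] at h2
    rw [h2.tsum_eq, Fintype.sum_sum_type]
    unfold jetApply
    rw [Complex.re_sum, ← Finset.sum_add_distrib]
    refine Finset.sum_congr rfl fun i _ => ?_
    simp only [Complex.add_re, Complex.re_ofReal_mul, Sum.elim_inl, Sum.elim_inr, hre, hder]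
  have hQ := hasSum_jetCov_quad (fun i => x i - c) u
  rw [crossCov_sub] at hQ
  rw [hsum]
  refine (abs_tsum_mul_le hasum.hasSum hQ (hlr.summable_mul hgrow)).trans ?_
  gcongr
  calc √(∑' n, a n ^ 2) ≤ √((2 * M) ^ 2) := Real.sqrt_le_sqrt hD
    _ = 2 * M := Real.sqrt_sq (by positivity)

theorem norm_jetApply_le (x : σ → ℝ) (u : σ ⊕ σ → ℝ) (c : ℝ) {G : ℂ → ℂ}
    (hG : Differentiable ℂ G) {M : ℝ}
    (hM : ∀ z, ‖G z * Complex.exp ((z - c) ^ 2 / 2)‖ ≤ M * Real.exp (‖z - c‖ ^ 2 / 8)) :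
    ‖jetApply x u G‖ ≤ 4 * M * √(u ⬝ᵥ crossCov x x *ᵥ u) := by
  have h1 := abs_re_jetApply_le x u c hG hM
  have h2 := abs_re_jetApply_le x u c (G := fun z => -Complex.I * G z) (hG.const_mul _) (M := M)
    (fun z => by
      have := hM z
      rw [mul_assoc, norm_mul]
      simpa using this)
  rw [jetApply_const_mul x u _ hG] at h2
  have h3 : (-Complex.I * jetApply x u G).re = (jetApply x u G).im := by simp
  rw [h3] at h2
  have := Complex.norm_le_abs_re_add_abs_im (jetApply x u G)
  linarith

end Jets

section Interpolation

/-- An entire function with a double zero at `0` and no other zeros near the real line. -/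
noncomputable def notch (η : ℝ) (z : ℂ) : ℂ := 1 - Complex.exp (-(η * z ^ 2))

theorem differentiable_notch (η : ℝ) : Differentiable ℂ (notch η) := by
  unfold notch; fun_prop

theorem notch_zero (η : ℝ) : notch η 0 = 0 := by simp [notch]

theorem deriv_notch_zero (η : ℝ) : deriv (notch η) 0 = 0 := by
  have h : HasDerivAt (notch η) 0 0 := by
    have h1 : HasDerivAt (fun z : ℂ => -(η * z ^ 2)) 0 0 := by
      have := ((hasDerivAt_pow 2 (0 : ℂ)).const_mul (η : ℂ)).neg
      simpa using! this
    have h2 := h1.cexp.const_sub 1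
    simpa using! h2
  exact h.deriv

theorem norm_notch_near {η : ℝ} (hη : 0 < η) (hη1 : η ≤ 1 / 16) {z : ℂ} (hz : ‖z‖ ≤ 2) :
    η / 2 * ‖z‖ ^ 2 ≤ ‖notch η z‖ := by
  set w : ℂ := -(η * z ^ 2) with hw
  have hwn : ‖w‖ = η * ‖z‖ ^ 2 := by
    rw [hw, norm_neg, norm_mul, norm_pow, Complex.norm_real, Real.norm_eq_abs, abs_of_pos hη]
  have hw1 : ‖w‖ ≤ 1 / 4 := by
    rw [hwn]
    nlinarith [norm_nonneg z]
  have h1 := Complex.norm_exp_sub_one_sub_id_le (x := w) (by linarith)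
  have h2 : notch η z = -(Complex.exp w - 1 - w) - w := by rw [notch, hw]; ring
  have h3 : ‖w‖ - ‖Complex.exp w - 1 - w‖ ≤ ‖notch η z‖ := by
    rw [h2, ← norm_neg (Complex.exp w - 1 - w)]
    have := norm_sub_norm_le w (-(Complex.exp w - 1 - w))
    rw [norm_sub_rev] at this
    exact this
  nlinarith [norm_nonneg w]

theorem norm_notch_far {η : ℝ} (hη : 0 < η) (hη1 : η ≤ 1 / 16) {z : ℂ} (hz : 1 / 2 ≤ ‖z‖)
    (him : |z.im| ≤ 1) : η / 8 ≤ ‖notch η z‖ := by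
  by_cases h : ‖z‖ ≤ 2
  · have h0 := norm_notch_near hη hη1 h
    have h1 : 1 / 4 ≤ ‖z‖ ^ 2 := by nlinarith
    nlinarith [mul_le_mul_of_nonneg_left h1 hη.le]
  · push Not at h
    have h1 : ‖z‖ ^ 2 = z.re ^ 2 + z.im ^ 2 := by
      rw [Complex.sq_norm, Complex.normSq_apply]; ring
    have h2 : z.im ^ 2 ≤ 1 := by rw [← sq_abs]; nlinarith [abs_nonneg z.im]
    have h3 : (-((η : ℂ) * z ^ 2)).re = -η * (z.re ^ 2 - z.im ^ 2) := by
      rw [Complex.neg_re, Complex.re_ofReal_mul, sq z, Complex.mul_re]; ring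
    have h4 : ‖Complex.exp (-(η * z ^ 2))‖ ≤ Real.exp (-(2 * η)) := by
      rw [Complex.norm_exp, h3]
      refine Real.exp_le_exp.2 ?_
      have h7 : 2 ≤ z.re ^ 2 - z.im ^ 2 := by nlinarith
      nlinarith [mul_le_mul_of_nonneg_left h7 hη.le]
    have h5 : Real.exp (-(2 * η)) ≤ 1 - η := by
      have h6 : 1 + 2 * η ≤ Real.exp (2 * η) := by linarith [Real.add_one_le_exp (2 * η)]
      rw [Real.exp_neg]
      refine (inv_anti₀ (by positivity) h6).trans ?_
      rw [inv_le_iff_one_le_mul₀ (by positivity)]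
      nlinarith
    have h7 := norm_sub_norm_le (1 : ℂ) (Complex.exp (-(η * z ^ 2)))
    rw [norm_one] at h7
    unfold notch
    linarith

theorem notch_ne_zero {η : ℝ} (hη : 0 < η) (hη1 : η ≤ 1 / 16) {z : ℂ} (hz : z ≠ 0)
    (him : |z.im| ≤ 1) : notch η z ≠ 0 := by
  rw [← norm_pos_iff]
  by_cases h : ‖z‖ ≤ 2
  · refine lt_of_lt_of_le ?_ (norm_notch_near hη hη1 h)
    have := norm_pos_iff.2 hz
    positivity
  · refine lt_of_lt_of_le (by positivity) (norm_notch_far hη hη1 (by linarith) him)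

/-- A function with prescribed value `α` and derivative `β` at `c`. -/
noncomputable def osculator (α β : ℂ) (c : ℝ) (z : ℂ) : ℂ :=
  (α + β * (z - c)) * Complex.exp (-((z - c) ^ 2 / 2))

theorem differentiable_osculator (α β : ℂ) (c : ℝ) : Differentiable ℂ (osculator α β c) := by
  unfold osculator; fun_prop

theorem osculator_self (α β : ℂ) (c : ℝ) : osculator α β c c = α := by simp [osculator]

theorem deriv_osculator_self (α β : ℂ) (c : ℝ) : deriv (osculator α β c) c = β := by
  have h1 : HasDerivAt (fun z : ℂ => α + β * (z - c)) β c := by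
    simpa using (((hasDerivAt_id (c : ℂ)).sub_const (c : ℂ)).const_mul β).const_add α
  have h2 : HasDerivAt (fun z : ℂ => Complex.exp (-((z - c) ^ 2 / 2))) 0 c := by
    have h0 := ((((hasDerivAt_id (c : ℂ)).sub_const (c : ℂ)).pow 2).div_const 2).neg.cexp
    simpa using h0
  have h3 := h1.mul h2
  have h4 : HasDerivAt (osculator α β c) β c := by simpa [osculator] using! h3
  exact h4.deriv

theorem norm_osculator_le (α β : ℂ) (c : ℝ) {z : ℂ} (him : |z.im| ≤ 1) :
    ‖osculator α β c z‖ ≤ 2 * (‖α‖ + 2 * ‖β‖) := by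
  set w := z - (c : ℂ) with hw
  have hwim : w.im = z.im := by simp [hw]
  have hre : (-(w ^ 2 / 2)).re = (w.im ^ 2 - w.re ^ 2) / 2 := by
    simp [sq]; ring
  have him2 : w.im ^ 2 ≤ 1 := by rw [hwim, ← sq_abs]; nlinarith [abs_nonneg z.im]
  have h1 : ‖Complex.exp (-(w ^ 2 / 2))‖ ≤ 2 * Real.exp (-(w.re ^ 2 / 2)) := by
    rw [Complex.norm_exp, hre]
    have e : (w.im ^ 2 - w.re ^ 2) / 2 = w.im ^ 2 / 2 + -(w.re ^ 2 / 2) := by ring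
    rw [e, Real.exp_add]
    gcongr
    have h0 : Real.exp (w.im ^ 2 / 2) ≤ Real.exp (1 / 2) := Real.exp_le_exp.2 (by linarith)
    refine h0.trans ?_
    have h2 : Real.exp (1 / 2) ^ 2 = Real.exp 1 := by
      rw [← Real.exp_nat_mul]; norm_num
    have := Real.exp_one_lt_d9
    nlinarith [Real.exp_pos (1 / 2)]
  have h2 : ‖w‖ ≤ |w.re| + 1 := by
    refine (Complex.norm_le_abs_re_add_abs_im w).trans ?_
    rw [hwim]; linarith
  have h3 : (|w.re| + 1) * Real.exp (-(w.re ^ 2 / 2)) ≤ 2 := by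
    rw [Real.exp_neg, ← div_eq_mul_inv, div_le_iff₀ (Real.exp_pos _)]
    have h4 := Real.add_one_le_exp (w.re ^ 2 / 2)
    have h5 : w.re ^ 2 = |w.re| ^ 2 := (sq_abs _).symm
    nlinarith [sq_nonneg (|w.re| - 1)]
  have h4 : Real.exp (-(w.re ^ 2 / 2)) ≤ 1 := Real.exp_le_one_iff.2 (by nlinarith [sq_nonneg w.re])
  have h5 : ‖α + β * w‖ ≤ ‖α‖ + ‖β‖ * (|w.re| + 1) := by
    refine (norm_add_le _ _).trans ?_
    rw [norm_mul]
    gcongr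
  have : osculator α β c z = (α + β * w) * Complex.exp (-(w ^ 2 / 2)) := rfl
  rw [this, norm_mul]
  calc ‖α + β * w‖ * ‖Complex.exp (-(w ^ 2 / 2))‖
      ≤ (‖α‖ + ‖β‖ * (|w.re| + 1)) * (2 * Real.exp (-(w.re ^ 2 / 2))) := by gcongr
    _ = 2 * (‖α‖ * Real.exp (-(w.re ^ 2 / 2))
          + ‖β‖ * ((|w.re| + 1) * Real.exp (-(w.re ^ 2 / 2)))) := by ring
    _ ≤ 2 * (‖α‖ * 1 + ‖β‖ * 2) := by gcongr
    _ = _ := by ring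

/-- Division by a double zero: the quotient is bounded on the same domain. -/
theorem exists_notch_quotient {η : ℝ} (hη : 0 < η) (hη1 : η ≤ 1 / 16) {S : Set ℂ} (hS : IsOpen S)
    (hSim : ∀ z ∈ S, |z.im| ≤ 1) {c : ℝ} (hc : Metric.ball (c : ℂ) 1 ⊆ S) {g : ℂ → ℂ}
    (hg : DifferentiableOn ℂ g S) {M : ℝ} (hM : ∀ z ∈ S, ‖g z‖ ≤ M) :
    ‖g c‖ ≤ M ∧ ‖deriv g c‖ ≤ 2 * M ∧
    ∃ q : ℂ → ℂ, DifferentiableOn ℂ q S ∧ (∀ z ∈ S, ‖q z‖ ≤ 88 / η * M) ∧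
      ∀ z ∈ S, g z = osculator (g c) (deriv g c) c z + notch η (z - c) * q z := by
  have hcS : (c : ℂ) ∈ S := hc (Metric.mem_ball_self one_pos)
  have hcb : Metric.closedBall (c : ℂ) (1 / 2) ⊆ S :=
    (Metric.closedBall_subset_ball (by norm_num)).trans hc
  have hα : ‖g c‖ ≤ M := hM _ hcS
  have hβ : ‖deriv g c‖ ≤ 2 * M := by
    have h1 : DiffContOnCl ℂ g (Metric.ball (c : ℂ) (1 / 2)) := by
      refine DifferentiableOn.diffContOnCl ?_
      rw [closure_ball _ (by norm_num)]
      exact hg.mono hcb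
    have := Complex.norm_deriv_le_of_forall_mem_sphere_norm_le (by norm_num) h1
      (fun z hz => hM z (hcb (Metric.sphere_subset_closedBall hz)))
    linarith
  refine ⟨hα, hβ, ?_⟩
  have hM0 : 0 ≤ M := (norm_nonneg _).trans hα
  set o := osculator (g c) (deriv g c) c with ho
  set r : ℂ → ℂ := fun z => g z - o z with hr
  have hrd : DifferentiableOn ℂ r S := hg.sub (differentiable_osculator _ _ _).differentiableOn
  have hrM : ∀ z ∈ S, ‖r z‖ ≤ 11 * M := by
    intro z hz
    have h1 := norm_osculator_le (g c) (deriv g c) c (hSim z hz)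
    have h2 := hM z hz
    have h3 := norm_sub_le (g z) (o z)
    linarith
  have hrc : r c = 0 := by simp [hr, ho, osculator_self]
  have hrc' : deriv r c = 0 := by
    rw [hr, deriv_fun_sub (hg.differentiableAt (hS.mem_nhds hcS))
      (differentiable_osculator _ _ _ _), deriv_osculator_self, sub_self]
  set r2 := dslope (dslope r c) c with hr2
  have hr2d : DifferentiableOn ℂ r2 S :=
    (Complex.differentiableOn_dslope (hS.mem_nhds hcS)).2
      ((Complex.differentiableOn_dslope (hS.mem_nhds hcS)).2 hrd)
  have hrr2 : ∀ z, r z = (z - c) ^ 2 * r2 z := by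
    intro z
    have h1 := sub_smul_dslope r c z
    have h2 := sub_smul_dslope (dslope r c) c z
    rw [dslope_same, hrc', sub_zero] at h2
    rw [hrc, sub_zero, ← h2] at h1
    rw [← h1]
    simp only [smul_eq_mul]
    ring
  obtain ⟨B, hB⟩ := (isCompact_closedBall (c : ℂ) (1 / 2)).exists_bound_of_continuousOn
    (hr2d.continuousOn.mono hcb)
  set q0 : ℂ → ℂ := fun z => r z / notch η (z - c) with hq0
  have him : ∀ z ∈ S, |(z - c).im| ≤ 1 := fun z hz => by simpa using hSim z hz
  have hq0d : DifferentiableOn ℂ q0 (S \ {(c : ℂ)}) := by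
    refine DifferentiableOn.div (hrd.mono Set.sdiff_subset)
      ((differentiable_notch η).comp (differentiable_id.sub_const _)).differentiableOn ?_
    intro z hz
    exact notch_ne_zero hη hη1 (sub_ne_zero.2 hz.2) (him z hz.1)
  have hfar : ∀ z ∈ S, 1 / 2 ≤ ‖z - c‖ → ‖q0 z‖ ≤ 88 / η * M := by
    intro z hz hzc
    have h1 := norm_notch_far hη hη1 hzc (him z hz)
    rw [hq0, norm_div]
    calc ‖r z‖ / ‖notch η (z - c)‖ ≤ (11 * M) / (η / 8) := by
          gcongr
          exact hrM z hz
      _ = _ := by field_simp; ring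
  have hnear : ∀ z : ℂ, ‖z - c‖ ≤ 1 / 2 → z ≠ c → ‖q0 z‖ ≤ B * (2 / η) := by
    intro z hz hzc
    have h1 := norm_notch_near hη hη1 (z := z - c) (by linarith)
    have h2 : 0 < ‖z - c‖ := norm_pos_iff.2 (sub_ne_zero.2 hzc)
    have h3 := hB z (by simpa [dist_eq_norm] using hz)
    have hB0 : 0 ≤ B := (norm_nonneg _).trans h3
    simp only [hq0]
    rw [norm_div, hrr2 z, norm_mul, norm_pow]
    calc ‖z - c‖ ^ 2 * ‖r2 z‖ / ‖notch η (z - c)‖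
        ≤ ‖z - c‖ ^ 2 * B / (η / 2 * ‖z - c‖ ^ 2) := by gcongr
      _ = _ := by field_simp
  set q := Function.update q0 c (Filter.limUnder (𝓝[≠] (c : ℂ)) q0) with hq
  have hqd : DifferentiableOn ℂ q S := by
    refine Complex.differentiableOn_update_limUnder_of_bddAbove (hS.mem_nhds hcS) hq0d ?_
    refine ⟨max (88 / η * M) (B * (2 / η)), ?_⟩
    rintro _ ⟨z, hz, rfl⟩
    by_cases h : 1 / 2 ≤ ‖z - c‖
    · exact (hfar z hz.1 h).trans (le_max_left _ _)
    · exact (hnear z (by linarith) hz.2).trans (le_max_right _ _)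
  have hqne : ∀ z : ℂ, z ≠ c → q z = q0 z := fun z hz => Function.update_of_ne hz _ _
  have hqfar : ∀ z ∈ S, 1 / 2 ≤ ‖z - c‖ → ‖q z‖ ≤ 88 / η * M := by
    intro z hz h
    have : z ≠ c := by
      rintro rfl
      simp at h
      linarith
    rw [hqne z this]
    exact hfar z hz h
  refine ⟨q, hqd, fun z hz => ?_, fun z hz => ?_⟩
  · by_cases h : 1 / 2 ≤ ‖z - c‖
    · exact hqfar z hz h
    · have hcl : closure (Metric.ball (c : ℂ) (1 / 2)) = Metric.closedBall (c : ℂ) (1 / 2) :=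
        closure_ball _ (by norm_num)
      refine Complex.norm_le_of_forall_mem_frontier_norm_le (U := Metric.ball (c : ℂ) (1 / 2))
        Metric.isBounded_ball (DifferentiableOn.diffContOnCl ?_) (fun w hw => ?_) ?_
      · rw [hcl]; exact hqd.mono hcb
      · rw [frontier_ball _ (by norm_num)] at hw
        refine hqfar w (hcb (Metric.sphere_subset_closedBall hw)) ?_
        rw [mem_sphere_iff_norm.1 hw]
      · rw [hcl, Metric.mem_closedBall, dist_eq_norm]
        linarith
  · by_cases h : z = c
    · rw [h, sub_self, notch_zero, zero_mul, add_zero, ho, osculator_self]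
    · rw [hqne z h]
      simp only [hq0, hr]
      have := notch_ne_zero hη hη1 (sub_ne_zero.2 h) (him z hz)
      field_simp
      ring

theorem norm_notch_le {η : ℝ} (hη : 0 < η) (y c : ℝ) (z : ℂ) :
    ‖notch η (z - y)‖ ≤ 2 * Real.exp (η * ‖z - c‖ ^ 2) := by
  have h3 : (-((η : ℂ) * (z - y) ^ 2)).re = -η * ((z - y).re ^ 2 - (z - y).im ^ 2) := by
    rw [Complex.neg_re, Complex.re_ofReal_mul, sq (z - y), Complex.mul_re]; ring
  have him : (z - y).im = (z - c).im := by simp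
  have h4 : ‖Complex.exp (-(η * (z - y) ^ 2))‖ ≤ Real.exp (η * ‖z - c‖ ^ 2) := by
    rw [Complex.norm_exp, h3, him]
    refine Real.exp_le_exp.2 ?_
    have h1 : ‖z - c‖ ^ 2 = (z - c).re ^ 2 + (z - c).im ^ 2 := by
      rw [Complex.sq_norm, Complex.normSq_apply]; ring
    rw [h1]
    nlinarith [sq_nonneg (z - c).re, sq_nonneg (z - y).re, mul_nonneg hη.le (sq_nonneg (z - c).re),
      mul_nonneg hη.le (sq_nonneg (z - y).re)]
  have h5 : 1 ≤ Real.exp (η * ‖z - c‖ ^ 2) := Real.one_le_exp (by positivity)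
  unfold notch
  refine (norm_sub_le _ _).trans ?_
  rw [norm_one]
  linarith

/-- The product of the notches at the points of a list. -/
noncomputable def notchProd (η : ℝ) (l : List ℝ) (z : ℂ) : ℂ := (l.map fun y : ℝ => notch η (z - y)).prod

theorem differentiable_notchProd (η : ℝ) (l : List ℝ) : Differentiable ℂ (notchProd η l) := by
  induction l with
  | nil => exact differentiable_const (𝕜 := ℂ) (E := ℂ) (1 : ℂ)
  | cons y l ih =>
    have : notchProd η (y :: l) = fun z => notch η (z - y) * notchProd η l z := by
      ext z; simp [notchProd]
    rw [this]
    exact ((differentiable_notch η).comp (differentiable_id.sub_const _)).mul ih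

theorem norm_notchProd_le {η : ℝ} (hη : 0 < η) (l : List ℝ) (c : ℝ) (z : ℂ) :
    ‖notchProd η l z‖ ≤ 2 ^ l.length * Real.exp (l.length * η * ‖z - c‖ ^ 2) := by
  induction l with
  | nil => simp [notchProd]
  | cons y l ih =>
    have : notchProd η (y :: l) z = notch η (z - y) * notchProd η l z := by simp [notchProd]
    rw [this, norm_mul]
    calc ‖notch η (z - y)‖ * ‖notchProd η l z‖
        ≤ (2 * Real.exp (η * ‖z - c‖ ^ 2)) *
          (2 ^ l.length * Real.exp (l.length * η * ‖z - c‖ ^ 2)) := by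
          gcongr
          exact norm_notch_le hη y c z
      _ = 2 ^ (l.length + 1) * (Real.exp (η * ‖z - c‖ ^ 2)
          * Real.exp (l.length * η * ‖z - c‖ ^ 2)) := by ring
      _ = _ := by
          rw [← Real.exp_add, List.length_cons]
          congr 2
          push_cast; ring

variable {σ : Type*} [Fintype σ]

theorem norm_jetApply_osculator_le (x : σ → ℝ) (u : σ ⊕ σ → ℝ) {η : ℝ} (hη : 0 < η) {k : ℕ}
    (hk : k * η ≤ 1 / 16) (l : List ℝ) (hl : l.length ≤ k) (α β : ℂ) (c : ℝ) :
    ‖jetApply x u fun z => notchProd η l z * osculator α β c z‖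
      ≤ 4 * (2 ^ k * (‖α‖ + 4 * ‖β‖)) * √(u ⬝ᵥ crossCov x x *ᵥ u) := by
  refine norm_jetApply_le x u c
    ((differentiable_notchProd η l).mul (differentiable_osculator α β c)) fun z => ?_
  have h1 := norm_notchProd_le hη l c z
  set t := ‖z - c‖ with ht
  have ht0 : 0 ≤ t := norm_nonneg _
  have h2 : osculator α β c z * Complex.exp ((z - c) ^ 2 / 2) = α + β * (z - c) := by
    rw [osculator, mul_assoc, ← Complex.exp_add, neg_add_cancel, Complex.exp_zero, mul_one]
  rw [Pi.mul_apply, mul_assoc, h2, norm_mul]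
  have h3 : ‖α + β * (z - c)‖ ≤ ‖α‖ + ‖β‖ * t := by
    refine (norm_add_le _ _).trans ?_
    rw [norm_mul]
  have h4 : t ≤ 4 * Real.exp (t ^ 2 / 16) := by
    have := Real.add_one_le_exp (t ^ 2 / 16)
    nlinarith [sq_nonneg (t - 8)]
  have h5 : (1 : ℝ) ≤ Real.exp (t ^ 2 / 16) := Real.one_le_exp (by positivity)
  have h6 : (2 : ℝ) ^ l.length ≤ 2 ^ k := pow_le_pow_right₀ (by norm_num) hl
  have h7 : (l.length : ℝ) * η * t ^ 2 ≤ t ^ 2 / 16 := by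
    have h8 : (l.length : ℝ) * η ≤ 1 / 16 := le_trans (by gcongr) hk
    nlinarith [sq_nonneg t]
  calc ‖notchProd η l z‖ * ‖α + β * (z - c)‖
      ≤ (2 ^ k * Real.exp (t ^ 2 / 16)) * (‖α‖ + ‖β‖ * t) := by
        gcongr
        refine h1.trans ?_
        gcongr
    _ ≤ (2 ^ k * Real.exp (t ^ 2 / 16)) *
        (‖α‖ * Real.exp (t ^ 2 / 16) + ‖β‖ * (4 * Real.exp (t ^ 2 / 16))) := by
        gcongr
        exact le_mul_of_one_le_right (norm_nonneg _) h5
    _ = 2 ^ k * (‖α‖ + 4 * ‖β‖) * (Real.exp (t ^ 2 / 16) * Real.exp (t ^ 2 / 16)) := by ring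
    _ = _ := by rw [← Real.exp_add]; congr 2; ring

/-- Interpolation at double nodes, with bounds in terms of variances. -/
theorem exists_interpolant {η : ℝ} (hη : 0 < η) (hη1 : η ≤ 1 / 16) {k : ℕ}
    (hk : k * η ≤ 1 / 16) (n : ℕ) : ∃ C : ℝ, 0 ≤ C ∧ ∀ {σ : Type} [Fintype σ] (x : σ → ℝ)
    (u : σ ⊕ σ → ℝ) {S : Set ℂ} (_ : IsOpen S) (_ : ∀ z ∈ S, |z.im| ≤ 1) (l pre : List ℝ)
    (_ : l.length = n) (_ : pre.length + l.length ≤ k)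
    (_ : ∀ y ∈ l, Metric.ball ((y : ℝ) : ℂ) 1 ⊆ S) {g : ℂ → ℂ} (_ : DifferentiableOn ℂ g S)
    {M : ℝ} (_ : ∀ z ∈ S, ‖g z‖ ≤ M),
    ∃ G : ℂ → ℂ, Differentiable ℂ G ∧ (∀ y ∈ l, G (y : ℝ) = g (y : ℝ)) ∧
      (∀ y ∈ l, deriv G (y : ℝ) = deriv g (y : ℝ)) ∧
      ‖jetApply x u fun z => notchProd η pre z * G z‖ ≤ C * M * √(u ⬝ᵥ crossCov x x *ᵥ u) := by
  induction n with
  | zero =>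
    refine ⟨0, le_rfl, ?_⟩
    intro σ _ x u S _ _ l pre hl _ _ g _ M _
    obtain rfl := List.length_eq_zero_iff.1 hl
    refine ⟨fun _ => 0, differentiable_const 0, by simp, by simp, ?_⟩
    simp [jetApply]
  | succ n ih =>
    obtain ⟨C, hC0, hC⟩ := ih
    refine ⟨4 * (2 ^ k * (1 + 4 * 2)) + C * (88 / η), by positivity, ?_⟩
    intro σ _ x u S hS hSim l pre hl hlen hball g hg M hM
    match l, hl with
    | c :: l, hl =>
      simp only [List.length_cons, add_left_inj] at hl
      simp only [List.length_cons] at hlen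
      obtain ⟨hα, hβ, q, hqd, hqM, hgq⟩ := exists_notch_quotient hη hη1 hS hSim
        (hball c List.mem_cons_self) hg hM
      obtain ⟨G', hG'd, hG'0, hG'1, hG'b⟩ := hC x u hS hSim l (c :: pre) hl
        (by simp only [List.length_cons]; omega) (fun y hy => hball y (List.mem_cons_of_mem _ hy))
        hqd hqM
      set o := osculator (g c) (deriv g c) c with ho
      have hod : Differentiable ℂ o := differentiable_osculator _ _ _
      have hnd : Differentiable ℂ fun z : ℂ => notch η (z - c) :=
        (differentiable_notch η).comp (differentiable_id.sub_const _)
      have hn0 : deriv (fun z : ℂ => notch η (z - c)) c = 0 := by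
        rw [deriv_comp_sub_const, sub_self, deriv_notch_zero]
      have hGd : Differentiable ℂ fun z => o z + notch η (z - c) * G' z := hod.add (hnd.mul hG'd)
      have hderiv : ∀ y : ℂ, deriv (fun z => o z + notch η (z - c) * G' z) y
          = deriv o y + (deriv (fun z : ℂ => notch η (z - c)) y * G' y
            + notch η (y - c) * deriv G' y) := fun y => by
        rw [deriv_fun_add (hod y) ((hnd y).fun_mul (hG'd y)), deriv_fun_mul (hnd y) (hG'd y)]
      refine ⟨fun z => o z + notch η (z - c) * G' z, hGd, ?_, ?_, ?_⟩
      · intro y hy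
        by_cases hyc : y = c
        · simp only [hyc]
          rw [sub_self, notch_zero, zero_mul, add_zero, ho, osculator_self]
        · have hyl : y ∈ l := (List.mem_cons.1 hy).resolve_left hyc
          have hyS : ((y : ℝ) : ℂ) ∈ S := hball y hy (Metric.mem_ball_self one_pos)
          simp only
          rw [hG'0 y hyl, hgq _ hyS]
      · intro y hy
        rw [hderiv]
        have hyS : ((y : ℝ) : ℂ) ∈ S := hball y hy (Metric.mem_ball_self one_pos)
        by_cases hyc : y = c
        · rw [hyc, hn0, sub_self, notch_zero, zero_mul, zero_mul, add_zero, add_zero, ho,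
            deriv_osculator_self]
        · have hyl : y ∈ l := (List.mem_cons.1 hy).resolve_left hyc
          have e : g =ᶠ[𝓝 ((y : ℝ) : ℂ)] fun z => o z + notch η (z - c) * q z := by
            filter_upwards [hS.mem_nhds hyS] with z hz using hgq z hz
          have hqy : DifferentiableAt ℂ q (y : ℝ) := hqd.differentiableAt (hS.mem_nhds hyS)
          rw [e.deriv_eq, deriv_fun_add (hod _) ((hnd _).fun_mul hqy), deriv_fun_mul (hnd _) hqy,
            hG'0 y hyl, hG'1 y hyl]
      · have hBd := differentiable_notchProd η pre
        have hBd' := differentiable_notchProd η (c :: pre)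
        have e : (fun z => notchProd η pre z * (o z + notch η (z - c) * G' z))
            = fun z => notchProd η pre z * o z + notchProd η (c :: pre) z * G' z := by
          ext z; simp [notchProd]; ring
        rw [e, jetApply_add x u (hBd.fun_mul hod) (hBd'.fun_mul hG'd)]
        refine (norm_add_le _ _).trans ?_
        have h1 := norm_jetApply_osculator_le x u hη hk pre (by omega) (g c) (deriv g c) c
        have hs := Real.sqrt_nonneg (u ⬝ᵥ crossCov x x *ᵥ u)
        have h2 : 4 * (2 ^ k * (‖g c‖ + 4 * ‖deriv g c‖)) * √(u ⬝ᵥ crossCov x x *ᵥ u)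
            ≤ 4 * (2 ^ k * (M + 4 * (2 * M))) * √(u ⬝ᵥ crossCov x x *ᵥ u) := by gcongr
        linarith

end Interpolation

section Decorrelation

theorem exists_norm_jetApply_le (k : ℕ) : ∃ C : ℝ, 0 ≤ C ∧ ∀ {σ : Type} [Fintype σ]
    (_ : Fintype.card σ = k) (x : σ → ℝ) (u : σ ⊕ σ → ℝ) {g : ℂ → ℂ}
    (_ : DifferentiableOn ℂ g (⋃ i, Metric.ball (x i : ℂ) 1)) {M : ℝ}
    (_ : ∀ z ∈ ⋃ i, Metric.ball (x i : ℂ) 1, ‖g z‖ ≤ M),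
    ‖jetApply x u g‖ ≤ C * M * √(u ⬝ᵥ crossCov x x *ᵥ u) := by
  have hη : (0 : ℝ) < 1 / (16 * (k + 1)) := by positivity
  have hη1 : (1 : ℝ) / (16 * (k + 1)) ≤ 1 / 16 := by
    gcongr
    have : (0 : ℝ) ≤ k := k.cast_nonneg
    linarith
  have hk : (k : ℝ) * (1 / (16 * (k + 1))) ≤ 1 / 16 := by
    have : (0 : ℝ) ≤ k := k.cast_nonneg
    rw [mul_one_div, div_le_div_iff₀ (by positivity) (by norm_num)]
    linarith
  obtain ⟨C, hC0, hC⟩ := exists_interpolant hη hη1 hk k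
  refine ⟨C, hC0, ?_⟩
  intro σ _ hσ x u g hg M hM
  obtain ⟨G, -, h0, h1, h2⟩ := hC x u (isOpen_iUnion fun i => Metric.isOpen_ball)
    (fun z hz => by
      obtain ⟨i, hi⟩ := Set.mem_iUnion.1 hz
      have h3 := (Complex.abs_im_le_norm (z - x i)).trans (mem_ball_iff_norm.1 hi).le
      simpa using h3)
    (Finset.univ.toList.map x) [] (by simp [hσ]) (by simp [hσ])
    (fun y hy => by
      obtain ⟨i, -, rfl⟩ := List.mem_map.1 hy
      exact Set.subset_iUnion (fun i => Metric.ball (x i : ℂ) 1) i) hg hM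
  have hmem : ∀ i, x i ∈ Finset.univ.toList.map x := fun i =>
    List.mem_map.2 ⟨i, by simp, rfl⟩
  rw [jetApply_congr u (fun i => (h0 _ (hmem i)).symm) (fun i => (h1 _ (hmem i)).symm)]
  simpa [notchProd] using h2

theorem deriv_sq_mul_self (c : ℂ) {r : ℂ → ℂ} (hr : Differentiable ℂ r) :
    deriv (fun z => (z - c) ^ 2 * r z) c = 0 := by
  have h1 : HasDerivAt (fun z : ℂ => (z - c) ^ 2) 0 c := by
    simpa using! ((hasDerivAt_id c).sub_const c).pow 2
  have := h1.mul (hr c).hasDerivAt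
  simpa using! this.deriv

/-- Values and derivatives of the normalised Weyl series at distinct points are linearly
independent. -/
theorem eq_zero_of_jetCov_quad_eq_zero {σ : Type} [Fintype σ] {x : σ → ℝ}
    (hx : Function.Injective x) {u : σ ⊕ σ → ℝ} (hu : u ⬝ᵥ crossCov x x *ᵥ u = 0) : u = 0 := by
  classical
  obtain ⟨C, -, hC⟩ := exists_norm_jetApply_le (Fintype.card σ)
  have key : ∀ g : ℂ → ℂ, Differentiable ℂ g → jetApply x u g = 0 := by
    intro g hg
    have hb : Bornology.IsBounded (⋃ i, Metric.ball (x i : ℂ) 1) :=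
      (Bornology.isBounded_iUnion).2 fun i => Metric.isBounded_ball
    obtain ⟨M, hM⟩ := hb.isCompact_closure.exists_bound_of_continuousOn hg.continuous.continuousOn
    have := hC rfl x u hg.differentiableOn fun z hz => hM z (subset_closure hz)
    rw [hu, Real.sqrt_zero, mul_zero] at this
    exact norm_le_zero_iff.1 this
  let p : σ → ℂ → ℂ := fun i z => ∏ j ∈ Finset.univ.erase i, (z - x j) ^ 2
  have hp : ∀ i, Differentiable ℂ (p i) := fun i => by
    simp only [p]; fun_prop
  have hp0 : ∀ i, p i (x i) ≠ 0 := fun i => by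
    refine Finset.prod_ne_zero_iff.2 fun j hj => pow_ne_zero _ (sub_ne_zero.2 ?_)
    exact fun h => Finset.ne_of_mem_erase hj (hx (Complex.ofReal_injective h)).symm
  have hps : ∀ i j, j ≠ i → ∀ r : ℂ → ℂ, Differentiable ℂ r → r (x j) * p i (x j) = 0 ∧
      deriv (fun z => r z * p i z) (x j) = 0 := by
    intro i j hj r hr
    have e : (fun z => r z * p i z) = fun z => (z - x j) ^ 2 *
        (r z * ∏ l ∈ (Finset.univ.erase i).erase j, (z - x l) ^ 2) := by
      ext z
      simp only [p]
      rw [← Finset.mul_prod_erase _ _ (Finset.mem_erase.2 ⟨hj, Finset.mem_univ j⟩)]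
      ring
    refine ⟨?_, ?_⟩
    · have := congrFun e (x j)
      simpa using this
    · rw [e]
      exact deriv_sq_mul_self _ (by fun_prop)
  have hr0 : ∀ i, u (Sum.inr i) = 0 := by
    intro i
    have h := key (fun z => (z - x i) * p i z) ((by fun_prop : Differentiable ℂ fun z : ℂ => z - x i).fun_mul (hp i))
    have hd : deriv (fun z => (z - x i) * p i z) (x i) = p i (x i) := by
      have := ((hasDerivAt_id ((x i : ℂ))).sub_const (x i : ℂ)).mul (hp i _).hasDerivAt
      simpa using! this.deriv
    unfold jetApply at h
    rw [Finset.sum_eq_single i (fun j _ hj => by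
      have := hps i j hj (fun z => z - x i) (by fun_prop)
      beta_reduce
      rw [this.1, this.2]; simp) (by simp)] at h
    rw [hd] at h
    simpa [hp0 i] using h
  have hl0 : ∀ i, u (Sum.inl i) = 0 := by
    intro i
    have h := key (fun z => 1 * p i z) (by simpa using hp i)
    unfold jetApply at h
    rw [Finset.sum_eq_single i (fun j _ hj => by
      have := hps i j hj (fun z => 1) (by fun_prop)
      beta_reduce
      rw [this.1, this.2]; simp) (by simp)] at h
    simpa [hr0 i, hp0 i] using h
  ext q
  rcases q with i | i
  · exact hl0 i
  · exact hr0 i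

theorem norm_cexp_le_of_separated {a b : ℝ} {d : ℝ} (hd : 2 ≤ d) (hab : d ≤ |a - b|) {z w : ℂ}
    (hz : ‖z - a‖ ≤ 1) (hw : ‖w - b‖ ≤ 1) :
    ‖Complex.exp (-((z - w) ^ 2 / 2))‖ ≤ Real.exp (-((d - 2) ^ 2 / 2) + 2) := by
  have h1 : (-((z - w) ^ 2 / 2)).re = -(((z - w).re ^ 2 - (z - w).im ^ 2) / 2) := by
    simp [sq]
  rw [Complex.norm_exp, h1]
  refine Real.exp_le_exp.2 ?_
  have z1 := (Complex.abs_re_le_norm (z - a)).trans hz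
  have z2 := (Complex.abs_im_le_norm (z - a)).trans hz
  have w1 := (Complex.abs_re_le_norm (w - b)).trans hw
  have w2 := (Complex.abs_im_le_norm (w - b)).trans hw
  simp only [Complex.sub_re, Complex.sub_im, Complex.ofReal_re, Complex.ofReal_im, sub_zero]
    at z1 z2 w1 w2 ⊢
  have hre : d - 2 ≤ |z.re - w.re| := by
    have e : a - b = (z.re - w.re) + ((w.re - b) - (z.re - a)) := by ring
    have h3 := abs_add_le (z.re - w.re) ((w.re - b) - (z.re - a))
    have h4 := abs_sub (w.re - b) (z.re - a)
    rw [← e] at h3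
    linarith
  have him : |z.im - w.im| ≤ 2 := by
    have h4 := abs_sub z.im w.im
    linarith
  have h5 : (d - 2) ^ 2 ≤ (z.re - w.re) ^ 2 := by
    rw [← sq_abs (z.re - w.re)]
    exact pow_le_pow_left₀ (by linarith) hre 2
  have h6 : (z.im - w.im) ^ 2 ≤ 2 ^ 2 := by
    rw [← sq_abs (z.im - w.im)]
    exact pow_le_pow_left₀ (abs_nonneg _) him 2
  linarith

theorem hasDerivAt_cexp_sub_left (z w : ℂ) :
    HasDerivAt (fun z => Complex.exp (-((z - w) ^ 2 / 2))) (-(z - w) * Complex.exp (-((z - w) ^ 2 / 2))) z := by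
  have h := ((((hasDerivAt_id z).sub_const w).pow 2).div_const 2).neg.cexp
  refine h.congr_deriv ?_
  simp
  ring

theorem hasDerivAt_cexp_sub_right (z w : ℂ) :
    HasDerivAt (fun w => Complex.exp (-((z - w) ^ 2 / 2))) ((z - w) * Complex.exp (-((z - w) ^ 2 / 2))) w := by
  have h := ((((hasDerivAt_id w).const_sub z).pow 2).div_const 2).neg.cexp
  refine h.congr_deriv ?_
  simp
  ring

theorem ofReal_gaussKernel (a b : ℝ) :
    (gaussKernel a b : ℂ) = Complex.exp (-(((a : ℂ) - b) ^ 2 / 2)) := by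
  rw [gaussKernel]
  push_cast
  congr 1
  ring

theorem jetApply_cexp {σ : Type} [Fintype σ] (x : σ → ℝ) (u : σ ⊕ σ → ℝ) (w : ℂ) :
    jetApply x u (fun z => Complex.exp (-((z - w) ^ 2 / 2))) = ∑ i,
      (u (Sum.inl i) * Complex.exp (-((x i - w) ^ 2 / 2))
        + u (Sum.inr i) * (-(x i - w) * Complex.exp (-((x i - w) ^ 2 / 2)))) := by
  unfold jetApply
  refine Finset.sum_congr rfl fun i _ => ?_
  rw [(hasDerivAt_cexp_sub_left (x i : ℂ) w).deriv]

theorem hasDerivAt_jetApply_cexp {σ : Type} [Fintype σ] (x : σ → ℝ) (u : σ ⊕ σ → ℝ) (w : ℂ) :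
    HasDerivAt (fun w => jetApply x u (fun z => Complex.exp (-((z - w) ^ 2 / 2)))) (∑ i,
      (u (Sum.inl i) * ((x i - w) * Complex.exp (-((x i - w) ^ 2 / 2)))
        + u (Sum.inr i) * ((1 - (x i - w) ^ 2) * Complex.exp (-((x i - w) ^ 2 / 2))))) w := by
  simp_rw [jetApply_cexp]
  refine HasDerivAt.fun_sum fun i _ => ?_
  refine ((hasDerivAt_cexp_sub_right (x i : ℂ) w).const_mul _).fun_add (HasDerivAt.const_mul _ ?_)
  have h1 : HasDerivAt (fun w : ℂ => -((x i : ℂ) - w)) 1 w := by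
    exact ((hasDerivAt_id w).const_sub (x i : ℂ)).neg.congr_deriv (neg_neg 1)
  refine (h1.mul (hasDerivAt_cexp_sub_right (x i : ℂ) w)).congr_deriv ?_
  ring

theorem jetApply_jetApply_cexp {σ τ : Type} [Fintype σ] [Fintype τ] (x : σ → ℝ) (y : τ → ℝ)
    (u : σ ⊕ σ → ℝ) (v : τ ⊕ τ → ℝ) :
    jetApply y v (fun w => jetApply x u (fun z => Complex.exp (-((z - w) ^ 2 / 2))))
      = ((u ⬝ᵥ crossCov x y *ᵥ v : ℝ) : ℂ) := by
  rw [jetApply]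
  simp_rw [(hasDerivAt_jetApply_cexp x u _).deriv, jetApply_cexp]
  have e : u ⬝ᵥ crossCov x y *ᵥ v = ∑ q, ∑ p, u p * v q * crossCov x y p q := by
    rw [Finset.sum_comm]
    simp only [dotProduct, Matrix.mulVec, Finset.mul_sum]
    refine Finset.sum_congr rfl fun i _ => Finset.sum_congr rfl fun j _ => by ring
  rw [e, Fintype.sum_sum_type, ← Finset.sum_add_distrib]
  push_cast
  refine Finset.sum_congr rfl fun j _ => ?_
  rw [Fintype.sum_sum_type, Fintype.sum_sum_type, ← Finset.sum_add_distrib,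
    ← Finset.sum_add_distrib, ← Finset.sum_add_distrib, Finset.mul_sum, Finset.mul_sum,
    ← Finset.sum_add_distrib]
  refine Finset.sum_congr rfl fun i _ => ?_
  simp only [crossCov, Matrix.fromBlocks_apply₁₁, Matrix.fromBlocks_apply₁₂,
    Matrix.fromBlocks_apply₂₁, Matrix.fromBlocks_apply₂₂, Matrix.of_apply]
  push_cast [ofReal_gaussKernel]
  ring

/-- Jets at well separated point configurations are almost uncorrelated. -/
theorem exists_abs_crossCov_le (k l : ℕ) : ∃ C : ℝ, 0 ≤ C ∧ ∀ {σ τ : Type} [Fintype σ] [Fintype τ]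
    (_ : Fintype.card σ = k) (_ : Fintype.card τ = l) (x : σ → ℝ) (y : τ → ℝ) {d : ℝ} (_ : 2 ≤ d)
    (_ : ∀ i j, d ≤ |x i - y j|) (u : σ ⊕ σ → ℝ) (v : τ ⊕ τ → ℝ),
    |u ⬝ᵥ crossCov x y *ᵥ v| ≤ C * Real.exp (-((d - 2) ^ 2 / 2))
      * √(u ⬝ᵥ crossCov x x *ᵥ u) * √(v ⬝ᵥ crossCov y y *ᵥ v) := by
  obtain ⟨C, hC0, hC⟩ := exists_norm_jetApply_le k
  obtain ⟨D, hD0, hD⟩ := exists_norm_jetApply_le l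
  refine ⟨D * C * Real.exp 2, by positivity, ?_⟩
  intro σ τ _ _ hσ hτ x y d hd hxy u v
  have h1 : ∀ w ∈ ⋃ j, Metric.ball (y j : ℂ) 1,
      ‖jetApply x u (fun z => Complex.exp (-((z - w) ^ 2 / 2)))‖
        ≤ C * Real.exp (-((d - 2) ^ 2 / 2) + 2) * √(u ⬝ᵥ crossCov x x *ᵥ u) := by
    intro w hw
    obtain ⟨j, hj⟩ := Set.mem_iUnion.1 hw
    refine hC hσ x u (by fun_prop) fun z hz => ?_
    obtain ⟨i, hi⟩ := Set.mem_iUnion.1 hz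
    exact norm_cexp_le_of_separated hd (hxy i j) (mem_ball_iff_norm.1 hi).le
      (mem_ball_iff_norm.1 hj).le
  have h2 := hD hτ y v
    (fun w _ => (hasDerivAt_jetApply_cexp x u w).differentiableAt.differentiableWithinAt) h1
  rw [jetApply_jetApply_cexp, Complex.norm_real, Real.norm_eq_abs, Real.exp_add] at h2
  refine h2.trans_eq ?_
  ring

end Decorrelation

section PrescribedZeros

/-- The standard Gaussian density on `ℝᵐ`. -/
noncomputable def stdDensity {m : ℕ} (a : Fin m → ℝ) : ℝ := ∏ i, gaussianPDFReal 0 1 (a i)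

theorem stdDensity_pos {m : ℕ} (a : Fin m → ℝ) : 0 < stdDensity a :=
  Finset.prod_pos fun i _ => gaussianPDFReal_pos 0 1 (a i) one_ne_zero

theorem gaussianPDFReal_le_one (x : ℝ) : gaussianPDFReal 0 1 x ≤ 1 := by
  unfold gaussianPDFReal
  have h1 : (√(2 * Real.pi * ((1 : NNReal) : ℝ)))⁻¹ ≤ 1 := by
    refine inv_le_one_of_one_le₀ (Real.one_le_sqrt.2 ?_)
    have := Real.pi_gt_three
    norm_num
    linarith
  have h2 : Real.exp (-(x - 0) ^ 2 / (2 * ((1 : NNReal) : ℝ))) ≤ 1 := by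
    refine Real.exp_le_one_iff.2 ?_
    rw [neg_div, neg_nonpos]
    positivity
  exact mul_le_one₀ h1 (Real.exp_pos _).le h2

theorem stdDensity_le_one {m : ℕ} (a : Fin m → ℝ) : stdDensity a ≤ 1 :=
  Finset.prod_le_one (fun i _ => (gaussianPDFReal_pos 0 1 (a i) one_ne_zero).le)
    fun _ _ => gaussianPDFReal_le_one _

theorem continuous_stdDensity (m : ℕ) : Continuous (stdDensity (m := m)) := by
  unfold stdDensity gaussianPDFReal
  fun_prop

theorem lintegral_stdGaussianPi {m : ℕ} {h : (Fin m → ℝ) → ℝ≥0∞} (hh : Measurable h) :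
    ∫⁻ a, h a ∂stdGaussianPi m = ∫⁻ a, ENNReal.ofReal (stdDensity a) * h a := by
  have h1 : (volume : Measure ℝ) = (gaussianReal 0 1).withDensity fun x => (gaussianPDF 0 1 x)⁻¹ := by
    rw [gaussianReal_of_var_ne_zero _ one_ne_zero]
    rw [withDensity_inv_same (measurable_gaussianPDF 0 1)
      (Filter.Eventually.of_forall fun x => (gaussianPDF_pos 0 one_ne_zero x).ne')
      (Filter.Eventually.of_forall fun x => gaussianPDF_ne_top)]
  have h2 := pi_withDensity (ι := Fin m) (μ := fun _ => gaussianReal 0 1) (ν := fun _ => volume)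
    (f := fun _ x => (gaussianPDF 0 1 x)⁻¹) (fun _ => (measurable_gaussianPDF 0 1).inv) fun _ => h1
  have hg : Measurable fun a : Fin m → ℝ => ENNReal.ofReal (stdDensity a) :=
    ((continuous_stdDensity m).measurable).ennreal_ofReal
  have h3 : Measurable fun a : Fin m → ℝ => ∏ i, (gaussianPDF 0 1 (a i))⁻¹ := by
    have := (measurable_gaussianPDF 0 1).inv
    fun_prop
  rw [volume_pi, h2, lintegral_withDensity_eq_lintegral_mul _ h3
    (g := fun a => ENNReal.ofReal (stdDensity a) * h a) (hg.mul hh)]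
  refine lintegral_congr fun a => ?_
  simp only [Pi.mul_apply]
  have e : ENNReal.ofReal (stdDensity a) = ∏ i, gaussianPDF 0 1 (a i) := by
    unfold stdDensity gaussianPDF
    rw [ENNReal.ofReal_prod_of_nonneg fun i _ => (gaussianPDFReal_pos 0 1 (a i) one_ne_zero).le]
  rw [← mul_assoc, e, ← Finset.prod_mul_distrib]
  rw [Finset.prod_eq_one fun i _ => ENNReal.inv_mul_cancel
    (gaussianPDF_pos 0 one_ne_zero _).ne' gaussianPDF_ne_top, one_mul]

variable {m : ℕ}

/-- The matrix `(weylFun j (x i))`. -/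
noncomputable def interpMat (x : Fin m → ℝ) : Matrix (Fin m) (Fin m) ℝ :=
  Matrix.of fun i j => weylFun j (x i)

theorem det_interpMat (x : Fin m → ℝ) : (interpMat x).det
    = (∏ i, Real.exp (-x i ^ 2 / 2)) * (∏ j : Fin m, (√((j : ℕ) ! : ℝ))⁻¹)
      * (Matrix.vandermonde x).det := by
  have : interpMat x = Matrix.of fun i j => Real.exp (-x i ^ 2 / 2) *
      (Matrix.of fun i j : Fin m => (√((j : ℕ) ! : ℝ))⁻¹ * Matrix.vandermonde x i j) i j := by
    ext i j
    simp [interpMat, weylFun, Matrix.vandermonde_apply]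
    ring
  rw [this, Matrix.det_mul_column, Matrix.det_mul_row]
  ring

theorem det_interpMat_ne_zero_iff {x : Fin m → ℝ} :
    (interpMat x).det ≠ 0 ↔ Function.Injective x := by
  rw [det_interpMat, ← Matrix.det_vandermonde_ne_zero_iff]
  have h1 : (∏ i, Real.exp (-x i ^ 2 / 2)) ≠ 0 :=
    Finset.prod_ne_zero_iff.2 fun i _ => (Real.exp_pos _).ne'
  have h2 : (∏ j : Fin m, (√((j : ℕ) ! : ℝ))⁻¹) ≠ 0 :=
    Finset.prod_ne_zero_iff.2 fun i _ => inv_ne_zero (sqrt_factorial_pos _).ne'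
  rw [mul_ne_zero_iff, mul_ne_zero_iff]
  exact ⟨fun h => h.2, fun h => ⟨⟨h1, h2⟩, h⟩⟩

theorem isOpen_injective : IsOpen {x : Fin m → ℝ | Function.Injective x} := by
  have : {x : Fin m → ℝ | Function.Injective x} = {x | (Matrix.vandermonde x).det ≠ 0} := by
    ext x; exact Matrix.det_vandermonde_ne_zero_iff.symm
  rw [this]
  refine isOpen_ne.preimage (Continuous.matrix_det ?_)
  refine continuous_matrix fun i j => ?_
  simp only [Matrix.vandermonde_apply]
  fun_prop

theorem HasGrowth.glue {b : ℕ → ℝ} {S : ℝ} (hb : HasGrowth b S) (a : Fin m → ℝ) :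
    ∃ S', HasGrowth (glue m a b) S' := by
  refine ⟨S + ∑ i, |a i|, fun n => ?_⟩
  have h1 : 0 ≤ ∑ i, |a i| := Finset.sum_nonneg fun i _ => abs_nonneg _
  have hS := hb.nonneg
  have h2 : (1 : ℝ) ≤ 2 ^ n := one_le_pow₀ (by norm_num)
  unfold _root_.glue
  split_ifs with h
  · have h3 := Finset.single_le_sum (f := fun i => |a i|) (fun i _ => abs_nonneg _)
      (Finset.mem_univ (⟨n, h⟩ : Fin m))
    nlinarith
  · have h3 := hb n
    nlinarith

theorem tsum_glue_mul {b : ℕ → ℝ} {S : ℝ} (hb : HasGrowth b S) {w : ℕ → ℝ} (hw : RapidDecay w)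
    (a : Fin m → ℝ) :
    ∑' n, glue m a b n * w n = ∑ j, a j * w j + ∑' n, glue m 0 b n * w n := by
  obtain ⟨S₁, h₁⟩ := hb.glue a
  obtain ⟨S₀, h₀⟩ := hb.glue (0 : Fin m → ℝ)
  rw [← (hw.summable_mul h₁).sum_add_tsum_nat_add m, ← (hw.summable_mul h₀).sum_add_tsum_nat_add m,
    Finset.sum_range, Finset.sum_range]
  simp [glue]

/-- The first `m` coefficients for which the normalised Weyl series with the remaining coefficients
`b` vanishes at the points `x i`. -/
noncomputable def rootCoeff (b : ℕ → ℝ) (x : Fin m → ℝ) (i : Fin m) : ℝ :=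
  -(((interpMat x).updateCol i fun l => normSeries (glue m 0 b) (x l)).det / (interpMat x).det)

theorem interpMat_mulVec_rootCoeff (b : ℕ → ℝ) {x : Fin m → ℝ} (hx : Function.Injective x) :
    interpMat x *ᵥ rootCoeff b x = fun l => -normSeries (glue m 0 b) (x l) := by
  have hd := det_interpMat_ne_zero_iff.2 hx
  have h := Matrix.mulVec_cramer (interpMat x) fun l => normSeries (glue m 0 b) (x l)
  have e : rootCoeff b x = (-((interpMat x).det)⁻¹) • Matrix.cramer (interpMat x)
      fun l => normSeries (glue m 0 b) (x l) := by
    ext i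
    simp only [rootCoeff, Pi.smul_apply, Matrix.cramer_apply, smul_eq_mul]
    ring
  rw [e, Matrix.mulVec_smul, h, smul_smul, neg_mul, inv_mul_cancel₀ hd]
  ext l
  simp

theorem normSeries_glue {b : ℕ → ℝ} {S : ℝ} (hb : HasGrowth b S) (a : Fin m → ℝ) (y : ℝ) :
    normSeries (glue m a b) y = ∑ j, a j * weylFun j y + normSeries (glue m 0 b) y :=
  tsum_glue_mul hb (rapidDecay_weylFun y) a

theorem normSeriesDeriv_glue {b : ℕ → ℝ} {S : ℝ} (hb : HasGrowth b S) (a : Fin m → ℝ) (y : ℝ) :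
    normSeriesDeriv (glue m a b) y
      = ∑ j, a j * weylFunDeriv j y + normSeriesDeriv (glue m 0 b) y :=
  tsum_glue_mul hb (rapidDecay_weylFunDeriv y) a

theorem interpMat_mulVec_apply (x a : Fin m → ℝ) (i : Fin m) :
    (interpMat x *ᵥ a) i = ∑ j, a j * weylFun j (x i) := by
  simp [Matrix.mulVec, dotProduct, interpMat, mul_comm]

theorem normSeries_glue_eq {b : ℕ → ℝ} {S : ℝ} (hb : HasGrowth b S) (a : Fin m → ℝ)
    {x : Fin m → ℝ} (hx : Function.Injective x) (i : Fin m) :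
    normSeries (glue m a b) (x i) = (interpMat x *ᵥ (a - rootCoeff b x)) i := by
  rw [Matrix.mulVec_sub, interpMat_mulVec_rootCoeff b hx, normSeries_glue hb, Pi.sub_apply,
    interpMat_mulVec_apply]
  ring

theorem mem_zeroTuples_glue_iff {b : ℕ → ℝ} {S : ℝ} (hb : HasGrowth b S) (a x : Fin m → ℝ) :
    x ∈ zeroTuples (glue m a b) m ↔ x ∈ {x | Function.Injective x} ∧ rootCoeff b x = a := by
  refine and_congr_right fun hx => ?_
  have hx : Function.Injective x := hx
  simp_rw [normSeries_glue_eq hb a hx]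
  constructor
  · intro h
    have h1 : interpMat x *ᵥ (a - rootCoeff b x) = 0 := funext h
    have h2 := Matrix.eq_zero_of_mulVec_eq_zero (det_interpMat_ne_zero_iff.2 hx) h1
    exact (sub_eq_zero.1 h2).symm
  · rintro rfl i
    simp

theorem contDiff_weylFun (n : ℕ) : ContDiff ℝ 1 (weylFun n) := by
  unfold weylFun
  fun_prop

theorem HasGrowth.contDiff {a : ℕ → ℝ} {S : ℝ} (ha : HasGrowth a S) :
    ContDiff ℝ 1 (normSeries a) := by
  refine contDiff_one_iff_deriv.2 ⟨fun x => (ha.hasDerivAt x).differentiableAt, ?_⟩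
  have : deriv (normSeries a) = normSeriesDeriv a := funext fun x => (ha.hasDerivAt x).deriv
  rw [this]
  exact ha.continuous_deriv

theorem ContDiff.matrix_det {E : Type*} [NormedAddCommGroup E] [NormedSpace ℝ E]
    {A : E → Matrix (Fin m) (Fin m) ℝ} (hA : ∀ i j, ContDiff ℝ 1 fun x => A x i j) :
    ContDiff ℝ 1 fun x => (A x).det := by
  simp_rw [Matrix.det_apply']
  refine ContDiff.sum fun s _ => contDiff_const.mul (contDiff_prod fun i _ => hA _ _)

theorem contDiffOn_rootCoeff {b : ℕ → ℝ} {S : ℝ} (hb : HasGrowth b S) :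
    ContDiffOn ℝ 1 (rootCoeff (m := m) b) {x | Function.Injective x} := by
  obtain ⟨S₀, h₀⟩ := hb.glue (0 : Fin m → ℝ)
  have h1 : ∀ i j, ContDiff ℝ 1 fun x : Fin m → ℝ => interpMat x i j := fun i j => by
    have := contDiff_weylFun (j : ℕ)
    simp only [interpMat, Matrix.of_apply]
    fun_prop
  refine contDiffOn_pi.2 fun i => ContDiffOn.neg (ContDiffOn.div ?_ ?_ ?_)
  · refine (ContDiff.matrix_det fun l j => ?_).contDiffOn
    by_cases h : j = i
    · subst h
      simp only [Matrix.updateCol_self]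
      have := h₀.contDiff
      fun_prop
    · simp only [Matrix.updateCol_ne h]
      exact h1 l j
  · exact (ContDiff.matrix_det h1).contDiffOn
  · exact fun x hx => det_interpMat_ne_zero_iff.2 hx

theorem det_mul_det_fderiv_rootCoeff {b : ℕ → ℝ} {S : ℝ} (hb : HasGrowth b S) {x : Fin m → ℝ}
    (hx : Function.Injective x) :
    (interpMat x).det * (fderiv ℝ (rootCoeff b) x).det
      = ∏ i, -normSeriesDeriv (glue m (rootCoeff b x) b) (x i) := by
  obtain ⟨S₀, h₀⟩ := hb.glue (0 : Fin m → ℝ)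
  have hΦ : HasFDerivAt (rootCoeff b) (fderiv ℝ (rootCoeff b) x) x :=
    (((contDiffOn_rootCoeff hb).contDiffAt (isOpen_injective.mem_nhds hx)).differentiableAt
      one_ne_zero).hasFDerivAt
  set D := fderiv ℝ (rootCoeff b) x with hD
  have key : ∀ (i : Fin m) (v : Fin m → ℝ), (interpMat x *ᵥ D v) i
      = -normSeriesDeriv (glue m (rootCoeff b x) b) (x i) * v i := by
    intro i v
    have hev : HasFDerivAt (fun y : Fin m → ℝ => y i) (ContinuousLinearMap.proj (R := ℝ) i) x :=
      hasFDerivAt_apply i x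
    have h1 : HasFDerivAt (fun y => ∑ j, rootCoeff b y j * weylFun j (y i)
        + normSeries (glue m 0 b) (y i)) (∑ j, (rootCoeff b x j • (weylFunDeriv j (x i) •
          (ContinuousLinearMap.proj (R := ℝ) i : (Fin m → ℝ) →L[ℝ] ℝ)) + weylFun j (x i) • (ContinuousLinearMap.proj (R := ℝ) j ∘L D))
        + normSeriesDeriv (glue m 0 b) (x i) • ContinuousLinearMap.proj (R := ℝ) i) x := by
      refine HasFDerivAt.fun_add (HasFDerivAt.fun_sum fun j _ => ?_) ?_
      · have h2 : HasFDerivAt (fun y => rootCoeff b y j) (ContinuousLinearMap.proj (R := ℝ) j ∘L D) x :=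
          (hasFDerivAt_pi'.1 hΦ) j
        have h5 : HasFDerivAt (fun y : Fin m → ℝ => weylFun j (y i)) (weylFunDeriv j (x i) •
            (ContinuousLinearMap.proj (R := ℝ) i : (Fin m → ℝ) →L[ℝ] ℝ)) x :=
          HasDerivAt.comp_hasFDerivAt (h₂ := weylFun j) x (hasDerivAt_weylFun j (x i)) hev
        exact h2.mul h5
      · exact (h₀.hasDerivAt (x i)).comp_hasFDerivAt x hev
    have h2 : (fun y => ∑ j, rootCoeff b y j * weylFun j (y i)
        + normSeries (glue m 0 b) (y i)) =ᶠ[𝓝 x] fun _ => 0 := by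
      filter_upwards [isOpen_injective.mem_nhds hx] with y hy
      have := congrFun (interpMat_mulVec_rootCoeff b hy) i
      rw [interpMat_mulVec_apply] at this
      rw [this]; ring
    have h3 := h1.unique ((hasFDerivAt_const (0 : ℝ) x).congr_of_eventuallyEq h2)
    have h4 := congrArg (fun L => L v) h3
    simp [Finset.sum_add_distrib] at h4
    rw [interpMat_mulVec_apply, normSeriesDeriv_glue hb, neg_mul, add_mul, Finset.sum_mul]
    have e1 : ∑ j, rootCoeff b x j * (weylFunDeriv j (x i) * v i)
      = ∑ j, rootCoeff b x j * weylFunDeriv j (x i) * v i := by simp_rw [mul_assoc]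
    have e2 : ∑ j : Fin m, weylFun j (x i) * (D v) j = ∑ j, (D v) j * weylFun j (x i) := by
      simp_rw [mul_comm]
    rw [e1, e2] at h4
    linarith
  have hcomp : (Matrix.toLin' (interpMat x)).comp (D : (Fin m → ℝ) →ₗ[ℝ] (Fin m → ℝ))
      = Matrix.toLin' (Matrix.diagonal fun i => -normSeriesDeriv (glue m (rootCoeff b x) b) (x i)) := by
    refine LinearMap.ext fun v => funext fun i => ?_
    simp only [LinearMap.comp_apply, Matrix.toLin'_apply, Matrix.mulVec_diagonal]
    exact key i v
  have := congrArg LinearMap.det hcomp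
  rw [LinearMap.det_comp, LinearMap.det_toLin', LinearMap.det_toLin', Matrix.det_diagonal] at this
  exact this

end PrescribedZeros

section Measurability

/-- For a continuous random function, the event that it has a zero in `[c, d]`. -/
def nearZero (h : (ℕ → ℝ) → ℝ → ℝ) (c d : ℝ) : Set (ℕ → ℝ) :=
  {a | ∀ k : ℕ, ∃ q : ℚ, (c ≤ q ∧ (q : ℝ) ≤ d) ∧ |h a q| < 1 / (k + 1)}

theorem measurableSet_nearZero {h : (ℕ → ℝ) → ℝ → ℝ} (hh : ∀ x, Measurable fun a => h a x)
    (c d : ℝ) : MeasurableSet (nearZero h c d) := by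
  have : nearZero h c d = ⋂ k : ℕ, ⋃ q : ℚ, ({_a | c ≤ q ∧ (q : ℝ) ≤ d} ∩ {a | |h a q| < 1 / (k + 1)}) := by
    ext a; simp [nearZero]
  rw [this]
  refine MeasurableSet.iInter fun k => MeasurableSet.iUnion fun q =>
    (MeasurableSet.const _).inter (measurableSet_lt ?_ measurable_const)
  exact (hh q).abs

theorem mem_nearZero_iff {h : (ℕ → ℝ) → ℝ → ℝ} {a : ℕ → ℝ} (ha : Continuous (h a)) {c d : ℝ}
    (hcd : c < d) : a ∈ nearZero h c d ↔ ∃ x ∈ Set.Icc c d, h a x = 0 := by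
  constructor
  · intro hz
    obtain ⟨x, hx, hmin⟩ := isCompact_Icc.exists_isMinOn (Set.nonempty_Icc.2 hcd.le)
      (ha.abs.continuousOn (s := Set.Icc c d))
    refine ⟨x, hx, ?_⟩
    by_contra hne
    obtain ⟨k, hk⟩ := exists_nat_one_div_lt (abs_pos.2 hne)
    obtain ⟨q, hq, hqk⟩ := hz k
    have := isMinOn_iff.1 hmin q hq
    linarith
  · rintro ⟨x, hx, hx0⟩ k
    have hx' : x ∈ closure (Set.Ioo c d) := by rwa [closure_Ioo hcd.ne]
    have ho : IsOpen {y | |h a y| < 1 / ((k : ℝ) + 1)} := isOpen_lt ha.abs continuous_const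
    have hne := mem_closure_iff.1 hx' _ ho (by
      simp only [Set.mem_ofPred_eq, hx0, abs_zero]; positivity)
    obtain ⟨q, hq⟩ := Rat.denseRange_cast.exists_mem_open (ho.inter isOpen_Ioo) hne
    exact ⟨q, ⟨hq.2.1.le, hq.2.2.le⟩, hq.1⟩

theorem measurable_normSeries_left (x : ℝ) : Measurable fun a => normSeries a x :=
  measurable_normSeries.comp (measurable_id.prodMk measurable_const)

theorem measurable_normSeriesDeriv_left (x : ℝ) : Measurable fun a => normSeriesDeriv a x :=
  measurable_normSeriesDeriv.comp (measurable_id.prodMk measurable_const)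

/-- The event that the normalised Weyl series has a zero in `[c, d)`. -/
def hitSet (c d : ℝ) : Set (ℕ → ℝ) :=
  ⋃ j : ℕ, nearZero normSeries c (d - (d - c) / (j + 2))

theorem measurableSet_hitSet (c d : ℝ) : MeasurableSet (hitSet c d) :=
  MeasurableSet.iUnion fun _ => measurableSet_nearZero measurable_normSeries_left _ _

theorem mem_hitSet_iff {a : ℕ → ℝ} {S : ℝ} (ha : HasGrowth a S) {c d : ℝ} (hcd : c < d) :
    a ∈ hitSet c d ↔ ∃ x ∈ Set.Ico c d, normSeries a x = 0 := by
  have hj : ∀ j : ℕ, c < d - (d - c) / (j + 2) := fun j => by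
    have : (d - c) / ((j : ℝ) + 2) < d - c := by
      refine div_lt_self (by linarith) ?_
      have : (0 : ℝ) ≤ j := j.cast_nonneg
      linarith
    linarith
  simp only [hitSet, Set.mem_iUnion]
  constructor
  · rintro ⟨j, hz⟩
    obtain ⟨x, hx, h0⟩ := (mem_nearZero_iff ha.continuous (hj j)).1 hz
    refine ⟨x, ⟨hx.1, hx.2.trans_lt ?_⟩, h0⟩
    have : 0 < (d - c) / ((j : ℝ) + 2) := div_pos (by linarith) (by positivity)
    linarith
  · rintro ⟨x, hx, h0⟩
    obtain ⟨j, hjx⟩ := exists_nat_gt ((d - c) / (d - x))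
    refine ⟨j, (mem_nearZero_iff ha.continuous (hj j)).2 ⟨x, ⟨hx.1, ?_⟩, h0⟩⟩
    have hdx : 0 < d - x := by linarith [hx.2]
    have h1 : (d - c) < j * (d - x) := (div_lt_iff₀ hdx).1 hjx
    have h2 : (d - c) / ((j : ℝ) + 2) ≤ d - x := by
      rw [div_le_iff₀ (by positivity)]
      nlinarith
    linarith

variable {m : ℕ}

/-- Dyadic approximation of the sum of `f` over tuples of distinct zeros. -/
noncomputable def dyadicSum (n : ℕ) (f : (Fin m → ℝ) → ℝ) (a : ℕ → ℝ) : ℝ :=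
  ∑' c : Fin m → ℤ,
    {a | Function.Injective c ∧ ∀ i, a ∈ hitSet ((c i : ℝ) / 2 ^ n) (((c i : ℝ) + 1) / 2 ^ n)}.indicator
      (fun _ => f fun i => (c i : ℝ) / 2 ^ n) a

theorem measurable_dyadicSum (n : ℕ) (f : (Fin m → ℝ) → ℝ) : Measurable (dyadicSum n f) := by
  refine Measurable.tsum fun c => measurable_const.indicator ?_
  have : {a : ℕ → ℝ | Function.Injective c ∧ ∀ i, a ∈ hitSet ((c i : ℝ) / 2 ^ n) (((c i : ℝ) + 1) / 2 ^ n)}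
      = {_a | Function.Injective c} ∩ ⋂ i, hitSet ((c i : ℝ) / 2 ^ n) (((c i : ℝ) + 1) / 2 ^ n) := by
    ext a; simp
  rw [this]
  exact (MeasurableSet.const _).inter (MeasurableSet.iInter fun i => measurableSet_hitSet _ _)

theorem tendsto_floor_two_pow_mul_div (x : ℝ) :
    Filter.Tendsto (fun n : ℕ => (⌊2 ^ n * x⌋ : ℝ) / 2 ^ n) Filter.atTop (𝓝 x) := by
  have h1 : Filter.Tendsto (fun n : ℕ => x - (1 / 2 : ℝ) ^ n) Filter.atTop (𝓝 (x - 0)) :=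
    tendsto_const_nhds.sub (tendsto_pow_atTop_nhds_zero_of_lt_one (by norm_num) (by norm_num))
  rw [sub_zero] at h1
  refine tendsto_of_tendsto_of_tendsto_of_le_of_le h1 tendsto_const_nhds (fun n => ?_) fun n => ?_
  · have h2 := Int.lt_floor_add_one ((2 : ℝ) ^ n * x)
    have h3 : (0 : ℝ) < 2 ^ n := by positivity
    simp only
    rw [le_div_iff₀ h3, sub_mul, ← mul_pow]
    norm_num
    linarith
  · have h2 := Int.floor_le ((2 : ℝ) ^ n * x)
    have h3 : (0 : ℝ) < 2 ^ n := by positivity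
    simp only
    rw [div_le_iff₀ h3]
    linarith

theorem exists_forall_abs_le_of_hasCompactSupport {f : (Fin m → ℝ) → ℝ} (hf : HasCompactSupport f) :
    ∃ R : ℝ, ∀ x, f x ≠ 0 → ∀ i, |x i| ≤ R := by
  obtain ⟨R, hR⟩ := hf.isCompact.isBounded.exists_norm_le
  exact ⟨R, fun x hx i => (norm_le_pi_norm x i).trans (hR x (subset_tsupport f hx))⟩

theorem tendsto_dyadicSum {a : ℕ → ℝ} {S : ℝ} (ha : HasGrowth a S) (hs : SimpleZeros a)
    {f : (Fin m → ℝ) → ℝ} (hf : Continuous f) (hfc : HasCompactSupport f) :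
    Filter.Tendsto (fun n => dyadicSum n f a) Filter.atTop (𝓝 (∑' x : zeroTuples a m, f x)) := by
  classical
  obtain ⟨R, hR⟩ := exists_forall_abs_le_of_hasCompactSupport hfc
  set Z : Set ℝ := {x | |x| ≤ R + 1 ∧ normSeries a x = 0} with hZ
  have hZf : Z.Finite := ha.finite_zeros hs (R + 1)
  have : Finite Z := hZf
  have : Fintype Z := Fintype.ofFinite Z
  have : Fintype (Fin m ↪ Z) := Fintype.ofFinite _
  have h1 : ∑' x : zeroTuples a m, f x = ∑ t : Fin m ↪ Z, f fun i => (t i : ℝ) := by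
    let g : (Fin m ↪ Z) → zeroTuples a m := fun t =>
      ⟨fun i => (t i : ℝ), fun i j h => t.injective (Subtype.ext h), fun i => (t i).2.2⟩
    have hg : Function.Injective g := fun t s h => by
      ext i
      exact congrFun (congrArg Subtype.val h) i
    rw [← tsum_fintype (L := SummationFilter.unconditional _)]
    refine (hg.tsum_eq (f := fun x : zeroTuples a m => f x) fun x hx => ?_).symm
    have hx' := hR x.1 hx
    exact ⟨⟨fun i => ⟨x.1 i, by linarith [hx' i], x.2.2 i⟩, fun i j h =>
      x.2.1 (congrArg Subtype.val h)⟩, rfl⟩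
  have h2 : ∀ᶠ n : ℕ in Filter.atTop, ∀ z w : Z, z ≠ w → (1 / 2 : ℝ) ^ n < |(z : ℝ) - w| := by
    refine Filter.eventually_all.2 fun z => Filter.eventually_all.2 fun w => ?_
    by_cases hzw : z = w
    · exact Filter.Eventually.of_forall fun n h => (h hzw).elim
    · have : 0 < |(z : ℝ) - w| := abs_pos.2 (sub_ne_zero.2 fun h => hzw (Subtype.ext h))
      filter_upwards [(tendsto_pow_atTop_nhds_zero_of_lt_one (by norm_num : (0 : ℝ) ≤ 1 / 2)
        (by norm_num)).eventually_lt_const this] with n hn _ using hn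
  have hcell : ∀ (n : ℕ) (c : ℤ) (x : ℝ), x ∈ Set.Ico ((c : ℝ) / 2 ^ n) (((c : ℝ) + 1) / 2 ^ n) ↔
      ⌊2 ^ n * x⌋ = c := by
    intro n c x
    have h3 : (0 : ℝ) < 2 ^ n := by positivity
    rw [Int.floor_eq_iff, Set.mem_Ico, div_le_iff₀ h3, lt_div_iff₀ h3, mul_comm x]
  have hlt : ∀ (n : ℕ) (c : ℤ), (c : ℝ) / 2 ^ n < ((c : ℝ) + 1) / 2 ^ n := fun n c => by
    gcongr; linarith
  have h3 : ∀ᶠ n : ℕ in Filter.atTop, dyadicSum n f a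
      = ∑ t : Fin m ↪ Z, f fun i => (⌊2 ^ n * (t i : ℝ)⌋ : ℝ) / 2 ^ n := by
    filter_upwards [h2] with n hn
    have hfl : ∀ z w : Z, ⌊2 ^ n * (z : ℝ)⌋ = ⌊2 ^ n * (w : ℝ)⌋ → z = w := by
      intro z w h
      by_contra hne
      have h4 := hn z w hne
      have h5 := Int.abs_sub_lt_one_of_floor_eq_floor h
      rw [← mul_sub, abs_mul, abs_of_pos (by positivity : (0 : ℝ) < 2 ^ n)] at h5
      have h6 : (2 : ℝ) ^ n * (1 / 2) ^ n = 1 := by rw [← mul_pow]; norm_num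
      have h7 := mul_lt_mul_of_pos_left h4 (by positivity : (0 : ℝ) < 2 ^ n)
      linarith
    let g : (Fin m ↪ Z) → (Fin m → ℤ) := fun t i => ⌊2 ^ n * (t i : ℝ)⌋
    have hg : Function.Injective g := fun t s h => by
      ext i
      exact congrArg Subtype.val (hfl _ _ (congrFun h i))
    rw [← tsum_fintype (L := SummationFilter.unconditional _), dyadicSum, ← hg.tsum_eq]
    · refine tsum_congr fun t => ?_
      rw [Set.indicator_of_mem]
      refine ⟨fun i j h => t.injective (hfl _ _ h), fun i => ?_⟩
      exact (mem_hitSet_iff ha (hlt _ _)).2 ⟨t i, (hcell _ _ _).2 rfl, (t i).2.2⟩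
    · intro c hc
      obtain ⟨⟨hci, hch⟩, hcf⟩ := Set.indicator_apply_ne_zero.1 hc
      choose x hx hx0 using fun i => (mem_hitSet_iff ha (hlt n (c i))).1 (hch i)
      have hxc : ∀ i, ⌊2 ^ n * x i⌋ = c i := fun i => (hcell _ _ _).1 (hx i)
      have hcR := hR _ hcf
      have hxR : ∀ i, |x i| ≤ R + 1 := by
        intro i
        have h4 := (hx i).1
        have h5 := (hx i).2
        have h6 : ((c i : ℝ) + 1) / 2 ^ n ≤ (c i : ℝ) / 2 ^ n + 1 := by
          rw [add_div]
          have : (1 : ℝ) / 2 ^ n ≤ 1 := div_le_one_of_le₀ (one_le_pow₀ (by norm_num)) (by positivity)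
          linarith
        have h7 := abs_le.1 (hcR i)
        exact abs_le.2 ⟨by linarith, by linarith⟩
      refine ⟨⟨fun i => ⟨x i, hxR i, hx0 i⟩, fun i j h => hci ?_⟩, funext fun i => hxc i⟩
      have hij : x i = x j := congrArg Subtype.val h
      rw [← hxc i, ← hxc j, hij]
  rw [h1]
  refine Filter.Tendsto.congr' (h3.mono fun n hn => hn.symm) ?_
  refine tendsto_finsetSum _ fun t _ => (hf.tendsto _).comp ?_
  exact tendsto_pi_nhds.2 fun i => tendsto_floor_two_pow_mul_div _

end Measurability

section Rice

variable {m : ℕ}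

theorem stdGaussianPi_absolutelyContinuous (m : ℕ) : stdGaussianPi m ≪ volume := by
  refine Measure.AbsolutelyContinuous.mk fun s hs h => ?_
  rw [← lintegral_indicator_one hs, lintegral_stdGaussianPi (measurable_one.indicator hs)]
  have : ∀ a : Fin m → ℝ, ENNReal.ofReal (stdDensity a) * s.indicator (1 : (Fin m → ℝ) → ℝ≥0∞) a
      = s.indicator (fun a => ENNReal.ofReal (stdDensity a)) a := fun a => by
    by_cases ha : a ∈ s <;> simp [ha]
  simp_rw [this]
  rw [lintegral_indicator hs, Measure.restrict_eq_zero.2 h, lintegral_zero_measure]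

theorem absolutelyContinuous_stdGaussianPi (m : ℕ) : volume ≪ stdGaussianPi m := by
  refine Measure.AbsolutelyContinuous.mk fun s hs h => ?_
  have hm : Measurable fun a : Fin m → ℝ => ENNReal.ofReal (stdDensity a) :=
    (continuous_stdDensity m).measurable.ennreal_ofReal
  rw [← lintegral_indicator_one hs, lintegral_stdGaussianPi (measurable_one.indicator hs),
    lintegral_eq_zero_iff (f := fun a => ENNReal.ofReal (stdDensity a) * s.indicator 1 a)
      (hm.mul (measurable_one.indicator hs))] at h
  rw [← lintegral_indicator_one hs, lintegral_eq_zero_iff (measurable_one.indicator hs)]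
  filter_upwards [h] with a ha
  have : ENNReal.ofReal (stdDensity a) ≠ 0 := by simpa using stdDensity_pos a
  simpa [this] using ha

/-- Almost sure events are almost sure after resampling the first `m` coefficients. -/
theorem ae_ae_glue (m : ℕ) {p : (ℕ → ℝ) → Prop} (hp : ∀ᵐ a ∂coeffLaw, p a) :
    ∀ᵐ b ∂coeffLaw, ∀ᵐ a ∂stdGaussianPi m, p (glue m a b) := by
  obtain ⟨t, hpt, ht, ht0⟩ := exists_measurable_superset_of_null (ae_iff.1 hp)
  rw [← lintegral_indicator_one ht, lintegral_coeffLaw m (measurable_one.indicator ht),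
    lintegral_eq_zero_iff] at ht0
  · filter_upwards [ht0] with b hb
    rw [Pi.zero_apply, lintegral_eq_zero_iff] at hb
    · filter_upwards [hb] with a ha
      by_contra hpa
      have : glue m a b ∈ t := hpt hpa
      simp [this] at ha
    · exact (measurable_one.indicator ht).comp ((measurable_glue m).comp
        (measurable_id.prodMk measurable_const))
  · exact Measurable.lintegral_prod_left'
      ((measurable_one.indicator ht).comp (measurable_glue m))

theorem measurable_det {α : Type*} [MeasurableSpace α] {A : α → Matrix (Fin m) (Fin m) ℝ}
    (hA : ∀ i j, Measurable fun x => A x i j) : Measurable fun x => (A x).det := by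
  simp_rw [Matrix.det_apply']
  exact Finset.measurable_sum _ fun s _ => measurable_const.mul
    (Finset.measurable_prod _ fun i _ => hA _ _)

theorem measurable_interpMat_apply (i j : Fin m) : Measurable fun x : Fin m → ℝ => interpMat x i j :=
  (continuous_weylFun j).measurable.comp (measurable_pi_apply i)

theorem measurable_rootCoeff :
    Measurable fun p : (ℕ → ℝ) × (Fin m → ℝ) => rootCoeff p.1 p.2 := by
  refine measurable_pi_iff.2 fun i => ((measurable_det fun l j => ?_).div
    (measurable_det fun l j => ?_)).neg
  · by_cases h : j = i
    · subst h
      simp only [Matrix.updateCol_self]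
      refine measurable_normSeries.comp (Measurable.prodMk ?_ (by fun_prop))
      exact (measurable_glue m).comp (measurable_const.prodMk measurable_fst)
    · simp only [Matrix.updateCol_ne h]
      exact (measurable_interpMat_apply l j).comp measurable_snd
  · exact (measurable_interpMat_apply l j).comp measurable_snd

/-- The slope at `x i` of the normalised Weyl series forced to vanish at `x`. -/
noncomputable def rootSlope (b : ℕ → ℝ) (x : Fin m → ℝ) (i : Fin m) : ℝ :=
  normSeriesDeriv (glue m (rootCoeff b x) b) (x i)

theorem measurable_rootSlope (i : Fin m) :
    Measurable fun p : (ℕ → ℝ) × (Fin m → ℝ) => rootSlope p.1 p.2 i := by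
  refine measurable_normSeriesDeriv.comp (Measurable.prodMk ?_ (by fun_prop))
  exact (measurable_glue m).comp (measurable_rootCoeff.prodMk measurable_fst)

theorem measurable_rootSlope_right (b : ℕ → ℝ) (i : Fin m) :
    Measurable fun x : Fin m → ℝ => rootSlope b x i := by
  have h : Measurable fun x : Fin m → ℝ => (b, x) := measurable_const.prodMk measurable_id
  have h2 := (measurable_rootSlope i).comp h
  exact h2

theorem measurable_rootCoeff_right (b : ℕ → ℝ) :
    Measurable fun x : Fin m → ℝ => rootCoeff b x := by
  have h : Measurable fun x : Fin m → ℝ => (b, x) := measurable_const.prodMk measurable_id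
  have h2 := measurable_rootCoeff.comp h
  exact h2

theorem abs_det_fderiv_rootCoeff {b : ℕ → ℝ} {S : ℝ} (hb : HasGrowth b S) {x : Fin m → ℝ}
    (hx : Function.Injective x) :
    |(fderiv ℝ (rootCoeff b) x).det| = (∏ i, |rootSlope b x i|) / |(interpMat x).det| := by
  have h := congrArg abs (det_mul_det_fderiv_rootCoeff hb hx)
  have hd := abs_pos.2 (det_interpMat_ne_zero_iff.2 hx)
  rw [abs_mul, Finset.abs_prod] at h
  simp only [abs_neg] at h
  rw [eq_div_iff hd.ne', mul_comm]
  exact h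

theorem fiberSum_rootCoeff {b : ℕ → ℝ} {S : ℝ} (hb : HasGrowth b S) (f : (Fin m → ℝ) → ℝ≥0∞)
    (a : Fin m → ℝ) :
    fiberSum (rootCoeff b) {x | Function.Injective x} f a
      = ∑' x, (zeroTuples (glue m a b) m).indicator f x := by
  have : {x | x ∈ {x : Fin m → ℝ | Function.Injective x} ∧ rootCoeff b x = a}
      = zeroTuples (glue m a b) m := by
    ext x; exact (mem_zeroTuples_glue_iff hb a x).symm
  rw [fiberSum, this]

theorem ae_simpleZeros : ∀ᵐ a ∂coeffLaw, SimpleZeros a := by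
  set h : (ℕ → ℝ) → ℝ → ℝ := fun a x => normSeries a x ^ 2 + normSeriesDeriv a x ^ 2 with hh
  set B : Set (ℕ → ℝ) := ⋃ N : ℕ, nearZero h (-(N + 1)) (N + 1) with hB
  have hBm : MeasurableSet B := MeasurableSet.iUnion fun N => measurableSet_nearZero (fun x =>
    ((measurable_normSeries_left x).pow_const 2).add
      ((measurable_normSeriesDeriv_left x).pow_const 2)) _ _
  have hmem : ∀ {a : ℕ → ℝ} {S : ℝ}, HasGrowth a S → (a ∈ B ↔ ¬ SimpleZeros a) := by
    intro a S ha
    have hc : Continuous (h a) := (ha.continuous.pow 2).add (ha.continuous_deriv.pow 2)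
    have hN : ∀ N : ℕ, (-((N : ℝ) + 1)) < N + 1 := fun N => by
      have : (0 : ℝ) ≤ N := N.cast_nonneg
      linarith
    have h0 : ∀ x, h a x = 0 ↔ normSeries a x = 0 ∧ normSeriesDeriv a x = 0 := fun x => by
      simp only [hh]
      rw [add_eq_zero_iff_of_nonneg (sq_nonneg _) (sq_nonneg _)]
      simp
    simp only [hB, Set.mem_iUnion, mem_nearZero_iff hc (hN _), h0, SimpleZeros]
    push Not
    constructor
    · rintro ⟨N, x, -, hx⟩
      exact ⟨x, hx⟩
    · rintro ⟨x, hx⟩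
      obtain ⟨N, hN⟩ := exists_nat_gt |x|
      have := abs_lt.1 hN
      exact ⟨N, x, ⟨by linarith, by linarith⟩, hx⟩
  have hB0 : coeffLaw B = 0 := by
    rw [← lintegral_indicator_one hBm, lintegral_coeffLaw 1 (measurable_one.indicator hBm)]
    refine lintegral_eq_zero_of_ae_eq_zero ?_
    filter_upwards [ae_hasGrowth] with b ⟨S, hb⟩
    rw [Pi.zero_apply]
    refine lintegral_eq_zero_of_ae_eq_zero ?_
    set f : (Fin 1 → ℝ) → ℝ≥0∞ := {x | rootSlope b x 0 = 0}.indicator 1 with hf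
    have hfm : Measurable f := by
      exact measurable_one.indicator
        (measurableSet_eq_fun (measurable_rootSlope_right b 0) measurable_const)
    have h1 := lintegral_fiberSum volume isOpen_injective (contDiffOn_rootCoeff (m := 1) hb) hfm
    have h2 : ∫⁻ x in {x : Fin 1 → ℝ | Function.Injective x},
        ENNReal.ofReal |(fderiv ℝ (rootCoeff b) x).det| * f x = 0 := by
      refine setLIntegral_eq_zero isOpen_injective.measurableSet fun x hx => ?_
      rw [abs_det_fderiv_rootCoeff hb hx]
      by_cases h3 : rootSlope b x 0 = 0
      · simp [h3]
      · simp [hf, h3]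
    rw [h2, lintegral_eq_zero_iff' h1.1] at h1
    filter_upwards [(stdGaussianPi_absolutelyContinuous 1).ae_le h1.2] with a ha
    obtain ⟨S', hg⟩ := hb.glue a
    by_contra hne
    have hgB : glue 1 a b ∈ B := by
      by_contra hcon
      simp [hcon] at hne
    rw [hmem hg, SimpleZeros] at hgB
    push Not at hgB
    obtain ⟨x, hx0, hx1⟩ := hgB
    rw [fiberSum_rootCoeff hb, Pi.zero_apply, ENNReal.tsum_eq_zero] at ha
    have hxz : (fun _ => x : Fin 1 → ℝ) ∈ zeroTuples (glue 1 a b) 1 :=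
      ⟨fun i j _ => Subsingleton.elim i j, fun _ => hx0⟩
    have h4 := ha fun _ => x
    rw [Set.indicator_of_mem hxz, hf, Set.indicator_of_mem] at h4
    · simp at h4
    · have := ((mem_zeroTuples_glue_iff hb a _).1 hxz).2
      simp only [Set.mem_ofPred_eq, rootSlope, this]
      exact hx1
  filter_upwards [measure_eq_zero_iff_ae_notMem.1 hB0, ae_hasGrowth] with a ha ⟨S, hS⟩
  rw [hmem hS] at ha
  exact not_not.1 ha

/-- The integrand of the Rice formula. -/
noncomputable def riceIntegrand (x : Fin m → ℝ) (b : ℕ → ℝ) : ℝ :=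
  stdDensity (rootCoeff b x) * ((∏ i, |rootSlope b x i|) / |(interpMat x).det|)

theorem riceIntegrand_nonneg (x : Fin m → ℝ) (b : ℕ → ℝ) : 0 ≤ riceIntegrand x b :=
  mul_nonneg (stdDensity_pos _).le
    (div_nonneg (Finset.prod_nonneg fun _ _ => abs_nonneg _) (abs_nonneg _))

theorem measurable_riceIntegrand :
    Measurable fun p : (Fin m → ℝ) × (ℕ → ℝ) => riceIntegrand p.1 p.2 := by
  have hs : Measurable fun p : (Fin m → ℝ) × (ℕ → ℝ) => (p.2, p.1) := measurable_swap
  have hr : Measurable fun p : (Fin m → ℝ) × (ℕ → ℝ) => rootCoeff p.2 p.1 := by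
    have h2 := (measurable_rootCoeff (m := m)).comp hs
    exact h2
  refine Measurable.mul ?_ (Measurable.div ?_ ?_)
  · exact (continuous_stdDensity m).measurable.comp hr
  · have h1 : ∀ i : Fin m, Measurable fun p : (Fin m → ℝ) × (ℕ → ℝ) => |rootSlope p.2 p.1 i| :=
      fun i => Measurable.abs (by have h2 := (measurable_rootSlope i).comp hs; exact h2)
    exact Finset.measurable_prod _ fun i _ => h1 i
  · have h3 := measurable_det (A := fun p : (Fin m → ℝ) × (ℕ → ℝ) => interpMat p.1)
      fun i j => (measurable_interpMat_apply i j).comp measurable_fst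
    exact h3.abs

theorem measurable_riceIntegrand_right (x : Fin m → ℝ) : Measurable (riceIntegrand x) := by
  have h : Measurable fun b : ℕ → ℝ => (x, b) := measurable_const.prodMk measurable_id
  have h2 := measurable_riceIntegrand.comp h
  exact h2

/-- The sum of `f` over tuples of distinct zeros of the normalised Weyl series. -/
noncomputable def zeroSum (f : (Fin m → ℝ) → ℝ) (a : ℕ → ℝ) : ℝ := ∑' x : zeroTuples a m, f x

theorem aemeasurable_zeroSum {f : (Fin m → ℝ) → ℝ} (hf : Continuous f)
    (hfc : HasCompactSupport f) : AEMeasurable (zeroSum f) coeffLaw := by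
  refine aemeasurable_of_tendsto_metrizable_ae Filter.atTop
    (fun n => (measurable_dyadicSum n f).aemeasurable) ?_
  filter_upwards [ae_hasGrowth, ae_simpleZeros] with a ⟨S, hS⟩ hs
  exact tendsto_dyadicSum hS hs hf hfc

theorem hasSum_zeroSum {a : ℕ → ℝ} {S : ℝ} (ha : HasGrowth a S) (hs : SimpleZeros a)
    {f : (Fin m → ℝ) → ℝ} (hfc : HasCompactSupport f) :
    HasSum (fun x : zeroTuples a m => f x) (zeroSum f a) := by
  obtain ⟨R, hR⟩ := exists_forall_abs_le_of_hasCompactSupport hfc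
  have hfin := ha.finite_zeros hs R
  refine (summable_of_hasFiniteSupport ?_).hasSum
  have h1 : (Set.univ.pi fun _ : Fin m => {x : ℝ | |x| ≤ R ∧ normSeries a x = 0}).Finite :=
    Set.Finite.pi fun _ => hfin
  refine Set.Finite.of_finite_image (f := Subtype.val) (h1.subset ?_) Subtype.val_injective.injOn
  rintro _ ⟨x, hx, rfl⟩ i -
  exact ⟨hR x.1 hx i, x.2.2 i⟩

theorem ofReal_zeroSum {a : ℕ → ℝ} {S : ℝ} (ha : HasGrowth a S) (hs : SimpleZeros a)
    {f : (Fin m → ℝ) → ℝ} (hfc : HasCompactSupport f) (hf0 : ∀ x, 0 ≤ f x) :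
    ENNReal.ofReal (zeroSum f a)
      = ∑' x, (zeroTuples a m).indicator (fun x => ENNReal.ofReal (f x)) x := by
  rw [zeroSum, ENNReal.ofReal_tsum_of_nonneg (f := fun x : zeroTuples a m => f x)
    (fun x => hf0 x) (hasSum_zeroSum ha hs hfc).summable]
  exact tsum_subtype (zeroTuples a m) fun x => ENNReal.ofReal (f x)

/-- The Rice formula for correlations of zeros. -/
theorem lintegral_zeroSum {f : (Fin m → ℝ) → ℝ} (hf : Continuous f)
    (hfc : HasCompactSupport f) (hf0 : ∀ x, 0 ≤ f x) :
    ∫⁻ a, ENNReal.ofReal (zeroSum f a) ∂coeffLaw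
      = ∫⁻ x, ENNReal.ofReal (f x) * ∫⁻ b, ENNReal.ofReal (riceIntegrand x b) ∂coeffLaw := by
  set F : (ℕ → ℝ) → ℝ≥0∞ := fun a => ENNReal.ofReal ((aemeasurable_zeroSum hf hfc).mk _ a) with hF
  have hFm : Measurable F := (aemeasurable_zeroSum hf hfc).measurable_mk.ennreal_ofReal
  have hfm : Measurable fun x => ENNReal.ofReal (f x) := hf.measurable.ennreal_ofReal
  have hri : Measurable fun p : (Fin m → ℝ) × (ℕ → ℝ) => ENNReal.ofReal (riceIntegrand p.1 p.2) :=
    measurable_riceIntegrand.ennreal_ofReal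
  have hU : MeasurableSet {x : Fin m → ℝ | Function.Injective x} := isOpen_injective.measurableSet
  have hae : ∀ᵐ a ∂coeffLaw, F a
      = ∑' x, (zeroTuples a m).indicator (fun x => ENNReal.ofReal (f x)) x := by
    filter_upwards [(aemeasurable_zeroSum hf hfc).ae_eq_mk, ae_hasGrowth, ae_simpleZeros]
      with a ha ⟨S, hS⟩ hs
    rw [← ofReal_zeroSum hS hs hfc hf0, ha]
  calc ∫⁻ a, ENNReal.ofReal (zeroSum f a) ∂coeffLaw
      = ∫⁻ a, F a ∂coeffLaw := by
        refine lintegral_congr_ae ?_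
        filter_upwards [(aemeasurable_zeroSum hf hfc).ae_eq_mk] with a ha
        rw [ha]
    _ = ∫⁻ b, ∫⁻ a, F (glue m a b) ∂stdGaussianPi m ∂coeffLaw := lintegral_coeffLaw m hFm
    _ = ∫⁻ b, (∫⁻ x, ENNReal.ofReal (f x) * ENNReal.ofReal (riceIntegrand x b)) ∂coeffLaw := by
        refine lintegral_congr_ae ?_
        filter_upwards [ae_hasGrowth, ae_ae_glue m hae] with b ⟨S, hb⟩ hab
        have hdm : Measurable fun x => ENNReal.ofReal (stdDensity (rootCoeff b x)) *
            ENNReal.ofReal (f x) := by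
          refine Measurable.mul (Measurable.ennreal_ofReal ?_) hfm
          exact (continuous_stdDensity m).measurable.comp (measurable_rootCoeff_right b)
        have hFg : Measurable fun a => F (glue m a b) :=
          hFm.comp ((measurable_glue m).comp (measurable_id.prodMk measurable_const))
        rw [lintegral_stdGaussianPi hFg]
        have e1 : ∫⁻ a, ENNReal.ofReal (stdDensity a) * F (glue m a b)
            = ∫⁻ a, fiberSum (rootCoeff b) {x | Function.Injective x}
              (fun x => ENNReal.ofReal (stdDensity (rootCoeff b x)) * ENNReal.ofReal (f x)) a := by
          refine lintegral_congr_ae ?_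
          filter_upwards [(absolutelyContinuous_stdGaussianPi m).ae_le hab] with a ha
          rw [ha, fiberSum_rootCoeff hb, ← ENNReal.tsum_mul_left]
          refine tsum_congr fun x => ?_
          by_cases hx : x ∈ zeroTuples (glue m a b) m
          · rw [Set.indicator_of_mem hx, Set.indicator_of_mem hx,
              ((mem_zeroTuples_glue_iff hb a x).1 hx).2]
          · rw [Set.indicator_of_notMem hx, Set.indicator_of_notMem hx, mul_zero]
        refine e1.trans ?_
        rw [(lintegral_fiberSum volume isOpen_injective (contDiffOn_rootCoeff hb) hdm).2,
          ← lintegral_indicator hU]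
        refine lintegral_congr fun x => ?_
        by_cases hx : Function.Injective x
        · rw [Set.indicator_of_mem (show x ∈ {x | Function.Injective x} from hx),
            abs_det_fderiv_rootCoeff hb hx, riceIntegrand,
            ENNReal.ofReal_mul (stdDensity_pos _).le]
          ring
        · rw [Set.indicator_of_notMem (show x ∉ {x | Function.Injective x} from hx), riceIntegrand,
            not_not.1 (mt det_interpMat_ne_zero_iff.1 hx)]
          simp
    _ = ∫⁻ x, ∫⁻ b, ENNReal.ofReal (f x) * ENNReal.ofReal (riceIntegrand x b) ∂coeffLaw := by
        rw [lintegral_lintegral_swap]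
        have h1 : Measurable fun p : (ℕ → ℝ) × (Fin m → ℝ) => ENNReal.ofReal (riceIntegrand p.2 p.1) := by
          have h2 : Measurable fun p : (ℕ → ℝ) × (Fin m → ℝ) => (p.2, p.1) := measurable_swap
          have h3 := hri.comp h2
          exact h3
        exact ((hfm.comp measurable_snd).mul h1).aemeasurable
    _ = _ := by
        refine lintegral_congr fun x => ?_
        have h1 : Measurable fun b => ENNReal.ofReal (riceIntegrand x b) :=
          measurable_riceIntegrand_right x |>.ennreal_ofReal
        exact lintegral_const_mul _ h1

end Rice

section Intensity

variable {m : ℕ}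

/-- The `m`-point intensity of the zeros, given by the Rice formula. -/
noncomputable def intensity (x : Fin m → ℝ) : ℝ := ∫ b, riceIntegrand x b ∂coeffLaw

theorem riceIntegrand_eq_zero {x : Fin m → ℝ} (hx : ¬ Function.Injective x) (b : ℕ → ℝ) :
    riceIntegrand x b = 0 := by
  rw [riceIntegrand, not_not.1 (mt det_interpMat_ne_zero_iff.1 hx)]
  simp

theorem intensity_eq_zero {x : Fin m → ℝ} (hx : ¬ Function.Injective x) : intensity x = 0 := by
  simp [intensity, riceIntegrand_eq_zero hx]

theorem intensity_nonneg (x : Fin m → ℝ) : 0 ≤ intensity x :=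
  integral_nonneg fun b => riceIntegrand_nonneg x b

theorem abs_rootSlope_le {b : ℕ → ℝ} {S : ℝ} (hb : HasGrowth b S) {R : ℝ} (hR : 1 ≤ R)
    {x : Fin m → ℝ} (hx : Function.Injective x) (hxR : ∀ i, |x i| ≤ R) (i : Fin m) :
    |rootSlope b x i|
      ≤ repulsionConst R m * S * ∏ j ∈ Finset.univ.erase i, |x i - x j| := by
  obtain ⟨S', hg⟩ := hb.glue (rootCoeff b x)
  refine abs_normSeriesDeriv_le_prod hg hR hx hxR (fun j => ?_) (fun n hn => ?_) i
  · rw [normSeries_glue_eq hb _ hx, sub_self, Matrix.mulVec_zero, Pi.zero_apply]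
  · rw [glue, dif_neg (by omega)]
    exact hb n

theorem prod_prod_erase_abs_sub (x : Fin m → ℝ) :
    ∏ i, ∏ j ∈ Finset.univ.erase i, |x i - x j| = |(Matrix.vandermonde x).det| ^ 2 := by
  have h1 : ∀ i, ∏ j ∈ Finset.univ.erase i, |x i - x j|
      = (∏ j ∈ Finset.Ioi i, |x j - x i|) * ∏ j ∈ Finset.Iio i, |x j - x i| := by
    intro i
    have : Finset.univ.erase i = Finset.Ioi i ∪ Finset.Iio i := by
      ext j; simp [lt_or_lt_iff_ne, eq_comm]
    rw [this, Finset.prod_union (Finset.disjoint_left.2 fun j h1 h2 => by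
      simp only [Finset.mem_Ioi, Finset.mem_Iio] at h1 h2
      exact lt_asymm h1 h2)]
    simp_rw [abs_sub_comm (x i)]
  have h2 : ∏ i, ∏ j ∈ Finset.Iio i, |x j - x i| = ∏ j, ∏ i ∈ Finset.Ioi j, |x i - x j| := by
    rw [Finset.prod_comm' (t' := Finset.univ) (s' := fun j => Finset.Ioi j) (by simp)]
    simp_rw [abs_sub_comm (x _) (x _)]
  simp_rw [h1]
  rw [Finset.prod_mul_distrib, h2, Matrix.det_vandermonde, Finset.abs_prod, sq]
  simp_rw [Finset.abs_prod]

/-- The constant in the bound for the integrand of the Rice formula. -/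
noncomputable def riceConst (R : ℝ) (m : ℕ) : ℝ :=
  repulsionConst R m ^ m / (Real.exp (-R ^ 2 / 2) ^ m * ∏ j : Fin m, (√((j : ℕ) ! : ℝ))⁻¹)

theorem riceConst_denom_pos (R : ℝ) (m : ℕ) :
    0 < Real.exp (-R ^ 2 / 2) ^ m * ∏ j : Fin m, (√((j : ℕ) ! : ℝ))⁻¹ :=
  mul_pos (pow_pos (Real.exp_pos _) _)
    (Finset.prod_pos fun _ _ => inv_pos.2 (sqrt_factorial_pos _))

theorem riceConst_nonneg {R : ℝ} (hR : 1 ≤ R) (m : ℕ) : 0 ≤ riceConst R m :=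
  div_nonneg (pow_nonneg (repulsionConst_pos hR m).le _) (riceConst_denom_pos R m).le

theorem le_abs_det_interpMat {R : ℝ} {x : Fin m → ℝ} (hxR : ∀ i, |x i| ≤ R) :
    (Real.exp (-R ^ 2 / 2) ^ m * ∏ j : Fin m, (√((j : ℕ) ! : ℝ))⁻¹) * |(Matrix.vandermonde x).det|
      ≤ |(interpMat x).det| := by
  have h0 : 0 ≤ ∏ j : Fin m, (√((j : ℕ) ! : ℝ))⁻¹ :=
    Finset.prod_nonneg fun _ _ => inv_nonneg.2 (sqrt_factorial_pos _).le
  rw [det_interpMat, abs_mul, abs_mul, abs_of_nonneg h0,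
    abs_of_nonneg (Finset.prod_nonneg fun _ _ => (Real.exp_pos _).le)]
  gcongr
  calc Real.exp (-R ^ 2 / 2) ^ m = ∏ _i : Fin m, Real.exp (-R ^ 2 / 2) := by simp
    _ ≤ _ := by
        refine Finset.prod_le_prod (fun _ _ => (Real.exp_pos _).le) fun i _ => ?_
        have : x i ^ 2 ≤ R ^ 2 := by
          rw [← sq_abs (x i)]; exact pow_le_pow_left₀ (abs_nonneg _) (hxR i) 2
        refine Real.exp_le_exp.2 (by linarith)

theorem riceIntegrand_le {b : ℕ → ℝ} {S : ℝ} (hb : HasGrowth b S) {R : ℝ} (hR : 1 ≤ R)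
    {x : Fin m → ℝ} (hxR : ∀ i, |x i| ≤ R) :
    riceIntegrand x b ≤ riceConst R m * S ^ m * |(Matrix.vandermonde x).det| := by
  have hS := hb.nonneg
  have hrep := repulsionConst_pos hR m
  by_cases hx : Function.Injective x
  · set V := |(Matrix.vandermonde x).det| with hV
    have hV0 : 0 < V := abs_pos.2 (Matrix.det_vandermonde_ne_zero_iff.2 hx)
    set D := Real.exp (-R ^ 2 / 2) ^ m * ∏ j : Fin m, (√((j : ℕ) ! : ℝ))⁻¹ with hD
    have hD0 : 0 < D := riceConst_denom_pos R m
    have h1 : ∏ i, |rootSlope b x i| ≤ (repulsionConst R m * S) ^ m * V ^ 2 := by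
      refine (Finset.prod_le_prod (fun _ _ => abs_nonneg _)
        fun i _ => abs_rootSlope_le hb hR hx hxR i).trans_eq ?_
      rw [Finset.prod_mul_distrib, prod_prod_erase_abs_sub, Finset.prod_const, Finset.card_univ,
        Fintype.card_fin]
    have h2 : D * V ≤ |(interpMat x).det| := le_abs_det_interpMat hxR
    calc riceIntegrand x b ≤ 1 * ((∏ i, |rootSlope b x i|) / |(interpMat x).det|) := by
          unfold riceIntegrand
          exact mul_le_mul_of_nonneg_right (stdDensity_le_one _)
            (div_nonneg (Finset.prod_nonneg fun _ _ => abs_nonneg _) (abs_nonneg _))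
      _ ≤ ((repulsionConst R m * S) ^ m * V ^ 2) / (D * V) := by
          rw [one_mul]
          exact div_le_div₀ (by positivity) h1 (by positivity) h2
      _ = _ := by
          rw [riceConst, ← hD, mul_pow]
          field_simp
  · rw [riceIntegrand_eq_zero hx]
    have := riceConst_nonneg hR m
    positivity

theorem riceIntegrand_le_growthSum (hm : m ≠ 0) {b : ℕ → ℝ} (hb : growthSum m b < ∞) {R : ℝ}
    (hR : 1 ≤ R) {x : Fin m → ℝ} (hxR : ∀ i, |x i| ≤ R) :
    riceIntegrand x b
      ≤ riceConst R m * (growthSum m b).toReal * |(Matrix.vandermonde x).det| := by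
  obtain ⟨S, hS, hSm⟩ := exists_hasGrowth_of_growthSum hm hb
  rw [← hSm]
  exact riceIntegrand_le hS hR hxR

theorem integrable_growthSum_toReal (hm : m ≠ 0) :
    Integrable (fun b => (growthSum m b).toReal) coeffLaw :=
  integrable_toReal_of_lintegral_ne_top (measurable_growthSum m).aemeasurable
    (lintegral_growthSum_lt_top hm).ne

theorem exists_bound_pi (x : Fin m → ℝ) : ∃ R : ℝ, 1 ≤ R ∧ (∀ i, |x i| ≤ R) ∧
    ∀ᶠ y in 𝓝 x, ∀ i, |y i| ≤ R := by
  refine ⟨‖x‖ + 1, by linarith [norm_nonneg x], fun i => ?_, ?_⟩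
  · have := norm_le_pi_norm x i
    rw [Real.norm_eq_abs] at this
    linarith
  · filter_upwards [Metric.ball_mem_nhds x one_pos] with y hy i
    have h1 := norm_le_pi_norm y i
    have h2 := norm_le_norm_add_norm_sub x y
    have h3 : ‖x - y‖ < 1 := by rw [← dist_eq_norm, dist_comm]; exact hy
    rw [Real.norm_eq_abs] at h1
    linarith

theorem integrable_riceIntegrand (hm : m ≠ 0) (x : Fin m → ℝ) :
    Integrable (riceIntegrand x) coeffLaw := by
  obtain ⟨R, hR, hxR, -⟩ := exists_bound_pi x
  refine (((integrable_growthSum_toReal hm).const_mul (riceConst R m)).mul_const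
    |(Matrix.vandermonde x).det|).mono' (measurable_riceIntegrand_right x).aestronglyMeasurable ?_
  filter_upwards [ae_growthSum_lt_top hm] with b hb
  rw [Real.norm_eq_abs, abs_of_nonneg (riceIntegrand_nonneg x b)]
  exact riceIntegrand_le_growthSum hm hb hR hxR

theorem ofReal_intensity (hm : m ≠ 0) (x : Fin m → ℝ) :
    ENNReal.ofReal (intensity x) = ∫⁻ b, ENNReal.ofReal (riceIntegrand x b) ∂coeffLaw :=
  ofReal_integral_eq_lintegral_ofReal (integrable_riceIntegrand hm x)
    (Filter.Eventually.of_forall fun b => riceIntegrand_nonneg x b)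

theorem continuous_det_vandermonde : Continuous fun x : Fin m → ℝ => (Matrix.vandermonde x).det := by
  refine Continuous.matrix_det (continuous_matrix fun i j => ?_)
  simp only [Matrix.vandermonde_apply]
  fun_prop

theorem continuous_det_interpMat : Continuous fun x : Fin m → ℝ => (interpMat x).det := by
  refine Continuous.matrix_det (continuous_matrix fun i j => ?_)
  exact (continuous_weylFun j).comp (continuous_apply i)

theorem continuousAt_rootCoeff {b : ℕ → ℝ} {S : ℝ} (hb : HasGrowth b S) {x : Fin m → ℝ}
    (hx : Function.Injective x) : ContinuousAt (rootCoeff b) x :=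
  ((contDiffOn_rootCoeff hb).contDiffAt (isOpen_injective.mem_nhds hx)).continuousAt

theorem continuousAt_rootSlope {b : ℕ → ℝ} {S : ℝ} (hb : HasGrowth b S) {x : Fin m → ℝ}
    (hx : Function.Injective x) (i : Fin m) : ContinuousAt (fun x => rootSlope b x i) x := by
  obtain ⟨S₀, h₀⟩ := hb.glue (0 : Fin m → ℝ)
  have e : (fun x => rootSlope b x i) = fun x => ∑ j, rootCoeff b x j * weylFunDeriv j (x i)
      + normSeriesDeriv (glue m 0 b) (x i) := by
    ext x; exact normSeriesDeriv_glue hb _ _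
  rw [e]
  have h1 := continuousAt_rootCoeff hb hx
  have h2 : ∀ j, ContinuousAt (fun x => rootCoeff b x j) x := fun j =>
    (continuous_apply j).continuousAt.comp h1
  have h3 : ∀ j : Fin m, Continuous fun x : Fin m → ℝ => weylFunDeriv j (x i) := fun j =>
    (continuous_weylFunDeriv j).comp (continuous_apply i)
  have h4 : Continuous fun x : Fin m → ℝ => normSeriesDeriv (glue m 0 b) (x i) :=
    h₀.continuous_deriv.comp (continuous_apply i)
  exact (tendsto_finsetSum _ fun j _ => (h2 j).mul (h3 j).continuousAt).add h4.continuousAt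

theorem continuousAt_riceIntegrand (hm : m ≠ 0) {b : ℕ → ℝ} (hb : growthSum m b < ∞)
    (x : Fin m → ℝ) : ContinuousAt (fun x => riceIntegrand x b) x := by
  obtain ⟨S, hS, -⟩ := exists_hasGrowth_of_growthSum hm hb
  by_cases hx : Function.Injective x
  · refine ContinuousAt.mul ((continuous_stdDensity m).continuousAt.comp
      (continuousAt_rootCoeff hS hx)) (ContinuousAt.div ?_ ?_ ?_)
    · exact tendsto_finsetProd _ fun i _ => (continuousAt_rootSlope hS hx i).abs
    · exact continuous_det_interpMat.abs.continuousAt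
    · exact abs_ne_zero.2 (det_interpMat_ne_zero_iff.2 hx)
  · obtain ⟨R, hR, hxR, hev⟩ := exists_bound_pi x
    unfold ContinuousAt
    simp only [riceIntegrand_eq_zero hx b]
    have h1 : Filter.Tendsto (fun y : Fin m → ℝ => riceConst R m * (growthSum m b).toReal *
        |(Matrix.vandermonde y).det|) (𝓝 x) (𝓝 0) := by
      have h2 : (Matrix.vandermonde x).det = 0 :=
        not_not.1 (mt Matrix.det_vandermonde_ne_zero_iff.1 hx)
      have h3 := (continuous_det_vandermonde (m := m)).abs.const_mul
        (riceConst R m * (growthSum m b).toReal)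
      have h4 := h3.tendsto x
      rwa [h2, abs_zero, mul_zero] at h4
    refine tendsto_of_tendsto_of_tendsto_of_le_of_le' tendsto_const_nhds h1
      (Filter.Eventually.of_forall fun y => riceIntegrand_nonneg y b) ?_
    filter_upwards [hev] with y hy
    exact riceIntegrand_le_growthSum hm hb hR hy

theorem continuous_intensity (hm : m ≠ 0) : Continuous (intensity (m := m)) := by
  refine continuous_iff_continuousAt.2 fun x => ?_
  obtain ⟨R, hR, hxR, hev⟩ := exists_bound_pi x
  refine continuousAt_of_dominated (bound := fun b => riceConst R m * (growthSum m b).toReal *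
    (|(Matrix.vandermonde x).det| + 1))
    (Filter.Eventually.of_forall fun y => (measurable_riceIntegrand_right y).aestronglyMeasurable)
    ?_ (((integrable_growthSum_toReal hm).const_mul _).mul_const _) ?_
  · have hV : ∀ᶠ y in 𝓝 x, |(Matrix.vandermonde y).det| < |(Matrix.vandermonde x).det| + 1 :=
      (continuous_det_vandermonde (m := m)).abs.continuousAt.eventually_lt_const (by linarith)
    filter_upwards [hev, hV] with y hy hyV
    filter_upwards [ae_growthSum_lt_top hm] with b hb
    rw [Real.norm_eq_abs, abs_of_nonneg (riceIntegrand_nonneg y b)]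
    refine (riceIntegrand_le_growthSum hm hb hR hy).trans ?_
    have := riceConst_nonneg hR m
    gcongr
  · filter_upwards [ae_growthSum_lt_top hm] with b hb
    exact continuousAt_riceIntegrand hm hb x

/-- The values and derivatives of the normalised Weyl series at the points `x i`. -/
noncomputable def jet {σ : Type*} (x : σ → ℝ) (a : ℕ → ℝ) (p : σ ⊕ σ) : ℝ := ∑' n, a n * jetFun x p n

theorem jet_inl {σ : Type*} (x : σ → ℝ) (a : ℕ → ℝ) (i : σ) :
    jet x a (Sum.inl i) = normSeries a (x i) := rfl

theorem jet_inr {σ : Type*} (x : σ → ℝ) (a : ℕ → ℝ) (i : σ) :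
    jet x a (Sum.inr i) = normSeriesDeriv a (x i) := rfl

theorem ae_dotProduct_jet_ne_zero {x : Fin m → ℝ} (hx : Function.Injective x)
    {u : Fin m ⊕ Fin m → ℝ} (hu : u ≠ 0) : ∀ᵐ a ∂coeffLaw, u ⬝ᵥ jet x a ≠ 0 := by
  set w : ℕ → ℝ := fun n => ∑ p, u p * jetFun x p n with hw
  have hwr : RapidDecay w := RapidDecay.sum _ fun p => (rapidDecay_jetFun x p).const_mul _
  have hQ := hasSum_jetCov_quad x u
  set Q := u ⬝ᵥ crossCov x x *ᵥ u with hQd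
  have hQ0 : 0 < Q := lt_of_le_of_ne (jetCov_quad_nonneg x u) fun h =>
    hu (eq_zero_of_jetCov_quad_eq_zero hx h.symm)
  have h1 := hasGaussianCov_map_tsum (ι := Unit) (w := fun _ => w) (A := fun _ _ => Q)
    (fun _ => hwr) fun _ _ => by simpa only [sq] using hQ
  have h2 := hasGaussianCov_pi (ι := Unit) fun _ => Q.toNNReal
  have h3 : (Matrix.diagonal fun _ : Unit => (Q.toNNReal : ℝ)) = fun _ _ => Q := by
    ext i j; simp [Matrix.diagonal, hQ0.le]
  rw [h3] at h2
  have h4 := h1.unique h2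
  have h5 : (Measure.pi fun _ : Unit => gaussianReal 0 Q.toNNReal) {y | y () = 0} = 0 := by
    have h6 := (measurePreserving_eval (fun _ : Unit => gaussianReal 0 Q.toNNReal) ()).measure_preimage
      (measurableSet_singleton (0 : ℝ)).nullMeasurableSet
    have h7 := nullSingletonClass_gaussianReal (μ := 0) (v := Q.toNNReal) (by simpa using hQ0)
    rw [measure_singleton] at h6
    exact h6
  have hwm : Measurable fun (a : ℕ → ℝ) (_ : Unit) => ∑' n, a n * w n :=
    measurable_pi_iff.2 fun _ => Measurable.tsum fun n => by fun_prop
  rw [← h4, Measure.map_apply hwm (measurableSet_eq_fun (measurable_pi_apply ()) measurable_const)]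
    at h5
  filter_upwards [measure_eq_zero_iff_ae_notMem.1 h5, ae_hasGrowth] with a ha ⟨S, hS⟩ h0
  refine ha ?_
  simp only [Set.mem_preimage, Set.mem_ofPred_eq]
  rw [← h0]
  simp only [dotProduct, jet, hw, ← tsum_mul_left, Finset.mul_sum]
  rw [← Summable.tsum_finsetSum fun p _ => ((rapidDecay_jetFun x p).summable_mul hS).mul_left _]
  refine tsum_congr fun n => Finset.sum_congr rfl fun p _ => by ring

theorem glue_self (a : ℕ → ℝ) : glue m (fun i => a i) a = a := by
  ext n; simp [glue]

theorem rootSlope_eq_dotProduct {a : ℕ → ℝ} {S : ℝ} (ha : HasGrowth a S) {x : Fin m → ℝ}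
    (hx : Function.Injective x) (i : Fin m) :
    rootSlope a x i = Sum.elim (-((fun j : Fin m => weylFunDeriv j (x i)) ᵥ* (interpMat x)⁻¹))
      (Pi.single i 1) ⬝ᵥ jet x a := by
  have hd : IsUnit (interpMat x).det := (det_interpMat_ne_zero_iff.2 hx).isUnit
  set a₀ : Fin m → ℝ := fun i => a i with ha₀
  have h1 : (fun j => normSeries a (x j)) = interpMat x *ᵥ (a₀ - rootCoeff a x) := by
    ext j
    conv_lhs => rw [← glue_self (m := m) a]
    exact normSeries_glue_eq ha _ hx j
  have h2 : normSeriesDeriv a (x i) - rootSlope a x i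
      = (fun j : Fin m => weylFunDeriv j (x i)) ⬝ᵥ (a₀ - rootCoeff a x) := by
    have e : normSeriesDeriv a (x i) = normSeriesDeriv (glue m a₀ a) (x i) := by rw [glue_self]
    rw [e, rootSlope, normSeriesDeriv_glue ha, normSeriesDeriv_glue ha (rootCoeff a x)]
    simp only [dotProduct, Pi.sub_apply, mul_sub, Finset.sum_sub_distrib, ha₀]
    simp_rw [mul_comm (weylFunDeriv _ _)]
    ring
  have h3 : jet x a = Sum.elim (fun j => normSeries a (x j)) fun j => normSeriesDeriv a (x j) := by
    ext p; rcases p with p | p <;> rfl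
  rw [h3, sumElim_dotProduct_sumElim, h1, neg_dotProduct, Matrix.dotProduct_mulVec,
    Matrix.vecMul_vecMul, Matrix.nonsing_inv_mul _ hd, Matrix.vecMul_one, ← h2, single_dotProduct]
  ring

theorem intensity_pos (hm : m ≠ 0) {x : Fin m → ℝ} (hx : Function.Injective x) :
    0 < intensity x := by
  have hae : ∀ᵐ b ∂coeffLaw, riceIntegrand x b ≠ 0 := by
    have h1 : ∀ᵐ b ∂coeffLaw, ∀ i, rootSlope b x i ≠ 0 := by
      refine ae_all_iff.2 fun i => ?_
      have h2 := ae_dotProduct_jet_ne_zero hx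
        (u := Sum.elim (-((fun j : Fin m => weylFunDeriv j (x i)) ᵥ* (interpMat x)⁻¹))
          (Pi.single i 1)) fun h => by
        have := congrFun h (Sum.inr i)
        simp at this
      filter_upwards [h2, ae_hasGrowth] with b hb ⟨S, hS⟩
      rwa [rootSlope_eq_dotProduct hS hx]
    filter_upwards [h1] with b hb
    refine mul_ne_zero (stdDensity_pos _).ne' (div_ne_zero ?_ ?_)
    · exact Finset.prod_ne_zero_iff.2 fun i _ => abs_ne_zero.2 (hb i)
    · exact abs_ne_zero.2 (det_interpMat_ne_zero_iff.2 hx)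
  rw [intensity, integral_pos_iff_support_of_nonneg (riceIntegrand_nonneg x)
    (integrable_riceIntegrand hm x)]
  have : coeffLaw (Function.support (riceIntegrand x)) = 1 := by
    rw [show Function.support (riceIntegrand x) = {b | riceIntegrand x b ≠ 0} from rfl,
      measure_congr (Filter.eventuallyEq_univ.2 hae), measure_univ]
  rw [this]
  exact one_pos

end Intensity

section Kac

/-- The Kac weight of a vector of values and derivatives. -/
noncomputable def kacWeight {σ : Type*} [Fintype σ] (ε : ℝ) (y : σ ⊕ σ → ℝ) : ℝ≥0∞ :=
  ∏ i, if |y (Sum.inl i)| < ε then ENNReal.ofReal (|y (Sum.inr i)| / (2 * ε)) else 0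

theorem measurable_kacWeight {σ : Type*} [Fintype σ] (ε : ℝ) :
    Measurable (kacWeight (σ := σ) ε) := by
  refine Finset.measurable_prod _ fun i _ => Measurable.ite ?_ (by fun_prop) measurable_const
  exact measurableSet_lt (by fun_prop) measurable_const

theorem kacWeight_smul {σ : Type*} [Fintype σ] {s ε : ℝ} (hs : 0 < s) (y : σ ⊕ σ → ℝ) :
    kacWeight ε (s • y) = kacWeight (ε / s) y := by
  unfold kacWeight
  refine Finset.prod_congr rfl fun i _ => ?_
  simp only [Pi.smul_apply, smul_eq_mul, abs_mul, abs_of_pos hs]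
  have h1 : s * |y (Sum.inl i)| < ε ↔ |y (Sum.inl i)| < ε / s := by
    rw [lt_div_iff₀ hs, mul_comm]
  have h2 : s * |y (Sum.inr i)| / (2 * ε) = |y (Sum.inr i)| / (2 * (ε / s)) := by
    field_simp
  simp only [h1, h2]

theorem measurable_jet {σ : Type*} (x : σ → ℝ) : Measurable (jet x) :=
  measurable_pi_iff.2 fun _ => Measurable.tsum fun n => by fun_prop

variable {m : ℕ}

/-- The slopes of the normalised Weyl series with values `ε u` at the points `x i`. -/
noncomputable def pertSlope (ε : ℝ) (x : Fin m → ℝ) (b : ℕ → ℝ) (u : Fin m → ℝ) (i : Fin m) : ℝ :=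
  rootSlope b x i + ε * ∑ j, ((interpMat x)⁻¹ *ᵥ u) j * weylFunDeriv j (x i)

/-- The integrand of the Kac formula, as a function of the rescaled values `u`. -/
noncomputable def kacIntegrand (ε : ℝ) (x : Fin m → ℝ) (b : ℕ → ℝ) (u : Fin m → ℝ) : ℝ :=
  stdDensity (rootCoeff b x + ε • ((interpMat x)⁻¹ *ᵥ u)) *
    ((∏ i, |pertSlope ε x b u i|) / |(interpMat x).det|) / 2 ^ m

/-- The open unit cube. -/
def unitCube (m : ℕ) : Set (Fin m → ℝ) := {u | ∀ i, |u i| < 1}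

theorem unitCube_eq (m : ℕ) : unitCube m = Set.univ.pi fun _ => Set.Ioo (-1) 1 := by
  ext u; simp [unitCube, abs_lt]

theorem measurableSet_unitCube (m : ℕ) : MeasurableSet (unitCube m) := by
  rw [unitCube_eq]
  exact MeasurableSet.univ_pi fun _ => measurableSet_Ioo

theorem volume_unitCube (m : ℕ) : volume (unitCube m) = 2 ^ m := by
  rw [unitCube_eq, volume_pi_pi]
  simp only [Real.volume_Ioo]
  norm_num

theorem kacIntegrand_zero (x : Fin m → ℝ) (b : ℕ → ℝ) (u : Fin m → ℝ) :
    kacIntegrand 0 x b u = riceIntegrand x b / 2 ^ m := by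
  simp [kacIntegrand, riceIntegrand, pertSlope]

theorem measurable_rootCoeff_left (x : Fin m → ℝ) :
    Measurable fun b : ℕ → ℝ => rootCoeff b x := by
  have h : Measurable fun b : ℕ → ℝ => (b, x) := measurable_id.prodMk measurable_const
  have h2 := (measurable_rootCoeff (m := m)).comp h
  exact h2

theorem measurable_rootSlope_left (x : Fin m → ℝ) (i : Fin m) :
    Measurable fun b : ℕ → ℝ => rootSlope b x i := by
  have h : Measurable fun b : ℕ → ℝ => (b, x) := measurable_id.prodMk measurable_const
  have h2 := (measurable_rootSlope i).comp h
  exact h2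

theorem continuous_mulVec_apply (A : Matrix (Fin m) (Fin m) ℝ) :
    Continuous fun u : Fin m → ℝ => A *ᵥ u :=
  Continuous.matrix_mulVec continuous_const continuous_id

theorem measurable_kacIntegrand (ε : ℝ) (x : Fin m → ℝ) :
    Measurable fun p : (ℕ → ℝ) × (Fin m → ℝ) => kacIntegrand ε x p.1 p.2 := by
  have hA : Measurable fun p : (ℕ → ℝ) × (Fin m → ℝ) => (interpMat x)⁻¹ *ᵥ p.2 :=
    (continuous_mulVec_apply _).measurable.comp measurable_snd
  have hAj : ∀ j, Measurable fun p : (ℕ → ℝ) × (Fin m → ℝ) => ((interpMat x)⁻¹ *ᵥ p.2) j :=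
    fun j => (measurable_pi_apply j).comp hA
  have hr : Measurable fun p : (ℕ → ℝ) × (Fin m → ℝ) => rootCoeff p.1 x :=
    (measurable_rootCoeff_left x).comp measurable_fst
  have hs : ∀ i, Measurable fun p : (ℕ → ℝ) × (Fin m → ℝ) => pertSlope ε x p.1 p.2 i := by
    intro i
    refine ((measurable_rootSlope_left x i).comp measurable_fst).add
      (measurable_const.mul (Finset.measurable_sum _ fun j _ => (hAj j).mul measurable_const))
  have hd : Measurable fun p : (ℕ → ℝ) × (Fin m → ℝ) =>
      stdDensity (rootCoeff p.1 x + ε • ((interpMat x)⁻¹ *ᵥ p.2)) :=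
    (continuous_stdDensity m).measurable.comp (hr.add (hA.const_smul ε))
  exact (hd.mul ((Finset.measurable_prod _ fun i _ => (hs i).abs).div_const _)).div_const _

theorem lintegral_kacWeight_glue {b : ℕ → ℝ} {S : ℝ} (hb : HasGrowth b S) {x : Fin m → ℝ}
    (hx : Function.Injective x) {ε : ℝ} (hε : 0 < ε) :
    ∫⁻ a, kacWeight ε (jet x (glue m a b)) ∂stdGaussianPi m
      = ∫⁻ u in unitCube m, ENNReal.ofReal (kacIntegrand ε x b u) := by
  have hd := det_interpMat_ne_zero_iff.2 hx
  set A : Matrix (Fin m) (Fin m) ℝ := ε • (interpMat x)⁻¹ with hA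
  have hAdet : A.det = ε ^ m / (interpMat x).det := by
    rw [hA, Matrix.det_smul, Matrix.det_nonsing_inv, Ring.inverse_eq_inv', Fintype.card_fin,
      div_eq_mul_inv]
  have hA0 : A.det ≠ 0 := by rw [hAdet]; positivity
  have hw : Measurable fun a : Fin m → ℝ => kacWeight ε (jet x (glue m a b)) :=
    (measurable_kacWeight ε).comp ((measurable_jet x).comp
      ((measurable_glue m).comp (measurable_id.prodMk measurable_const)))
  set g : (Fin m → ℝ) → ℝ≥0∞ := fun a =>
    ENNReal.ofReal (stdDensity a) * kacWeight ε (jet x (glue m a b)) with hg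
  have hgm : Measurable g := (continuous_stdDensity m).measurable.ennreal_ofReal.mul hw
  have hmap := Real.map_matrix_volume_pi_eq_smul_volume_pi hA0
  have hlin : Measurable (Matrix.toLin' A) := (continuous_mulVec_apply A).measurable
  have h1 : ∫⁻ u, g (rootCoeff b x + A *ᵥ u) = ENNReal.ofReal |A.det|⁻¹ * ∫⁻ a, g a := by
    have h2 : ∫⁻ u, g (rootCoeff b x + A *ᵥ u)
        = ∫⁻ v, g (rootCoeff b x + v) ∂(volume.map (Matrix.toLin' A)) := by
      have hgt : Measurable fun v => g (rootCoeff b x + v) :=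
        hgm.comp (measurable_const.add measurable_id)
      rw [lintegral_map hgt hlin]
      rfl
    rw [h2, hmap, lintegral_smul_measure, lintegral_add_left_eq_self g, abs_inv, smul_eq_mul]
  have h3 : ∫⁻ a, g a = ENNReal.ofReal |A.det| * ∫⁻ u, g (rootCoeff b x + A *ᵥ u) := by
    rw [h1, ← mul_assoc, ← ENNReal.ofReal_mul (abs_nonneg _), mul_inv_cancel₀ (abs_ne_zero.2 hA0),
      ENNReal.ofReal_one, one_mul]
  rw [lintegral_stdGaussianPi hw]
  refine h3.trans ?_
  have hgm' : Measurable fun u => g (rootCoeff b x + A *ᵥ u) :=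
    hgm.comp (measurable_const.add (continuous_mulVec_apply A).measurable)
  rw [← lintegral_const_mul _ hgm', ← lintegral_indicator (measurableSet_unitCube m)]
  refine lintegral_congr fun u => ?_
  have hAu : A *ᵥ u = ε • ((interpMat x)⁻¹ *ᵥ u) := by rw [hA, Matrix.smul_mulVec]
  have hval : ∀ i, jet x (glue m (rootCoeff b x + A *ᵥ u) b) (Sum.inl i) = ε * u i := by
    intro i
    rw [jet_inl, normSeries_glue_eq hb _ hx, add_sub_cancel_left, hAu, Matrix.mulVec_smul,
      Matrix.mulVec_mulVec, Matrix.mul_nonsing_inv _ hd.isUnit, Matrix.one_mulVec]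
    rfl
  have hder : ∀ i, jet x (glue m (rootCoeff b x + A *ᵥ u) b) (Sum.inr i) = pertSlope ε x b u i := by
    intro i
    rw [jet_inr, normSeriesDeriv_glue hb, pertSlope, rootSlope, normSeriesDeriv_glue hb (rootCoeff b x),
      hAu]
    simp only [Pi.add_apply, Pi.smul_apply, smul_eq_mul, add_mul, Finset.sum_add_distrib,
      Finset.mul_sum, mul_assoc]
    ring
  simp only [hg, kacWeight, hval, hder]
  have hlt : ∀ i, |ε * u i| < ε ↔ |u i| < 1 := fun i => by
    rw [abs_mul, abs_of_pos hε]
    exact mul_lt_iff_lt_one_right hε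
  simp only [hlt]
  by_cases hu : u ∈ unitCube m
  · rw [Set.indicator_of_mem hu]
    have hu' : ∀ i, |u i| < 1 := hu
    simp only [hu', if_true]
    rw [← ENNReal.ofReal_prod_of_nonneg fun _ _ => by positivity,
      ← ENNReal.ofReal_mul (stdDensity_pos _).le, ← ENNReal.ofReal_mul (abs_nonneg _)]
    congr 1
    rw [kacIntegrand, hAu, hAdet, Finset.prod_div_distrib, Finset.prod_const, Finset.card_univ,
      Fintype.card_fin, abs_div, abs_of_pos (pow_pos hε m), mul_pow]
    have := abs_pos.2 hd
    field_simp
  · rw [Set.indicator_of_notMem hu]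
    have : ∃ i, ¬ |u i| < 1 := by simpa [unitCube] using hu
    obtain ⟨i, hi⟩ := this
    rw [Finset.prod_eq_zero (Finset.mem_univ i) (if_neg hi), mul_zero, mul_zero]

theorem exists_kacIntegrand_le (hm : m ≠ 0) {x : Fin m → ℝ} (hx : Function.Injective x) :
    ∃ K L : ℝ, ∀ b, growthSum m b < ∞ → ∀ u ∈ unitCube m, ∀ ε : ℝ, 0 < ε → ε ≤ 1 →
      kacIntegrand ε x b u ≤ K * (growthSum m b).toReal + L := by
  obtain ⟨R, hR, hxR, -⟩ := exists_bound_pi x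
  set P : ℝ := ∑ i, repulsionConst R m * ∏ j ∈ Finset.univ.erase i, |x i - x j| with hP
  have hPi : ∀ i, 0 ≤ repulsionConst R m * ∏ j ∈ Finset.univ.erase i, |x i - x j| := fun i =>
    mul_nonneg (repulsionConst_pos hR m).le (Finset.prod_nonneg fun _ _ => abs_nonneg _)
  have hP0 : 0 ≤ P := Finset.sum_nonneg fun i _ => hPi i
  have hcont : ∀ i : Fin m, Continuous fun u : Fin m → ℝ =>
      ∑ j, ((interpMat x)⁻¹ *ᵥ u) j * weylFunDeriv j (x i) := fun i =>
    continuous_finsetSum _ fun j _ =>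
      ((continuous_apply j).comp (continuous_mulVec_apply _)).mul continuous_const
  have hex : ∀ i : Fin m, ∃ B, ∀ u ∈ Metric.closedBall (0 : Fin m → ℝ) 1,
      ‖∑ j, ((interpMat x)⁻¹ *ᵥ u) j * weylFunDeriv j (x i)‖ ≤ B := fun i =>
    (isCompact_closedBall _ _).exists_bound_of_continuousOn (hcont i).continuousOn
  choose B hB using hex
  have hB0 : ∀ i, 0 ≤ B i := fun i => (norm_nonneg _).trans (hB i 0 (by simp))
  set Q : ℝ := ∑ i, B i with hQ
  have hQ0 : 0 ≤ Q := Finset.sum_nonneg fun i _ => hB0 i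
  have hd := abs_pos.2 (det_interpMat_ne_zero_iff.2 hx)
  set D := |(interpMat x).det| with hD
  refine ⟨2 ^ (m - 1) * P ^ m / D, 2 ^ (m - 1) * Q ^ m / D, ?_⟩
  intro b hb u hu ε hε hε1
  obtain ⟨S, hS, hSm⟩ := exists_hasGrowth_of_growthSum hm hb
  have hS0 := hS.nonneg
  have hu1 : u ∈ Metric.closedBall (0 : Fin m → ℝ) 1 := by
    rw [mem_closedBall_zero_iff]
    exact (pi_norm_le_iff_of_nonneg zero_le_one).2 fun i => (hu i).le
  have hsl : ∀ i, |pertSlope ε x b u i| ≤ P * S + Q := by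
    intro i
    refine (abs_add_le _ _).trans (add_le_add ?_ ?_)
    · refine (abs_rootSlope_le hS hR hx hxR i).trans ?_
      have := Finset.single_le_sum (fun i _ => hPi i) (Finset.mem_univ i)
      have h2 := mul_le_mul_of_nonneg_right this hS0
      linarith
    · rw [abs_mul, abs_of_pos hε]
      refine (mul_le_of_le_one_left (abs_nonneg _) hε1).trans ?_
      exact (hB i u hu1).trans (Finset.single_le_sum (fun i _ => hB0 i) (Finset.mem_univ i))
  have h2m : (1 : ℝ) ≤ 2 ^ m := one_le_pow₀ (by norm_num)
  calc kacIntegrand ε x b u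
      ≤ stdDensity (rootCoeff b x + ε • ((interpMat x)⁻¹ *ᵥ u)) *
          ((∏ i, |pertSlope ε x b u i|) / D) := by
        refine div_le_self (mul_nonneg (stdDensity_pos _).le ?_) h2m
        exact div_nonneg (Finset.prod_nonneg fun _ _ => abs_nonneg _) hd.le
    _ ≤ (∏ i, |pertSlope ε x b u i|) / D := mul_le_of_le_one_left
        (div_nonneg (Finset.prod_nonneg fun _ _ => abs_nonneg _) hd.le) (stdDensity_le_one _)
    _ ≤ (P * S + Q) ^ m / D := by
        gcongr
        refine (Finset.prod_le_prod (fun _ _ => abs_nonneg _) fun i _ => hsl i).trans_eq ?_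
        rw [Finset.prod_const, Finset.card_univ, Fintype.card_fin]
    _ ≤ (2 ^ (m - 1) * ((P * S) ^ m + Q ^ m)) / D := by
        gcongr
        exact add_pow_le (by positivity) hQ0 m
    _ = _ := by rw [mul_pow, hSm]; ring

theorem tendsto_kacIntegrand (x : Fin m → ℝ) (b : ℕ → ℝ) (u : Fin m → ℝ) :
    Filter.Tendsto (fun ε => kacIntegrand ε x b u) (𝓝[>] 0) (𝓝 (kacIntegrand 0 x b u)) := by
  have h1 := continuous_stdDensity m
  have : Continuous fun ε => kacIntegrand ε x b u := by
    unfold kacIntegrand pertSlope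
    fun_prop
  exact (this.tendsto 0).mono_left nhdsWithin_le_nhds

/-- The Kac formula: the intensity as a limit of smoothed expectations. -/
theorem tendsto_lintegral_kacWeight (hm : m ≠ 0) {x : Fin m → ℝ} (hx : Function.Injective x) :
    Filter.Tendsto (fun ε => ∫⁻ a, kacWeight ε (jet x a) ∂coeffLaw) (𝓝[>] 0)
      (𝓝 (ENNReal.ofReal (intensity x))) := by
  have hpos : ∀ᶠ ε : ℝ in 𝓝[>] 0, 0 < ε := self_mem_nhdsWithin
  have hle : ∀ᶠ ε : ℝ in 𝓝[>] 0, ε ≤ 1 :=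
    (eventually_le_nhds (zero_lt_one' ℝ)).filter_mono nhdsWithin_le_nhds
  have hm' : ∀ ε, Measurable fun p : (ℕ → ℝ) × (Fin m → ℝ) =>
      ENNReal.ofReal (kacIntegrand ε x p.1 p.2) := fun ε =>
    (measurable_kacIntegrand ε x).ennreal_ofReal
  set μ : Measure ((ℕ → ℝ) × (Fin m → ℝ)) := coeffLaw.prod (volume.restrict (unitCube m)) with hμ
  have h1 : ∀ ε > 0, ∫⁻ a, kacWeight ε (jet x a) ∂coeffLaw
      = ∫⁻ p, ENNReal.ofReal (kacIntegrand ε x p.1 p.2) ∂μ := by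
    intro ε hε
    have hk : Measurable fun a => kacWeight ε (jet x a) :=
      (measurable_kacWeight ε).comp (measurable_jet x)
    rw [hμ, lintegral_prod _ (hm' ε).aemeasurable, lintegral_coeffLaw m hk]
    refine lintegral_congr_ae ?_
    filter_upwards [ae_hasGrowth] with b ⟨S, hb⟩
    exact lintegral_kacWeight_glue hb hx hε
  have h0 : ENNReal.ofReal (intensity x)
      = ∫⁻ p, ENNReal.ofReal (kacIntegrand 0 x p.1 p.2) ∂μ := by
    rw [hμ, lintegral_prod _ (hm' 0).aemeasurable, ofReal_intensity hm]
    refine lintegral_congr fun b => ?_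
    simp only [kacIntegrand_zero, lintegral_const, Measure.restrict_apply_univ, volume_unitCube]
    rw [ENNReal.ofReal_div_of_pos (by positivity), ENNReal.ofReal_pow (by norm_num),
      ENNReal.ofReal_ofNat, ENNReal.div_mul_cancel (by positivity) (by finiteness)]
  obtain ⟨K, L, hKL⟩ := exists_kacIntegrand_le hm hx
  rw [h0]
  refine Filter.Tendsto.congr' (hpos.mono fun ε hε => (h1 ε hε).symm) ?_
  refine tendsto_lintegral_filter_of_dominated_convergence
    (fun p => ENNReal.ofReal (K * (growthSum m p.1).toReal + L))
    (Filter.Eventually.of_forall hm') ?_ ?_ ?_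
  · filter_upwards [hpos, hle] with ε hε hε1
    have hg : ∀ᵐ p ∂μ, growthSum m p.1 < ∞ :=
      Measure.quasiMeasurePreserving_fst.ae (ae_growthSum_lt_top hm)
    have hc : ∀ᵐ p ∂μ, p.2 ∈ unitCube m :=
      Measure.quasiMeasurePreserving_snd.ae (ae_restrict_mem (measurableSet_unitCube m))
    filter_upwards [hg, hc] with p hp1 hp2
    exact ENNReal.ofReal_le_ofReal (hKL _ hp1 _ hp2 ε hε hε1)
  · have hI : Integrable (fun b => K * (growthSum m b).toReal + L) coeffLaw :=
      ((integrable_growthSum_toReal hm).const_mul K).add (integrable_const L)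
    have hfm : Measurable fun b => ENNReal.ofReal (K * (growthSum m b).toReal + L) :=
      (((measurable_growthSum m).ennreal_toReal.const_mul K).add_const L).ennreal_ofReal
    have hfm2 : Measurable fun p : (ℕ → ℝ) × (Fin m → ℝ) =>
        ENNReal.ofReal (K * (growthSum m p.1).toReal + L) := hfm.comp measurable_fst
    rw [hμ, lintegral_prod _ hfm2.aemeasurable]
    simp only [lintegral_const, Measure.restrict_apply_univ, volume_unitCube]
    rw [lintegral_mul_const _ hfm]
    refine ENNReal.mul_ne_top ?_ (by finiteness)
    exact (hI.lintegral_lt_top).ne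
  · exact Filter.Eventually.of_forall fun p =>
      (ENNReal.continuous_ofReal.tendsto _).comp (tendsto_kacIntegrand x p.1 p.2)

end Kac

section Clustering

theorem hasGaussianCov_map_jet {σ : Type*} [Fintype σ] (x : σ → ℝ) :
    HasGaussianCov (coeffLaw.map (jet x)) (crossCov x x) :=
  hasGaussianCov_map_tsum (rapidDecay_jetFun x) (hasSum_jetFun x x)

theorem hasGaussianCov_map_jet_sum {σ τ : Type*} [Fintype σ] [Fintype τ] (x : σ → ℝ) (y : τ → ℝ) :
    HasGaussianCov (coeffLaw.map fun a => Sum.elim (jet x a) (jet y a))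
      (Matrix.fromBlocks (crossCov x x) (crossCov x y) (crossCov y x) (crossCov y y)) := by
  have h := hasGaussianCov_map_tsum (w := Sum.elim (jetFun x) (jetFun y))
    (A := Matrix.fromBlocks (crossCov x x) (crossCov x y) (crossCov y x) (crossCov y y))
    (fun i => by
      rcases i with i | i
      · exact rapidDecay_jetFun x i
      · exact rapidDecay_jetFun y i)
    (fun i j => by
      rcases i with i | i <;> rcases j with j | j
      · exact hasSum_jetFun x x i j
      · exact hasSum_jetFun x y i j
      · exact hasSum_jetFun y x i j
      · exact hasSum_jetFun y y i j)
  convert! h using 2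
  ext a i
  rcases i with i | i <;> rfl

theorem dotProduct_fromBlocks_mulVec {σ τ : Type*} [Fintype σ] [Fintype τ] (A : Matrix σ σ ℝ)
    (B : Matrix σ τ ℝ) (C : Matrix τ σ ℝ) (D : Matrix τ τ ℝ) (u : σ → ℝ) (v : τ → ℝ) :
    Sum.elim u v ⬝ᵥ Matrix.fromBlocks A B C D *ᵥ Sum.elim u v
      = u ⬝ᵥ A *ᵥ u + u ⬝ᵥ B *ᵥ v + v ⬝ᵥ C *ᵥ u + v ⬝ᵥ D *ᵥ v := by
  rw [Matrix.fromBlocks_mulVec, sumElim_dotProduct_sumElim]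
  simp only [Sum.elim_comp_inl, Sum.elim_comp_inr, dotProduct_add]
  ring

variable {p q k : ℕ}

theorem intensity_le_and_le (hp : p ≠ 0) (hq : q ≠ 0) (hk : k ≠ 0) {x : Fin p → ℝ} {y : Fin q → ℝ}
    {z : Fin k → ℝ} (hz : Function.Injective z) (e : Fin p ⊕ Fin q ≃ Fin k)
    (hzx : ∀ i, z (e (Sum.inl i)) = x i) (hzy : ∀ j, z (e (Sum.inr j)) = y j) {δ : ℝ} (hδ : 0 ≤ δ)
    (hδ2 : δ ≤ 1 / 2) (hcross : ∀ u v, |u ⬝ᵥ crossCov x y *ᵥ v|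
      ≤ δ * √(u ⬝ᵥ crossCov x x *ᵥ u) * √(v ⬝ᵥ crossCov y y *ᵥ v)) :
    intensity z ≤ (1 + 4 * δ) ^ (p + q) * (intensity x * intensity y) ∧
      intensity x * intensity y ≤ (1 + 4 * δ) ^ (p + q) * intensity z := by
  have hx : Function.Injective x := fun i j h => by
    rw [← hzx, ← hzx] at h
    exact Sum.inl_injective (e.injective (hz h))
  have hy : Function.Injective y := fun i j h => by
    rw [← hzy, ← hzy] at h
    exact Sum.inr_injective (e.injective (hz h))
  set A := Matrix.fromBlocks (crossCov x x) (crossCov x y) (crossCov y x) (crossCov y y) with hA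
  set A₀ : Matrix _ _ ℝ := Matrix.fromBlocks (crossCov x x) 0 0 (crossCov y y) with hA₀
  have hμ : HasGaussianCov _ A := hasGaussianCov_map_jet_sum x y
  have hμ₀ : HasGaussianCov _ A₀ := (hasGaussianCov_map_jet x).prod (hasGaussianCov_map_jet y)
  set μ := coeffLaw.map fun a => (Sum.elim (jet x a) (jet y a) :
    (Fin p ⊕ Fin p) ⊕ (Fin q ⊕ Fin q) → ℝ) with hμd
  set μ₀ := ((coeffLaw.map (jet x)).prod (coeffLaw.map (jet y))).map fun r =>
    (Sum.elim r.1 r.2 : (Fin p ⊕ Fin p) ⊕ (Fin q ⊕ Fin q) → ℝ) with hμ₀d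
  have hsplit : ∀ t : (Fin p ⊕ Fin p) ⊕ (Fin q ⊕ Fin q) → ℝ,
      Sum.elim (t ∘ Sum.inl) (t ∘ Sum.inr) = t := fun t => Sum.elim_comp_inl_inr t
  have hQ₀ : ∀ u v, Sum.elim u v ⬝ᵥ A₀ *ᵥ Sum.elim u v
      = u ⬝ᵥ crossCov x x *ᵥ u + v ⬝ᵥ crossCov y y *ᵥ v := fun u v => by
    rw [hA₀, dotProduct_fromBlocks_mulVec]; simp
  have hQ : ∀ u v, Sum.elim u v ⬝ᵥ A *ᵥ Sum.elim u v
      = u ⬝ᵥ crossCov x x *ᵥ u + v ⬝ᵥ crossCov y y *ᵥ v + 2 * (u ⬝ᵥ crossCov x y *ᵥ v) := by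
    intro u v
    have h1 : v ⬝ᵥ crossCov y x *ᵥ u = u ⬝ᵥ crossCov x y *ᵥ v := by
      rw [← crossCov_transpose x y, Matrix.mulVec_transpose, dotProduct_comm,
        Matrix.dotProduct_mulVec]
    rw [hA, dotProduct_fromBlocks_mulVec, h1]
    ring
  have hQle : ∀ u v, |2 * (u ⬝ᵥ crossCov x y *ᵥ v)|
      ≤ δ * (u ⬝ᵥ crossCov x x *ᵥ u + v ⬝ᵥ crossCov y y *ᵥ v) := by
    intro u v
    rw [abs_mul, abs_two]
    have h1 := hcross u v
    have h2 := Real.sq_sqrt (jetCov_quad_nonneg x u)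
    have h3 := Real.sq_sqrt (jetCov_quad_nonneg y v)
    have h4 := two_mul_le_add_sq √(u ⬝ᵥ crossCov x x *ᵥ u) √(v ⬝ᵥ crossCov y y *ᵥ v)
    rw [h2, h3] at h4
    have h5 := mul_le_mul_of_nonneg_left h4 hδ
    linarith
  set P : NNReal := ⟨1 - δ, by linarith⟩ with hP
  set T : NNReal := ⟨1 + δ, by linarith⟩ with hT
  have hPv : (P : ℝ) = 1 - δ := rfl
  have hTv : (T : ℝ) = 1 + δ := rfl
  have hP0 : P ≠ 0 := fun h => by
    have := congrArg NNReal.toReal h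
    rw [hPv, NNReal.coe_zero] at this
    linarith
  set c : ℝ := √(1 + 4 * δ) with hc
  have hc2 : c ^ 2 = 1 + 4 * δ := Real.sq_sqrt (by linarith)
  have hcmp := fun {h : ((Fin p ⊕ Fin p) ⊕ (Fin q ⊕ Fin q) → ℝ) → ℝ≥0∞} (hh : Measurable h) =>
    hμ₀.lintegral_le_and_le hμ
    (by rw [hA₀, Matrix.fromBlocks_transpose, crossCov_transpose, crossCov_transpose]; simp)
    (by rw [hA, Matrix.fromBlocks_transpose]; simp only [crossCov_transpose])
    (fun t ht => by
      rw [← hsplit t, hQ₀]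
      have h1 := jetCov_quad_nonneg x (t ∘ Sum.inl)
      have h2 := jetCov_quad_nonneg y (t ∘ Sum.inr)
      refine lt_of_le_of_ne (add_nonneg h1 h2) fun h => ht ?_
      have h3 := eq_zero_of_jetCov_quad_eq_zero hx (u := t ∘ Sum.inl) (by linarith)
      have h4 := eq_zero_of_jetCov_quad_eq_zero hy (u := t ∘ Sum.inr) (by linarith)
      rw [← hsplit t, h3, h4]
      ext i; rcases i with i | i <;> rfl)
    hP0 (q := T)
    (fun t => by
      rw [← hsplit t, hQ₀, hQ, hPv]
      have := (abs_le.1 (hQle (t ∘ Sum.inl) (t ∘ Sum.inr))).1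
      linarith)
    (fun t => by
      rw [← hsplit t, hQ₀, hQ, hTv]
      have := (abs_le.1 (hQle (t ∘ Sum.inl) (t ∘ Sum.inr))).2
      linarith)
    (c := c) (Real.sqrt_nonneg (1 + 4 * δ))
    (by rw [hc2, hPv, hTv]; nlinarith) hh
  have hcard : Fintype.card ((Fin p ⊕ Fin p) ⊕ (Fin q ⊕ Fin q)) = 2 * (p + q) := by
    simp; ring
  rw [hcard, pow_mul, hc2] at hcmp
  set E : ℝ := (1 + 4 * δ) ^ (p + q) with hE
  have hE0 : 0 ≤ E := by positivity
  let h : ℝ → ((Fin p ⊕ Fin p) ⊕ (Fin q ⊕ Fin q) → ℝ) → ℝ≥0∞ := fun ε t =>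
    kacWeight ε (t ∘ Sum.inl) * kacWeight ε (t ∘ Sum.inr)
  have hhm : ∀ ε, Measurable (h ε) := fun ε => by
    refine ((measurable_kacWeight ε).comp ?_).mul ((measurable_kacWeight ε).comp ?_)
    · exact measurable_pi_iff.2 fun i => measurable_pi_apply (Sum.inl i)
    · exact measurable_pi_iff.2 fun i => measurable_pi_apply (Sum.inr i)
  have hHz : ∀ ε, ∫⁻ t, h ε t ∂μ = ∫⁻ a, kacWeight ε (jet z a) ∂coeffLaw := by
    intro ε
    have hm : Measurable fun a => (Sum.elim (jet x a) (jet y a) :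
        (Fin p ⊕ Fin p) ⊕ (Fin q ⊕ Fin q) → ℝ) :=
      measurable_pi_iff.2 fun i => by
        rcases i with i | i
        · exact (measurable_pi_apply i).comp (measurable_jet x)
        · exact (measurable_pi_apply i).comp (measurable_jet y)
    rw [hμd, lintegral_map (hhm ε) hm]
    refine lintegral_congr fun a => ?_
    obtain ⟨F, hF⟩ : ∃ F : ℝ → ℝ≥0∞, F = fun s => if |normSeries a s| < ε then
      ENNReal.ofReal (|normSeriesDeriv a s| / (2 * ε)) else 0 := ⟨_, rfl⟩
    have hw : ∀ {n : ℕ} (w : Fin n → ℝ), kacWeight ε (jet w a) = ∏ i, F (w i) := fun w => by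
      rw [hF]; rfl
    change kacWeight ε (jet x a) * kacWeight ε (jet y a) = kacWeight ε (jet z a)
    rw [hw, hw, hw, ← e.prod_comp, Fintype.prod_sum_type]
    simp only [hzx, hzy]
  have hHxy : ∀ {s : ℝ}, 0 < s → ∀ ε, ∫⁻ t, h ε (s • t) ∂μ₀
      = (∫⁻ a, kacWeight (ε / s) (jet x a) ∂coeffLaw) *
        ∫⁻ a, kacWeight (ε / s) (jet y a) ∂coeffLaw := by
    intro s hs ε
    have hm : Measurable fun r : (Fin p ⊕ Fin p → ℝ) × (Fin q ⊕ Fin q → ℝ) =>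
        (Sum.elim r.1 r.2 : (Fin p ⊕ Fin p) ⊕ (Fin q ⊕ Fin q) → ℝ) :=
      measurable_pi_iff.2 fun i => by
        rcases i with i | i
        · exact (measurable_pi_apply i).comp measurable_fst
        · exact (measurable_pi_apply i).comp measurable_snd
    have h1 := hasGaussianCov_map_jet x |>.isProbabilityMeasure
    have h2 := hasGaussianCov_map_jet y |>.isProbabilityMeasure
    have hhs : Measurable fun t => h ε (s • t) := (hhm ε).comp (measurable_const_smul s)
    rw [hμ₀d, lintegral_map hhs hm]
    have e1 : ∀ r : (Fin p ⊕ Fin p → ℝ) × (Fin q ⊕ Fin q → ℝ), h ε (s • Sum.elim r.1 r.2)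
        = kacWeight (ε / s) r.1 * kacWeight (ε / s) r.2 := by
      intro r
      rw [← kacWeight_smul hs, ← kacWeight_smul hs]
      rfl
    simp_rw [e1]
    rw [lintegral_prod_mul (measurable_kacWeight _).aemeasurable
      (measurable_kacWeight _).aemeasurable, lintegral_map (measurable_kacWeight _) (measurable_jet x),
      lintegral_map (measurable_kacWeight _) (measurable_jet y)]
  have hlimz := tendsto_lintegral_kacWeight hk hz
  have hlim : ∀ {s : ℝ}, 0 < s → Filter.Tendsto (fun ε => ∫⁻ t, h ε (s • t) ∂μ₀) (𝓝[>] 0)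
      (𝓝 (ENNReal.ofReal (intensity x * intensity y))) := by
    intro s hs
    simp_rw [hHxy hs]
    have hdiv : Filter.Tendsto (fun ε : ℝ => ε / s) (𝓝[>] 0) (𝓝[>] 0) := by
      refine tendsto_nhdsWithin_of_tendsto_nhds_of_eventually_within _ ?_ ?_
      · have : Filter.Tendsto (fun ε : ℝ => ε / s) (𝓝 0) (𝓝 (0 / s)) :=
          (continuous_id.div_const s).tendsto 0
        rw [zero_div] at this
        exact this.mono_left nhdsWithin_le_nhds
      · filter_upwards [self_mem_nhdsWithin] with ε hε
        exact div_pos hε hs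
    rw [ENNReal.ofReal_mul (intensity_nonneg x)]
    exact ENNReal.Tendsto.mul ((tendsto_lintegral_kacWeight hp hx).comp hdiv)
      (Or.inr ENNReal.ofReal_ne_top) ((tendsto_lintegral_kacWeight hq hy).comp hdiv)
      (Or.inr ENNReal.ofReal_ne_top)
  have hxy0 : 0 ≤ intensity x * intensity y := mul_nonneg (intensity_nonneg x) (intensity_nonneg y)
  constructor
  · refine (ENNReal.ofReal_le_ofReal_iff (by positivity)).1 ?_
    rw [ENNReal.ofReal_mul hE0]
    refine le_of_tendsto_of_tendsto' hlimz (ENNReal.Tendsto.const_mul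
      (hlim (s := √T) (Real.sqrt_pos.2 (by rw [hTv]; linarith))) (Or.inr ENNReal.ofReal_ne_top))
      fun ε => ?_
    rw [← hHz]
    exact (hcmp (hhm ε)).1
  · refine (ENNReal.ofReal_le_ofReal_iff (mul_nonneg hE0 (intensity_nonneg z))).1 ?_
    rw [ENNReal.ofReal_mul hE0]
    refine le_of_tendsto_of_tendsto' (hlim (s := √P) (Real.sqrt_pos.2 (by rw [hPv]; linarith)))
      (ENNReal.Tendsto.const_mul hlimz (Or.inr ENNReal.ofReal_ne_top)) fun ε => ?_
    rw [← hHz]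
    exact (hcmp (hhm ε)).2

end Clustering

section ClusterBounds

theorem intensity_sub_const {m : ℕ} (hm : m ≠ 0) (x : Fin m → ℝ) (c : ℝ) :
    intensity (fun i => x i - c) = intensity x := by
  have hinj : Function.Injective (fun i => x i - c) ↔ Function.Injective x :=
    ⟨fun h i j hij => h (by simp only [hij]), fun h i j hij => h (sub_left_injective hij)⟩
  by_cases hx : Function.Injective x
  · have h1 := hasGaussianCov_map_jet fun i => x i - c
    rw [crossCov_sub] at h1
    have h2 := h1.unique (hasGaussianCov_map_jet x)
    have h3 := tendsto_lintegral_kacWeight hm (hinj.2 hx)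
    have h4 := tendsto_lintegral_kacWeight hm hx
    have h5 : ∀ (y : Fin m → ℝ) (ε : ℝ), ∫⁻ a, kacWeight ε (jet y a) ∂coeffLaw
        = ∫⁻ t, kacWeight ε t ∂(coeffLaw.map (jet y)) := fun y ε =>
      (lintegral_map (measurable_kacWeight ε) (measurable_jet y)).symm
    simp_rw [h5] at h3 h4
    rw [h2] at h3
    have h6 := tendsto_nhds_unique h3 h4
    exact (ENNReal.ofReal_eq_ofReal_iff (intensity_nonneg _) (intensity_nonneg _)).1 h6
  · rw [intensity_eq_zero hx, intensity_eq_zero (mt hinj.1 hx)]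

theorem exists_abs_crossCov_le_uniform (k : ℕ) : ∃ C : ℝ, 0 ≤ C ∧ ∀ p q : ℕ, p ≤ k → q ≤ k →
    ∀ (x : Fin p → ℝ) (y : Fin q → ℝ) {d : ℝ}, 2 ≤ d → (∀ i j, d ≤ |x i - y j|) →
    ∀ (u : Fin p ⊕ Fin p → ℝ) (v : Fin q ⊕ Fin q → ℝ),
    |u ⬝ᵥ crossCov x y *ᵥ v| ≤ C * Real.exp (-((d - 2) ^ 2 / 2))
      * √(u ⬝ᵥ crossCov x x *ᵥ u) * √(v ⬝ᵥ crossCov y y *ᵥ v) := by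
  choose C hC0 hC using exists_abs_crossCov_le
  have hs : ∀ p, 0 ≤ ∑ q ∈ Finset.range (k + 1), C p q := fun p =>
    Finset.sum_nonneg fun q _ => hC0 p q
  refine ⟨∑ p ∈ Finset.range (k + 1), ∑ q ∈ Finset.range (k + 1), C p q,
    Finset.sum_nonneg fun p _ => hs p, ?_⟩
  intro p q hp hq x y d hd hxy u v
  refine (hC p q (by simp) (by simp) x y hd hxy u v).trans ?_
  have h1 : C p q ≤ ∑ p ∈ Finset.range (k + 1), ∑ q ∈ Finset.range (k + 1), C p q :=
    (Finset.single_le_sum (f := fun q => C p q) (fun q _ => hC0 p q)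
      (Finset.mem_range.2 (by omega))).trans
    (Finset.single_le_sum (f := fun p => ∑ q ∈ Finset.range (k + 1), C p q) (fun p _ => hs p)
      (Finset.mem_range.2 (by omega)))
  gcongr

theorem one_add_pow_le {t : ℝ} (ht : 0 ≤ t) (ht2 : t ≤ 2) (n : ℕ) :
    (1 + t) ^ n ≤ 1 + t * 4 ^ n := by
  induction n with
  | zero => simpa using ht
  | succ n ih =>
    have h4 : (1 : ℝ) ≤ 4 ^ n := one_le_pow₀ (by norm_num)
    calc (1 + t) ^ (n + 1) = (1 + t) ^ n * (1 + t) := pow_succ _ _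
      _ ≤ (1 + t * 4 ^ n) * (1 + t) := by gcongr
      _ = 1 + t * (1 + 4 ^ n + t * 4 ^ n) := by ring
      _ ≤ 1 + t * (4 ^ n + 4 ^ n + 2 * 4 ^ n) := by gcongr
      _ = _ := by ring

/-- A two-block partition of `Fin k` as an equivalence with the disjoint union of the blocks. -/
noncomputable def partitionEquiv {k : ℕ} {I J : Finset (Fin k)} (hd : Disjoint I J)
    (hu : I ∪ J = Finset.univ) : Fin I.card ⊕ Fin J.card ≃ Fin k :=
  Equiv.ofBijective (Sum.elim (I.orderEmbOfFin rfl) (J.orderEmbOfFin rfl)) (by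
    constructor
    · refine (I.orderEmbOfFin rfl).injective.sumElim (J.orderEmbOfFin rfl).injective fun i j h => ?_
      exact Finset.disjoint_left.1 hd (I.orderEmbOfFin_mem rfl i)
        (h ▸ J.orderEmbOfFin_mem rfl j)
    · intro l
      have hl : l ∈ I ∪ J := hu ▸ Finset.mem_univ l
      rcases Finset.mem_union.1 hl with h | h
      · have : l ∈ Set.range (I.orderEmbOfFin rfl) := by rw [Finset.range_orderEmbOfFin]; exact h
        obtain ⟨i, hi⟩ := this
        exact ⟨Sum.inl i, hi⟩
      · have : l ∈ Set.range (J.orderEmbOfFin rfl) := by rw [Finset.range_orderEmbOfFin]; exact h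
        obtain ⟨i, hi⟩ := this
        exact ⟨Sum.inr i, hi⟩)

/-- Two-sided multiplicative clustering of the intensities. -/
theorem exists_intensity_cluster (k : ℕ) : ∃ D C : ℝ, 2 ≤ D ∧ 0 ≤ C ∧
    ∀ (z : Fin k → ℝ) (I J : Finset (Fin k)), I.Nonempty → J.Nonempty → Disjoint I J →
    I ∪ J = Finset.univ → Function.Injective z → ∀ d : ℝ, D ≤ d →
    (∀ i ∈ I, ∀ j ∈ J, d ≤ |z i - z j|) →
    intensity z ≤ (1 + C * Real.exp (-((d - 2) ^ 2 / 2))) *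
        (intensity (subConfig z I) * intensity (subConfig z J)) ∧
      intensity (subConfig z I) * intensity (subConfig z J)
        ≤ (1 + C * Real.exp (-((d - 2) ^ 2 / 2))) * intensity z := by
  obtain ⟨C, hC0, hC⟩ := exists_abs_crossCov_le_uniform k
  refine ⟨2 + 2 * C, 4 * C * 4 ^ k, by linarith, by positivity, ?_⟩
  intro z I J hI hJ hd hu hz d hDd hsep
  set δ := C * Real.exp (-((d - 2) ^ 2 / 2)) with hδ
  have hδ0 : 0 ≤ δ := by positivity
  have hδ2 : δ ≤ 1 / 2 := by
    rw [hδ, Real.exp_neg, ← div_eq_mul_inv, div_le_iff₀ (Real.exp_pos _)]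
    have h1 := Real.add_one_le_exp ((d - 2) ^ 2 / 2)
    have h2 : (2 * C) ^ 2 ≤ (d - 2) ^ 2 := pow_le_pow_left₀ (by positivity) (by linarith) 2
    nlinarith [sq_nonneg (C - 1 / 2)]
  have hcard : I.card + J.card = k := by
    rw [← Finset.card_union_of_disjoint hd, hu, Finset.card_univ, Fintype.card_fin]
  have hIc := hI.card_pos
  have hJc := hJ.card_pos
  have key := intensity_le_and_le (x := subConfig z I) (y := subConfig z J) hIc.ne' hJc.ne'
    (by omega) hz (partitionEquiv hd hu) (fun i => rfl) (fun j => rfl) hδ0 hδ2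
    (hC _ _ (by omega) (by omega) _ _ (by linarith)
      fun i j => hsep _ (I.orderEmbOfFin_mem rfl i) _ (J.orderEmbOfFin_mem rfl j))
  rw [hcard] at key
  have hpow : (1 + 4 * δ) ^ k ≤ 1 + 4 * C * 4 ^ k * Real.exp (-((d - 2) ^ 2 / 2)) := by
    refine (one_add_pow_le (by linarith) (by linarith) k).trans_eq ?_
    rw [hδ]; ring
  exact ⟨key.1.trans (mul_le_mul_of_nonneg_right hpow
    (mul_nonneg (intensity_nonneg _) (intensity_nonneg _))),
    key.2.trans (mul_le_mul_of_nonneg_right hpow (intensity_nonneg _))⟩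

/-- A configuration without large gaps has bounded diameter. -/
theorem abs_sub_le_of_forall_exists_lt {m : ℕ} {D : ℝ} (hD : 0 ≤ D) (x : Fin m → ℝ) (i₀ : Fin m)
    (h : ∀ I : Finset (Fin m), I.Nonempty → Iᶜ.Nonempty →
      ∃ i ∈ I, ∃ j ∈ Iᶜ, |x i - x j| < D) (i : Fin m) : |x i - x i₀| ≤ m * D := by
  classical
  have key : ∀ t : ℕ, (Finset.univ.filter fun i => |x i - x i₀| ≤ t * D) = Finset.univ ∨
      t + 1 ≤ (Finset.univ.filter fun i => |x i - x i₀| ≤ t * D).card := by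
    intro t
    induction t with
    | zero =>
      refine Or.inr (Finset.card_pos.2 ⟨i₀, by simp⟩)
    | succ t ih =>
      have hsub : (Finset.univ.filter fun i => |x i - x i₀| ≤ t * D) ⊆
          Finset.univ.filter fun i => |x i - x i₀| ≤ ((t + 1 : ℕ) : ℝ) * D := by
        refine Finset.monotone_filter_right _ fun i _ hi => ?_
        push_cast
        linarith
      rcases ih with ih | ih
      · exact Or.inl (Finset.eq_univ_iff_forall.2 fun i => hsub (by rw [ih]; exact Finset.mem_univ i))
      · by_cases hne : (Finset.univ.filter fun i => |x i - x i₀| ≤ t * D)ᶜ.Nonempty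
        · obtain ⟨i, hi, j, hj, hij⟩ := h _ (Finset.card_pos.1 (by omega)) hne
          refine Or.inr (Nat.succ_le_of_lt (lt_of_le_of_lt ih (Finset.card_lt_card ?_)))
          refine (Finset.ssubset_iff_of_subset hsub).2 ⟨j, ?_, by simpa using hj⟩
          simp only [Finset.mem_filter, Finset.mem_univ, true_and] at hi ⊢
          have h1 := abs_sub_le (x j) (x i) (x i₀)
          rw [abs_sub_comm (x j) (x i)] at h1
          push_cast
          linarith
        · have h2 := Finset.not_nonempty_iff_eq_empty.1 hne
          rw [Finset.compl_eq_empty_iff] at h2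
          exact Or.inl (Finset.eq_univ_iff_forall.2 fun i => hsub (by rw [h2]; exact Finset.mem_univ i))
  have hm : (Finset.univ.filter fun i => |x i - x i₀| ≤ m * D) = Finset.univ := by
    refine (key m).resolve_right fun hcon => ?_
    have := Finset.card_le_univ (Finset.univ.filter fun i => |x i - x i₀| ≤ m * D)
    rw [Fintype.card_fin] at this
    omega
  have := Finset.mem_univ i
  rw [← hm] at this
  simpa using this

theorem exists_intensity_le (m : ℕ) : ∃ B : ℝ, 0 ≤ B ∧ ∀ n ≤ m, n ≠ 0 →
    ∀ x : Fin n → ℝ, intensity x ≤ B := by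
  induction m with
  | zero => exact ⟨0, le_rfl, fun n hn hn0 => (hn0 (by omega)).elim⟩
  | succ m ih =>
    obtain ⟨B, hB0, hB⟩ := ih
    obtain ⟨D, C, hD, hC0, hcl⟩ := exists_intensity_cluster (m + 1)
    obtain ⟨L, hL⟩ := (isCompact_closedBall (0 : Fin (m + 1) → ℝ) ((m + 1 : ℕ) * D)).exists_bound_of_continuousOn
      (continuous_intensity (m := m + 1) m.succ_ne_zero).continuousOn
    have hL0 : 0 ≤ L := (norm_nonneg _).trans (hL 0 (by
      rw [mem_closedBall_zero_iff, norm_zero]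
      have : 0 ≤ D := by linarith
      positivity))
    refine ⟨B + L + (1 + C) * (B * B), by positivity, fun n hn hn0 x => ?_⟩
    rcases Nat.lt_or_ge n (m + 1) with h | h
    · have h1 := hB n (by omega) hn0 x
      have h2 : 0 ≤ (1 + C) * (B * B) := by positivity
      linarith
    obtain rfl : n = m + 1 := by omega
    by_cases hx : Function.Injective x
    swap
    · rw [intensity_eq_zero hx]; positivity
    by_cases hgap : ∀ I : Finset (Fin (m + 1)), I.Nonempty → Iᶜ.Nonempty →
      ∃ i ∈ I, ∃ j ∈ Iᶜ, |x i - x j| < D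
    · have h1 := abs_sub_le_of_forall_exists_lt (by linarith) x 0 hgap
      have h2 : (fun i => x i - x 0) ∈ Metric.closedBall (0 : Fin (m + 1) → ℝ) ((m + 1 : ℕ) * D) := by
        rw [mem_closedBall_zero_iff]
        refine (pi_norm_le_iff_of_nonneg ?_).2 h1
        have : 0 ≤ D := by linarith
        positivity
      have h3 := hL _ h2
      rw [intensity_sub_const m.succ_ne_zero] at h3
      have h4 := (le_abs_self _).trans h3
      have h5 : 0 ≤ (1 + C) * (B * B) := by positivity
      linarith
    · push Not at hgap
      obtain ⟨I, hI, hJ, hsep⟩ := hgap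
      have h1 := (hcl x I Iᶜ hI hJ disjoint_compl_right (Finset.union_compl I) hx D le_rfl hsep).1
      have hIJ : I.card + Iᶜ.card = m + 1 := by rw [Finset.card_add_card_compl, Fintype.card_fin]
      have hI' := hI.card_pos
      have hJ' := hJ.card_pos
      have h2 := hB _ (by omega) hI'.ne' (subConfig x I)
      have h3 := hB _ (by omega) hJ'.ne' (subConfig x Iᶜ)
      have h4 : Real.exp (-((D - 2) ^ 2 / 2)) ≤ 1 := Real.exp_le_one_iff.2 (by
        have := sq_nonneg (D - 2); linarith)
      have h5 := intensity_nonneg (subConfig x I)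
      have h6 := intensity_nonneg (subConfig x Iᶜ)
      calc intensity x ≤ _ := h1
        _ ≤ (1 + C * 1) * (B * B) := by gcongr
        _ ≤ _ := by rw [mul_one]; linarith

/-- The clustering estimates for the intensities. -/
theorem exists_intensity_clustering (k : ℕ) : ∃ Δ C : ℝ, 0 < Δ ∧ 0 < C ∧
    ∀ (x : Fin k → ℝ) (I J : Finset (Fin k)), I.Nonempty → J.Nonempty → Disjoint I J →
    I ∪ J = Finset.univ → ∀ d : ℝ, 2 * Δ ≤ d → (∀ i ∈ I, ∀ j ∈ J, d ≤ |x i - x j|) →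
    (Function.Injective x → 0 < intensity (subConfig x I) ∧ 0 < intensity (subConfig x J) ∧
      |intensity x / (intensity (subConfig x I) * intensity (subConfig x J)) - 1|
        ≤ C * Real.exp (-(1 / 2) * (d - Δ) ^ 2)) ∧
    |intensity x - intensity (subConfig x I) * intensity (subConfig x J)|
        ≤ C * Real.exp (-(1 / 2) * (d - Δ) ^ 2) := by
  obtain ⟨D, C, hD, hC0, hcl⟩ := exists_intensity_cluster k
  obtain ⟨B, hB0, hB⟩ := exists_intensity_le k
  refine ⟨D, 1 + C * (1 + B + B * B), by linarith, by positivity, ?_⟩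
  intro x I J hI hJ hdis hu d hd hsep
  set E := Real.exp (-(1 / 2) * (d - D) ^ 2) with hE
  have hE0 : 0 < E := Real.exp_pos _
  set η := C * Real.exp (-((d - 2) ^ 2 / 2)) with hη
  have hηE : η ≤ C * E := by
    refine mul_le_mul_of_nonneg_left (Real.exp_le_exp.2 ?_) hC0
    have : (d - D) ^ 2 ≤ (d - 2) ^ 2 := pow_le_pow_left₀ (by linarith) (by linarith) 2
    linarith
  have hη0 : 0 ≤ η := by positivity
  have hcard : I.card + J.card = k := by
    rw [← Finset.card_union_of_disjoint hdis, hu, Finset.card_univ, Fintype.card_fin]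
  have hIc := hI.card_pos
  have hJc := hJ.card_pos
  have hfin : ∀ t : ℝ, 0 ≤ t → t ≤ 1 + B + B * B → η * t ≤ (1 + C * (1 + B + B * B)) * E := by
    intro t ht0 ht
    calc η * t ≤ (C * E) * (1 + B + B * B) := by gcongr
      _ ≤ _ := by nlinarith
  by_cases hx : Function.Injective x
  · have hxI : Function.Injective (subConfig x I) := fun i j h =>
      (I.orderEmbOfFin rfl).injective (hx h)
    have hxJ : Function.Injective (subConfig x J) := fun i j h =>
      (J.orderEmbOfFin rfl).injective (hx h)
    have hpI := intensity_pos hIc.ne' hxI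
    have hpJ := intensity_pos hJc.ne' hxJ
    have hpx := intensity_pos (by omega) hx
    obtain ⟨h1, h2⟩ := hcl x I J hI hJ hdis hu hx d (by linarith) hsep
    rw [← hη] at h1 h2
    have hxB := hB k le_rfl (by omega) x
    have hIB := hB _ (by omega) hIc.ne' (subConfig x I)
    have hJB := hB _ (by omega) hJc.ne' (subConfig x J)
    set a := intensity x with ha
    set b := intensity (subConfig x I) * intensity (subConfig x J) with hb
    have hb0 : 0 < b := mul_pos hpI hpJ
    have hbB : b ≤ B * B := mul_le_mul hIB hJB hpJ.le hB0
    refine ⟨fun _ => ⟨hpI, hpJ, ?_⟩, ?_⟩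
    · refine le_trans ?_ (hfin 1 zero_le_one (by nlinarith))
      rw [mul_one, abs_le]
      constructor
      · have : 1 - η ≤ a / b := by
          rw [le_div_iff₀ hb0]
          nlinarith [sq_nonneg η]
        linarith
      · have : a / b ≤ 1 + η := by
          rw [div_le_iff₀ hb0]
          exact h1
        linarith
    · rw [abs_le]
      have h3 := hfin a hpx.le (by nlinarith)
      have h4 := hfin b hb0.le (by linarith)
      constructor <;> linarith
  · refine ⟨fun h => (hx h).elim, ?_⟩
    have h0 : intensity (subConfig x I) * intensity (subConfig x J) = 0 := by
      by_contra hne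
      obtain ⟨h1, h2⟩ := mul_ne_zero_iff.1 hne
      have hxI : Function.Injective (subConfig x I) :=
        not_not.1 fun h => h1 (intensity_eq_zero h)
      have hxJ : Function.Injective (subConfig x J) :=
        not_not.1 fun h => h2 (intensity_eq_zero h)
      refine hx ?_
      have h3 : Function.Injective (x ∘ partitionEquiv hdis hu) := by
        have e : x ∘ partitionEquiv hdis hu = Sum.elim (subConfig x I) (subConfig x J) := by
          ext i; rcases i with i | i <;> rfl
        rw [e]
        refine hxI.sumElim hxJ fun i j h => ?_
        have h4 := hsep _ (I.orderEmbOfFin_mem rfl i) _ (J.orderEmbOfFin_mem rfl j)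
        have h5 : x (I.orderEmbOfFin rfl i) = x (J.orderEmbOfFin rfl j) := h
        rw [h5, sub_self, abs_zero] at h4
        linarith
      exact ((partitionEquiv hdis hu).injective_comp x).1 h3
    rw [h0, intensity_eq_zero hx, sub_zero, abs_zero]
    positivity

end ClusterBounds

section Correlation

variable {m : ℕ}

theorem integrable_zeroSum_of_nonneg (hm : m ≠ 0) {f : (Fin m → ℝ) → ℝ} (hf : Continuous f)
    (hfc : HasCompactSupport f) (hf0 : ∀ x, 0 ≤ f x) : Integrable (zeroSum f) coeffLaw ∧
      ∫ a, zeroSum f a ∂coeffLaw = ∫ x, f x * intensity x := by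
  have hc : Continuous fun x => f x * intensity x := hf.mul (continuous_intensity hm)
  have hi : Integrable fun x => f x * intensity x :=
    hc.integrable_of_hasCompactSupport hfc.mul_right
  have h0 : ∀ x, 0 ≤ f x * intensity x := fun x => mul_nonneg (hf0 x) (intensity_nonneg x)
  have hz0 : ∀ a, 0 ≤ zeroSum f a := fun a => tsum_nonneg fun x => hf0 x
  have hzm := (aemeasurable_zeroSum hf hfc).aestronglyMeasurable
  have key : ∫⁻ a, ENNReal.ofReal (zeroSum f a) ∂coeffLaw
      = ∫⁻ x, ENNReal.ofReal (f x * intensity x) := by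
    rw [lintegral_zeroSum hf hfc hf0]
    refine lintegral_congr fun x => ?_
    rw [ENNReal.ofReal_mul (hf0 x), ofReal_intensity hm]
  constructor
  · rw [← lintegral_ofReal_ne_top_iff_integrable hzm (.of_forall hz0), key]
    exact (lintegral_ofReal_ne_top_iff_integrable hi.1 (.of_forall h0)).2 hi
  · rw [integral_eq_lintegral_of_nonneg_ae (.of_forall hz0) hzm, key,
      integral_eq_lintegral_of_nonneg_ae (.of_forall h0) hi.1]

theorem integrable_zeroSum (hm : m ≠ 0) {f : (Fin m → ℝ) → ℝ} (hf : Continuous f)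
    (hfc : HasCompactSupport f) : Integrable (zeroSum f) coeffLaw ∧
      ∫ a, zeroSum f a ∂coeffLaw = ∫ x, f x * intensity x := by
  set g : (Fin m → ℝ) → ℝ := fun x => max (f x) 0 with hg
  set h : (Fin m → ℝ) → ℝ := fun x => max (-f x) 0 with hh
  have hgc : Continuous g := hf.max continuous_const
  have hhc : Continuous h := hf.neg.max continuous_const
  have hgs : HasCompactSupport g :=
    hfc.comp_left (g := fun t : ℝ => max t 0) (by simp)
  have hhs : HasCompactSupport h :=
    hfc.comp_left (g := fun t : ℝ => max (-t) 0) (by simp)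
  have hfgh : ∀ x, f x = g x - h x := fun x => by
    simp only [hg, hh]
    rcases le_total 0 (f x) with h0 | h0
    · rw [max_eq_left h0, max_eq_right (by linarith), sub_zero]
    · rw [max_eq_right h0, max_eq_left (by linarith)]; ring
  obtain ⟨hgi, hge⟩ := integrable_zeroSum_of_nonneg hm hgc hgs fun x => le_max_right _ _
  obtain ⟨hhi, hhe⟩ := integrable_zeroSum_of_nonneg hm hhc hhs fun x => le_max_right _ _
  have hae : zeroSum f =ᵐ[coeffLaw] fun a => zeroSum g a - zeroSum h a := by
    filter_upwards [ae_hasGrowth, ae_simpleZeros] with a ⟨S, hS⟩ hs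
    have h1 := (hasSum_zeroSum hS hs hgs).sub (hasSum_zeroSum hS hs hhs)
    simp only [← hfgh] at h1
    exact h1.tsum_eq
  refine ⟨(hgi.sub hhi).congr hae.symm, ?_⟩
  have hint : ∀ {u : (Fin m → ℝ) → ℝ}, Continuous u → HasCompactSupport u →
      Integrable fun x => u x * intensity x := fun hu hus =>
    (hu.mul (continuous_intensity hm)).integrable_of_hasCompactSupport hus.mul_right
  rw [integral_congr_ae hae, integral_sub hgi hhi, hge, hhe,
    ← integral_sub (hint hgc hgs) (hint hhc hhs)]
  simp only [hfgh, sub_mul]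

/-- The joint law of a standard Gaussian sequence. -/
theorem IsStdGaussianSeq.hasLaw {Ω : Type*} [MeasurableSpace Ω] {P : Measure Ω}
    {ξ : ℕ → Ω → ℝ} (h : IsStdGaussianSeq P ξ) : HasLaw (fun ω n => ξ n ω) coeffLaw P :=
  iIndepFun.hasLaw_infinitePi h.law h.indep (aemeasurable_pi_iff.2 fun n => (h.law n).aemeasurable)

theorem zeroTupleSum_ae_eq_zeroSum (f : (Fin m → ℝ) → ℝ) :
    ∀ᵐ a ∂coeffLaw, zeroTupleSum (weylSeries a) m f = zeroSum f a := by
  filter_upwards [ae_hasGrowth, ae_simpleZeros] with a ⟨S, hS⟩ hs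
  exact zeroTupleSum_eq hS hs m f

/-- The intensity is a correlation function of the zeros of the random Weyl series. -/
theorem isCorrelationFunction_intensity (hm : m ≠ 0) {Ω : Type*} [MeasurableSpace Ω]
    {P : Measure Ω} {ξ : ℕ → Ω → ℝ} (h : IsStdGaussianSeq P ξ) :
    IsCorrelationFunction P (fun ω => weylSeries (fun n => ξ n ω)) m intensity := by
  have hL := h.hasLaw
  have hae : ∀ f : (Fin m → ℝ) → ℝ, (fun ω => zeroTupleSum (weylSeries fun n => ξ n ω) m f)
      =ᵐ[P] fun ω => zeroSum f fun n => ξ n ω := fun f => by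
    have h1 := zeroTupleSum_ae_eq_zeroSum f
    rw [← hL.map_eq] at h1
    exact ae_of_ae_map hL.aemeasurable h1
  refine ⟨(continuous_intensity hm).locallyIntegrable, fun f hf hfc => ?_, fun f hf hfc => ?_⟩
  · have h1 := (integrable_zeroSum hm hf.continuous hfc).1
    rw [← hL.map_eq] at h1
    exact (h1.comp_aemeasurable hL.aemeasurable).congr (hae f).symm
  · have h1 := integrable_zeroSum hm hf.continuous hfc
    rw [integral_congr_ae (hae f), ← h1.2, ← hL.map_eq]
    refine (integral_map hL.aemeasurable ?_).symm
    rw [hL.map_eq]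
    exact h1.1.aestronglyMeasurable

theorem IsCorrelationFunction.eq_of_continuous {Ω : Type*} [MeasurableSpace Ω] {P : Measure Ω}
    {F : Ω → ℝ → ℝ} {r s : (Fin m → ℝ) → ℝ} (hr : IsCorrelationFunction P F m r)
    (hs : IsCorrelationFunction P F m s) (hrc : Continuous r) (hsc : Continuous s) : r = s := by
  refine (hrc.ae_eq_iff_eq volume hsc).1 ?_
  refine ae_eq_of_integral_contDiff_smul_eq hr.locallyIntegrable hs.locallyIntegrable
    fun g hg hgc => ?_
  simp only [smul_eq_mul]
  rw [← hr.integral_sum g hg hgc, ← hs.integral_sum g hg hgc]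

theorem clusterDist_le {k : ℕ} (x : Fin k → ℝ) {I J : Finset (Fin k)} {i j : Fin k} (hi : i ∈ I)
    (hj : j ∈ J) : clusterDist x I J ≤ |x i - x j| :=
  ciInf_le (f := fun p : I × J => |x p.1 - x p.2|) ⟨0, by rintro _ ⟨p, rfl⟩; positivity⟩
    (⟨i, hi⟩, ⟨j, hj⟩)

end Correlation

theorem lemma7p3 (k : ℕ) :
    ∃ Δ C : ℝ, 0 < Δ ∧ 0 < C ∧
      ∀ (Ω : Type*) [MeasurableSpace Ω] (P : Measure Ω) [IsProbabilityMeasure P]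
        (ξ : ℕ → Ω → ℝ), IsStdGaussianSeq P ξ →
        -- the correlation functions exist and have continuous versions
        (∀ m : ℕ, 1 ≤ m → ∃ r : (Fin m → ℝ) → ℝ, Continuous r ∧
          IsCorrelationFunction P (fun ω => weylSeries (fun n => ξ n ω)) m r) ∧
        -- and the continuous versions satisfy the clustering estimates
        ∀ ρ : (m : ℕ) → (Fin m → ℝ) → ℝ,
          (∀ m : ℕ, 1 ≤ m → Continuous (ρ m) ∧
            IsCorrelationFunction P (fun ω => weylSeries (fun n => ξ n ω)) m (ρ m)) →
          ∀ (x : Fin k → ℝ) (I J : Finset (Fin k)), I.Nonempty → J.Nonempty →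
            Disjoint I J → I ∪ J = Finset.univ → 2 * Δ ≤ clusterDist x I J →
            (Function.Injective x →
              0 < ρ I.card (subConfig x I) ∧ 0 < ρ J.card (subConfig x J) ∧
              |ρ k x / (ρ I.card (subConfig x I) * ρ J.card (subConfig x J)) - 1|
                ≤ C * Real.exp (-(1 / 2) * (clusterDist x I J - Δ) ^ 2)) ∧
            |ρ k x - ρ I.card (subConfig x I) * ρ J.card (subConfig x J)|
              ≤ C * Real.exp (-(1 / 2) * (clusterDist x I J - Δ) ^ 2) := by
  obtain ⟨Δ, C, hΔ, hC, h⟩ := exists_intensity_clustering k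
  refine ⟨Δ, C, hΔ, hC, fun Ω _ P _ ξ hξ => ⟨fun m hm => ⟨intensity,
    continuous_intensity (by omega), isCorrelationFunction_intensity (by omega) hξ⟩, ?_⟩⟩
  intro ρ hρ x I J hI hJ hdis hu hd
  have heq : ∀ m, 1 ≤ m → ρ m = intensity := fun m hm =>
    (hρ m hm).2.eq_of_continuous (isCorrelationFunction_intensity (by omega) hξ) (hρ m hm).1
      (continuous_intensity (by omega))
  have hk : 1 ≤ k := by
    obtain ⟨i, -⟩ := hI
    exact i.pos
  rw [heq k hk, heq _ hI.card_pos, heq _ hJ.card_pos]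
  exact h x I J hI hJ hdis hu _ hd fun i hi j hj => clusterDist_le x hi hj
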